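/- **Theorem (Existence and uniqueness for the linear problems).** Let $T>0$, let $k\ge 3$ and $s$ be real numbers with $0\le s+\tfrac32\le k$ (so $s$ may be negative, down to $-\tfrac32$), let $l\ge 2$ be an integer, and let $V\in H^l([0,T];H^k(\mathbb R))$ be real-valued. Let $H$ be the Hilbert transform, $\widehat{Hf}(\xi)=-i\,\mathrm{sgn}(\xi)\hat f(\xi)$. (i) For all $u_0\in H^{s+3/2}(\mathbb R)$ and $u_1\in H^s(\mathbb R)$ the problem $$\partial_t^2u-H\partial_\alpha^3u+2V\partial_\alpha\partial_tu+V^2\partial_\alpha^2u=0\ \text{ on }[0,T]\times\mathbb R,\qquad u(0)=u_0,\quad \partial_tu(0)=u_1,$$ has a solution $u$ with $$\|u\|_{L^\infty([0,T];H^{s+3/2})}+\|\partial_tu\|_{L^\infty([0,T];H^s)}\le C_1\big(\|u_0\|_{H^{s+3/2}}+\|u_1\|_{H^s}\big),$$ and it is the only solution with $u\in L^\infty([0,T];H^{s+3/2})$ and $\partial_tu\in L^\infty([0,T];H^s)$. (ii) For every $R\in L^2([0,T];H^s(\mathbb R))$ the problem $$\partial_t^2v-H\partial_\alpha^3v+2V\partial_\alpha\partial_tv+V^2\partial_\alpha^2v=R\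 \text{ on }[0,T]\times\mathbb R,\qquad v(0)=0,\quad \partial_tv(0)=0,$$ has a solution $v$ with $$\|\partial_tv\|_{L^\infty([0,T];H^s)}+\|v\|_{L^\infty([0,T];H^{s+3/2})}\le C_2\|R\|_{L^2([0,T];H^s)},$$ and it is the only solution with $v\in L^\infty([0,T];H^{s+3/2})$ and $\partial_tv\in L^\infty([0,T];H^s)$. Here $C_i=\exp\big(P_i(\|V\|_{L^\infty([0,T];H^k)},\|\partial_tV\|_{L^\infty([0,T];H^k)})\big)$, where $P_1,P_2$ are real polynomials in two variables that depend only on $T,k,s$. Functions are complex-valued unless said otherwise, and solutions are understood in the sense of distributions, the initial values being those of the weakly continuous representatives of $u$ and $\partial_tu$. -/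

import Mathlib

open MeasureTheory Set FourierTransform TemperedDistribution
open scoped SchwartzMap ENNReal

noncomputable section

namespace WaterWave

/-- The norm `‖f‖_{H^s(ℝ)} = ‖⟨D⟩^s f‖_{L²}` of a tempered distribution, with value `∞` when `f ∉ H^s`
(the `L²` representative of the Bessel potential is unique, so the infimum has at most one term). -/
def sobolevNorm (s : ℝ) (f : 𝓢'(ℝ, ℂ)) : ℝ≥0∞ :=
  ⨅ (g : Lp ℂ 2 (volume : Measure ℝ)) (_ : besselPotential ℝ ℂ s f = g), ‖g‖ₑ

/-- The norm of `L^∞([0,T]; H^s(ℝ))`. -/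
def linftyNorm (T s : ℝ) (f : ℝ → 𝓢'(ℝ, ℂ)) : ℝ≥0∞ :=
  essSup (fun t => sobolevNorm s (f t)) (volume.restrict (Icc 0 T))

/-- The norm of `L²([0,T]; H^s(ℝ))`. -/
def l2Norm (T s : ℝ) (f : ℝ → 𝓢'(ℝ, ℂ)) : ℝ≥0∞ :=
  (∫⁻ t in Icc 0 T, sobolevNorm s (f t) ^ 2) ^ (1 / 2 : ℝ)

/-- `f ∈ L²([0,T]; H^s(ℝ))`. As `H^s` is separable and Schwartz functions are dense in its dual,
strong measurability is the same as measurability of `t ↦ ⟨f(t), φ⟩` for all Schwartz `φ`. -/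
structure MemL2 (T s : ℝ) (f : ℝ → 𝓢'(ℝ, ℂ)) : Prop where
  measurable : ∀ φ : 𝓢(ℝ, ℂ), AEMeasurable (fun t => f t φ) (volume.restrict (Icc 0 T))
  norm_lt_top : l2Norm T s f < ∞

/-- `∂_t f = g` on `[0,T]` in the weak sense: tested against any Schwartz function `φ` of the space
variable, `f` is absolutely continuous in time with integrable derivative `g`. -/
def HasWeakTimeDeriv (T : ℝ) (f : ℝ → 𝓢'(ℝ, ℂ)) (g : ℝ → 𝓢(ℝ, ℂ) → ℂ) : Prop :=
  ∀ φ : 𝓢(ℝ, ℂ), IntegrableOn (fun t => g t φ) (Icc 0 T) ∧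
    ∀ t ∈ Icc 0 T, f t φ = f 0 φ + ∫ τ in (0 : ℝ)..t, g τ φ

/-- `V ∈ H^l([0,T]; H^k(ℝ))` is real-valued, and `DV j = ∂_t^j V` for `j ≤ l`: for almost every `t` the
function `V t` represents `DV 0 t`, consecutive `DV j` are weak time derivatives of one another, and each
of them belongs to `L²([0,T]; H^k(ℝ))`. -/
structure MemHlHk (T : ℝ) (l : ℕ) (k : ℝ) (V : ℝ → ℝ → ℝ) (DV : ℕ → ℝ → 𝓢'(ℝ, ℂ)) : Prop where
  repr : ∀ᵐ t ∂(volume.restrict (Icc 0 T)),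
    ∃ h : MemLp (fun x => (V t x : ℂ)) 2 volume, DV 0 t = (h.toLp _ : Lp ℂ 2 (volume : Measure ℝ))
  deriv : ∀ j < l, HasWeakTimeDeriv T (DV j) (fun t φ => DV (j + 1) t φ)
  memL2 : ∀ j ≤ l, MemL2 T k (DV j)

/-- `g` is a function representing the Fourier transform of the tempered distribution `f`. -/
def IsFourierDensity (f : 𝓢'(ℝ, ℂ)) (g : ℝ → ℂ) : Prop :=
  ∀ φ : 𝓢(ℝ, ℂ), Integrable (fun ξ => g ξ * φ ξ) ∧ (𝓕 f) φ = ∫ ξ, g ξ * φ ξ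

open Classical in
/-- The Fourier transform of `f` as a function. It exists, and is unique almost everywhere, for every `f` in
any Sobolev space `H^σ(ℝ)`, `σ ∈ ℝ`; the value `0` for other distributions is never used. -/
def fourierDensity (f : 𝓢'(ℝ, ℂ)) : ℝ → ℂ :=
  if h : ∃ g, IsFourierDensity f g then h.choose else 0

/-- The (bilinear) duality pairing `⟨f, ψ⟩ = ∫ f̂ (𝓕⁻¹ψ) dξ` of `f ∈ H^{-σ}(ℝ)` and `ψ ∈ H^σ(ℝ)`.
For Schwartz `ψ` it is `f ψ`. For a function `a`, the product `a f` is the distribution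
`φ ↦ ⟨f, a φ⟩`. -/
def pairing (f : 𝓢'(ℝ, ℂ)) (ψ : ℝ → ℂ) : ℂ :=
  ∫ ξ, fourierDensity f ξ * (𝓕⁻ ψ) ξ

/-- The symbol `-i sgn ξ` of the Hilbert transform. -/
def hilbertSymbol (ξ : ℝ) : ℂ := -Complex.I * (SignType.sign ξ : ℝ)

/-- `⟨H f, ψ⟩`, where `H` is the Hilbert transform. -/
def hilbertPairing (f : 𝓢'(ℝ, ℂ)) (ψ : ℝ → ℂ) : ℂ :=
  ∫ ξ, hilbertSymbol ξ * fourierDensity f ξ * (𝓕⁻ ψ) ξ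

/-- The distributional derivative `∂_α`. -/
abbrev dα : 𝓢'(ℝ, ℂ) →L[ℂ] 𝓢'(ℝ, ℂ) := TemperedDistribution.derivCLM ℂ

/-- `H ∂_α³ u - 2 V ∂_α w - V² ∂_α² u + R` at time `t`, tested against `φ`. -/
def acceleration (V : ℝ → ℝ → ℝ) (R u w : ℝ → 𝓢'(ℝ, ℂ)) (t : ℝ) (φ : 𝓢(ℝ, ℂ)) : ℂ :=
  hilbertPairing (dα (dα (dα (u t)))) φ
    - pairing (dα (w t)) (fun x => 2 * (V t x : ℂ) * φ x)
    - pairing (dα (dα (u t))) (fun x => (V t x : ℂ) ^ 2 * φ x)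
    + R t φ

/-- `u`, with time derivative `w = ∂_t u`, is a (weak) solution on `[0,T]` of
`∂_t² u - H ∂_α³ u + 2 V ∂_α ∂_t u + V² ∂_α² u = R`, `u(0) = u₀`, `∂_t u(0) = u₁`,
with `u ∈ L^∞([0,T]; H^{s+3/2})` and `∂_t u ∈ L^∞([0,T]; H^s)`. The values at a given time are those of
the weakly continuous representatives of `u` and `∂_t u`. -/
structure IsSolution (T s : ℝ) (V : ℝ → ℝ → ℝ) (R : ℝ → 𝓢'(ℝ, ℂ)) (u₀ u₁ : 𝓢'(ℝ, ℂ))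
    (u w : ℝ → 𝓢'(ℝ, ℂ)) : Prop where
  bounded : linftyNorm T (s + 3 / 2) u < ∞
  bounded_deriv : linftyNorm T s w < ∞
  initial : u 0 = u₀
  initial_deriv : w 0 = u₁
  timeDeriv : HasWeakTimeDeriv T u (fun t φ => w t φ)
  equation : HasWeakTimeDeriv T w (acceleration V R u w)

/-- `exp (P(‖V‖_{L^∞([0,T];H^k)}, ‖V_t‖_{L^∞([0,T];H^k)}))`, where `DV j = ∂_t^j V`. -/
def energyConst (P : MvPolynomial (Fin 2) ℝ) (T k : ℝ) (DV : ℕ → ℝ → 𝓢'(ℝ, ℂ)) : ℝ≥0∞ :=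
  ENNReal.ofReal (Real.exp
    (MvPolynomial.eval ![(linftyNorm T k (DV 0)).toReal, (linftyNorm T k (DV 1)).toReal] P))

end WaterWave

end

/-! Since `H∂³ = -|D|³`, the equation reads `(∂_t + V∂)² u + |D|³ u = R` up to lower order terms: a
dispersive wave equation in a frame transported by `V`. It is solved by an energy method.

Everything is done on the Fourier side in `L²`. With `Z = ⟨D⟩^{s+3/2} u` and `Y = ⟨D⟩^s ∂_t u` all
Sobolev norms become `L²` norms, and multiplication by `V` becomes `V_a = ⟨D⟩^a V ⟨D⟩^{-a}`, an
integral operator with kernel `⟨ξ⟩^a ⟨η⟩^{-a} ⟨ξ-η⟩^{-k}` times the value of `⟨·⟩^k V̂` at `ξ - η`.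
Product and commutator estimates are thereby pointwise kernel bounds: `V_a` is bounded
(`multiplication_kernel_le`), so is `(∂V)_a` (`derivative_kernel_le`), and `V_a ∂` is skew-adjoint
up to a bounded operator (`commutator_kernel_le`), the last because `V` is real.

For `x = ⟨D⟩^a u` and `y = ∂_t x` the energy is `‖y‖² + ‖|D|^{3/2} x‖² - ‖V_a ∂x‖² + K ‖x‖²`. The
negative term is there so that its time derivative cancels the leading part of `⟨y, V_a² ∂² x⟩`,
which no norm at hand controls. As `∂` has order `1 < 3/2`, interpolation makes the energy coercive
once `K` is a suitable polynomial in the norm of `V`; Gronwall then gives `energy_estimate`, with a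
rate polynomial in the norms of `V` and `∂_t V`. Hence the constants of the form `exp(P)`.

Existence: the sharp frequency cutoff turns the equation into a linear ODE with bounded
coefficients, and the estimate is uniform in the cutoff. Weak limits are taken at every time along
one ultrafilter. Tested against the range of `⟨D⟩^{-3/2}`, the approximations are equicontinuous in
time, which carries the integrated equation to the limit (`IsApprox.exists_isWeakSolution`).

Uniqueness: a solution in the given class is too rough for its own energy identity at level `s`. The
difference of two solutions is truncated in frequency and the estimate is used at level `s - 1/2`.
There the truncation error, paired with the velocity, costs exactly the derivatives available, and
it vanishes as the cutoff is removed (`eq_zero_of_weak`).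

What remains is a dictionary: distributions in `H^a` are `L²` functions (`toDist`), the weak
equation in its distributional form is the one in Fourier variables (`acceleration_eq`), and a
coefficient in `H²` in time is `C¹` with values in `H^k` (`MemHlHk.exists_coeff`). -/

noncomputable section

namespace WaterWave

open scoped InnerProductSpace ComplexConjugate
open Filter Topology

/-! ### Japanese bracket and pointwise kernel bounds -/

/-- The Japanese bracket `⟨ξ⟩ = (1 + ξ²)^{1/2}`. -/
def jb (ξ : ℝ) : ℝ := Real.sqrt (1 + ξ ^ 2)

lemma one_le_jb (ξ : ℝ) : 1 ≤ jb ξ := by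
  rw [jb, Real.one_le_sqrt]; nlinarith [sq_nonneg ξ]

lemma jb_pos (ξ : ℝ) : 0 < jb ξ := lt_of_lt_of_le one_pos (one_le_jb ξ)

lemma jb_sq (ξ : ℝ) : jb ξ ^ 2 = 1 + ξ ^ 2 := Real.sq_sqrt (by positivity)

lemma abs_le_jb (ξ : ℝ) : |ξ| ≤ jb ξ := by
  apply Real.le_sqrt_of_sq_le; rw [sq_abs]; linarith

lemma jb_neg (ξ : ℝ) : jb (-ξ) = jb ξ := by simp [jb]

lemma jb_sub_comm (ξ η : ℝ) : jb (ξ - η) = jb (η - ξ) := by rw [← jb_neg, neg_sub]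

@[fun_prop]
lemma continuous_jb : Continuous jb := by unfold jb; fun_prop

@[fun_prop]
lemma measurable_jb : Measurable jb := continuous_jb.measurable

lemma jb_le_add (ξ η : ℝ) : jb ξ ≤ jb η + |ξ - η| := by
  apply Real.sqrt_le_iff.2 ⟨by have := jb_pos η; positivity, ?_⟩
  have h1 := jb_sq η
  have h2 := abs_le_jb η
  have h3 := sq_abs (ξ - η)
  have h4 : η * (ξ - η) ≤ jb η * |ξ - η| := by
    calc η * (ξ - η) ≤ |η * (ξ - η)| := le_abs_self _
      _ = |η| * |ξ - η| := abs_mul _ _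
      _ ≤ _ := by gcongr
  nlinarith

lemma abs_jb_sub_le (ξ η : ℝ) : |jb ξ - jb η| ≤ |ξ - η| := by
  rw [abs_le]
  have h1 := jb_le_add ξ η
  have h2 := jb_le_add η ξ
  rw [abs_sub_comm η ξ] at h2
  constructor <;> linarith

/-- The elementary kernel dominating all the kernels in use. -/
def kerBound (ξ η : ℝ) : ℝ := (jb (ξ - η) ^ 2)⁻¹ + (jb ξ)⁻¹ + (jb η)⁻¹

lemma kerBound_nonneg (ξ η : ℝ) : 0 ≤ kerBound ξ η := by
  have := jb_pos ξ; have := jb_pos η; have := jb_pos (ξ - η)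
  unfold kerBound; positivity

lemma kerBound_comm (ξ η : ℝ) : kerBound ξ η = kerBound η ξ := by
  unfold kerBound; rw [jb_sub_comm]; ring

/-- If one frequency is much larger than the other, the difference is comparable to the larger. -/
lemma rpow_mul_div_rpow_le {k p q d : ℝ} (hk : 1 ≤ k) (hq : 1 ≤ q) (hp : 0 ≤ p) (hd : 0 < d)
    (h : p ≤ 2 * d) : (p / q) ^ k * d ^ (-k) ≤ 2 ^ k * q⁻¹ := by
  have hq0 : 0 < q := by linarith
  rw [Real.div_rpow hp hq0.le, Real.rpow_neg hd.le]
  have h1 : p ^ k ≤ (2 * d) ^ k := Real.rpow_le_rpow hp h (by linarith)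
  rw [Real.mul_rpow (by norm_num) hd.le] at h1
  have h2 : q ≤ q ^ k := by
    simpa using Real.rpow_le_rpow_of_exponent_le hq hk
  have hdk : 0 < d ^ k := Real.rpow_pos_of_pos hd k
  calc p ^ k / q ^ k * (d ^ k)⁻¹ ≤ (2 ^ k * d ^ k) / q * (d ^ k)⁻¹ := by gcongr
    _ = 2 ^ k * q⁻¹ := by field_simp

lemma ratio_rpow_le {a k p q : ℝ} (hp : 0 < p) (hq : 0 < q) (hpq : q ≤ p) (hak : a ≤ k) :
    p ^ a * q ^ (-a) ≤ (p / q) ^ k := by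
  rw [Real.rpow_neg hq.le, ← div_eq_mul_inv, ← Real.div_rpow hp.le hq.le]
  exact Real.rpow_le_rpow_of_exponent_le ((one_le_div hq).2 hpq) hak

lemma ratio_rpow_le_two {a p q : ℝ} (hp : 0 < p) (hq : 0 < q) (h1 : p ≤ 2 * q) (h2 : q ≤ 2 * p) :
    p ^ a * q ^ (-a) ≤ 2 ^ |a| := by
  rw [Real.rpow_neg hq.le, ← div_eq_mul_inv, ← Real.div_rpow hp.le hq.le]
  rcases le_or_gt 0 a with ha | ha
  · rw [abs_of_nonneg ha]
    exact Real.rpow_le_rpow (by positivity) ((div_le_iff₀ hq).2 h1) ha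
  · rw [abs_of_neg ha, ← inv_div, Real.inv_rpow (by positivity), ← Real.rpow_neg (by positivity)]
    exact Real.rpow_le_rpow (by positivity) ((div_le_iff₀ hp).2 h2) (by linarith)

/-- A case distinction on the relative size of two frequencies. -/
lemma freq_cases (ξ η : ℝ) :
    (jb ξ ≤ 2 * jb η ∧ jb η ≤ 2 * jb ξ) ∨ (jb η ≤ jb ξ ∧ jb ξ ≤ 2 * jb (ξ - η)) ∨
      (jb ξ ≤ jb η ∧ jb η ≤ 2 * jb (ξ - η)) := by
  have h1 := jb_le_add ξ η
  have h2 := jb_le_add η ξ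
  rw [abs_sub_comm η ξ] at h2
  have h3 := abs_le_jb (ξ - η)
  have := jb_pos ξ; have := jb_pos η
  by_cases ha : jb ξ ≤ 2 * jb η
  · by_cases hb : jb η ≤ 2 * jb ξ
    · exact Or.inl ⟨ha, hb⟩
    · right; right; constructor <;> linarith
  · right; left; constructor <;> linarith

lemma jb_rpow_neg_le {k : ℝ} (hk : 2 ≤ k) (ξ : ℝ) : jb ξ ^ (-k) ≤ (jb ξ ^ 2)⁻¹ := by
  rw [← Real.rpow_natCast, ← Real.rpow_neg (jb_pos ξ).le]
  exact Real.rpow_le_rpow_of_exponent_le (one_le_jb ξ) (by push_cast; linarith)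

/-- At comparable frequencies the weights cancel up to `2^|a|` and `⟨ξ-η⟩^{-k}` decays enough.
Otherwise `⟨ξ-η⟩` is comparable to the larger frequency, so `⟨ξ-η⟩^{-k}` absorbs the ratio of the
weights and leaves the inverse of the smaller bracket. -/
lemma multiplication_kernel_le {a k : ℝ} (hk : 3 ≤ k) (ha : |a| ≤ k) (ξ η : ℝ) :
    jb ξ ^ a * jb η ^ (-a) * jb (ξ - η) ^ (-k) ≤ 2 ^ k * kerBound ξ η := by
  have hp := jb_pos ξ; have hq := jb_pos η; have hd := jb_pos (ξ - η)
  have hka := abs_le.1 ha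
  have hnn : 0 ≤ jb (ξ - η) ^ (-k) := by positivity
  rcases freq_cases ξ η with ⟨h1, h2⟩ | ⟨h1, h2⟩ | ⟨h1, h2⟩
  · calc _ ≤ 2 ^ k * (jb (ξ - η) ^ 2)⁻¹ := by
          apply mul_le_mul _ (jb_rpow_neg_le (by linarith) _) hnn (by positivity)
          exact (ratio_rpow_le_two hp hq h1 h2).trans
            (Real.rpow_le_rpow_of_exponent_le (by norm_num) ha)
      _ ≤ _ := by
          unfold kerBound; gcongr
          have := inv_pos.2 hp; have := inv_pos.2 hq; linarith
  · calc _ ≤ (jb ξ / jb η) ^ k * jb (ξ - η) ^ (-k) := by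
          gcongr; exact ratio_rpow_le hp hq h1 hka.2
      _ ≤ 2 ^ k * (jb η)⁻¹ := rpow_mul_div_rpow_le (by linarith) (one_le_jb η) hp.le hd h2
      _ ≤ _ := by
          unfold kerBound; gcongr
          have := inv_pos.2 hp; have : 0 < (jb (ξ - η) ^ 2)⁻¹ := by positivity
          linarith
  · calc _ ≤ (jb η / jb ξ) ^ k * jb (ξ - η) ^ (-k) := by
          gcongr
          have := ratio_rpow_le (a := -a) hq hp h1 (by linarith : -a ≤ k)
          rw [neg_neg] at this
          linarith
      _ ≤ 2 ^ k * (jb ξ)⁻¹ := rpow_mul_div_rpow_le (by linarith) (one_le_jb ξ) hq.le hd h2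
      _ ≤ _ := by
          unfold kerBound; gcongr
          have := inv_pos.2 hq; have : 0 < (jb (ξ - η) ^ 2)⁻¹ := by positivity
          linarith

lemma jb_mul_rpow_neg (k ξ : ℝ) : jb ξ * jb ξ ^ (-k) = jb ξ ^ (-(k - 1)) := by
  conv_lhs => rw [← Real.rpow_one (jb ξ)]
  rw [Real.rpow_one, neg_sub, sub_eq_add_neg, Real.rpow_add (jb_pos ξ), Real.rpow_one]

/-- The derivative falls on `V` and spends one power of `⟨ξ-η⟩^{-k}`; the argument for
multiplication then runs with `k - 1 ≥ 2`. -/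
lemma derivative_kernel_le {a k : ℝ} (hk : 3 ≤ k) (ha : |a| ≤ k - 1) (ξ η : ℝ) :
    |ξ - η| * (jb ξ ^ a * jb η ^ (-a) * jb (ξ - η) ^ (-k)) ≤ 2 ^ k * kerBound ξ η := by
  have hp := jb_pos ξ; have hq := jb_pos η; have hd := jb_pos (ξ - η)
  have hka := abs_le.1 ha
  have hnn : 0 ≤ jb (ξ - η) ^ (-(k - 1)) := by positivity
  have h2k : (2 : ℝ) ^ (k - 1) ≤ 2 ^ k :=
    Real.rpow_le_rpow_of_exponent_le (by norm_num) (by linarith)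
  have hp' := inv_pos.2 hp
  have hq' := inv_pos.2 hq
  have hd' : 0 < (jb (ξ - η) ^ 2)⁻¹ := by positivity
  calc |ξ - η| * (jb ξ ^ a * jb η ^ (-a) * jb (ξ - η) ^ (-k))
      ≤ jb (ξ - η) * (jb ξ ^ a * jb η ^ (-a) * jb (ξ - η) ^ (-k)) := by
        gcongr; exact abs_le_jb _
    _ = jb ξ ^ a * jb η ^ (-a) * (jb (ξ - η) * jb (ξ - η) ^ (-k)) := by ring
    _ = jb ξ ^ a * jb η ^ (-a) * jb (ξ - η) ^ (-(k - 1)) := by rw [jb_mul_rpow_neg]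
    _ ≤ 2 ^ k * kerBound ξ η := by
      rcases freq_cases ξ η with ⟨h1, h2⟩ | ⟨h1, h2⟩ | ⟨h1, h2⟩
      · calc _ ≤ 2 ^ k * (jb (ξ - η) ^ 2)⁻¹ := by
              apply mul_le_mul _ (jb_rpow_neg_le (by linarith) _) hnn (by positivity)
              exact (ratio_rpow_le_two hp hq h1 h2).trans
                (Real.rpow_le_rpow_of_exponent_le (by norm_num) (by linarith))
          _ ≤ _ := by unfold kerBound; gcongr; linarith
      · calc _ ≤ (jb ξ / jb η) ^ (k - 1) * jb (ξ - η) ^ (-(k - 1)) := by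
              gcongr; exact ratio_rpow_le hp hq h1 hka.2
          _ ≤ 2 ^ (k - 1) * (jb η)⁻¹ :=
              rpow_mul_div_rpow_le (by linarith) (one_le_jb η) hp.le hd h2
          _ ≤ _ := by unfold kerBound; gcongr; linarith
      · calc _ ≤ (jb η / jb ξ) ^ (k - 1) * jb (ξ - η) ^ (-(k - 1)) := by
              gcongr
              have := ratio_rpow_le (a := -a) hq hp h1 (by linarith : -a ≤ k - 1)
              rw [neg_neg] at this
              linarith
          _ ≤ 2 ^ (k - 1) * (jb ξ)⁻¹ :=
              rpow_mul_div_rpow_le (by linarith) (one_le_jb ξ) hq.le hd h2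
          _ ≤ _ := by unfold kerBound; gcongr; linarith

/-- The function `x^a - x^{-a}` vanishes at `1` and is Lipschitz on the interval. This is the gain
of one derivative in the commutator. -/
lemma exists_rpow_sub_rpow_le (a : ℝ) :
    ∃ C : ℝ, 0 ≤ C ∧ ∀ x ∈ Icc (1 / 2 : ℝ) 2, |x ^ a - x ^ (-a)| ≤ C * |x - 1| := by
  have hc : ContDiffOn ℝ 1 (fun x : ℝ => x ^ a - x ^ (-a)) (Icc (1 / 2) 2) := by
    have h0 : ∀ x ∈ Icc (1 / 2 : ℝ) 2, x ≠ 0 := fun x hx => by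
      have := hx.1; intro h; rw [h] at this; norm_num at this
    exact (contDiffOn_id.rpow_const_of_ne h0).sub (contDiffOn_id.rpow_const_of_ne h0)
  obtain ⟨K, hK⟩ := hc.exists_lipschitzOnWith one_ne_zero (convex_Icc _ _) isCompact_Icc
  refine ⟨K, K.2, fun x hx => ?_⟩
  have := hK.dist_le_mul x hx 1 (by norm_num)
  simpa [Real.dist_eq] using this

/-- At unbalanced frequencies no cancellation is needed: `|ξ|` and `|η|` are both at most `2⟨ξ-η⟩`,
so the two terms are estimated separately at the price of one power of `⟨ξ-η⟩`. -/
lemma commutator_kernel_aux {a k : ℝ} (hk : 3 ≤ k) (ha : |a| ≤ k - 1) {ξ η : ℝ}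
    (h1 : jb η ≤ jb ξ) (h2 : jb ξ ≤ 2 * jb (ξ - η)) :
    |η * (jb ξ ^ a * jb η ^ (-a)) - ξ * (jb ξ ^ (-a) * jb η ^ a)| * jb (ξ - η) ^ (-k) ≤
      4 * 2 ^ k * kerBound ξ η := by
  have hp := jb_pos ξ; have hq := jb_pos η; have hd := jb_pos (ξ - η)
  have hka := abs_le.1 ha
  have e1 : jb ξ ^ a * jb η ^ (-a) ≤ (jb ξ / jb η) ^ (k - 1) := ratio_rpow_le hp hq h1 hka.2
  have e2 : jb ξ ^ (-a) * jb η ^ a ≤ (jb ξ / jb η) ^ (k - 1) := by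
    have := ratio_rpow_le (a := -a) hp hq h1 (by linarith : -a ≤ k - 1)
    rwa [neg_neg] at this
  have e3 := rpow_mul_div_rpow_le (by linarith : 1 ≤ k - 1) (one_le_jb η) hp.le hd h2
  have h2k : (2 : ℝ) ^ (k - 1) ≤ 2 ^ k :=
    Real.rpow_le_rpow_of_exponent_le (by norm_num) (by linarith)
  have hη : |η| ≤ 2 * jb (ξ - η) := (abs_le_jb η).trans (h1.trans h2)
  have hξ : |ξ| ≤ 2 * jb (ξ - η) := (abs_le_jb ξ).trans h2
  have hp' := inv_pos.2 hp
  have hq' := inv_pos.2 hq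
  have hd' : 0 < (jb (ξ - η) ^ 2)⁻¹ := by positivity
  calc |η * (jb ξ ^ a * jb η ^ (-a)) - ξ * (jb ξ ^ (-a) * jb η ^ a)| * jb (ξ - η) ^ (-k)
      ≤ (|η| * (jb ξ ^ a * jb η ^ (-a)) + |ξ| * (jb ξ ^ (-a) * jb η ^ a)) *
          jb (ξ - η) ^ (-k) := by
        gcongr
        refine (abs_sub _ _).trans (le_of_eq ?_)
        rw [abs_mul η, abs_mul ξ, abs_of_nonneg (by positivity : 0 ≤ jb ξ ^ a * jb η ^ (-a)),
          abs_of_nonneg (by positivity : 0 ≤ jb ξ ^ (-a) * jb η ^ a)]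
    _ ≤ (2 * jb (ξ - η) * (jb ξ / jb η) ^ (k - 1) + 2 * jb (ξ - η) * (jb ξ / jb η) ^ (k - 1)) *
          jb (ξ - η) ^ (-k) := by gcongr
    _ = 4 * ((jb ξ / jb η) ^ (k - 1) * (jb (ξ - η) * jb (ξ - η) ^ (-k))) := by ring
    _ = 4 * ((jb ξ / jb η) ^ (k - 1) * jb (ξ - η) ^ (-(k - 1))) := by rw [jb_mul_rpow_neg]
    _ ≤ 4 * (2 ^ (k - 1) * (jb η)⁻¹) := by gcongr
    _ ≤ 4 * (2 ^ k * kerBound ξ η) := by unfold kerBound; gcongr; linarith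
    _ = _ := by ring

/-- This is the kernel of `V_a ∂ + (V_a ∂)*` up to the factor `2πi`. Each of its two terms has order
one; at comparable frequencies their difference gains a factor `|ξ-η|`, which is a derivative on `V`
instead of on the unknown. -/
lemma commutator_kernel_le {a k : ℝ} (hk : 3 ≤ k) (ha : |a| ≤ k - 1) :
    ∃ C : ℝ, 0 ≤ C ∧ ∀ ξ η : ℝ,
      |η * (jb ξ ^ a * jb η ^ (-a)) - ξ * (jb ξ ^ (-a) * jb η ^ a)| * jb (ξ - η) ^ (-k) ≤
        C * kerBound ξ η := by
  obtain ⟨C, hC0, hC⟩ := exists_rpow_sub_rpow_le a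
  refine ⟨2 ^ k + 2 * C + 4 * 2 ^ k, by positivity, fun ξ η => ?_⟩
  have hp := jb_pos ξ; have hq := jb_pos η; have hd := jb_pos (ξ - η)
  have hker := kerBound_nonneg ξ η
  rcases freq_cases ξ η with ⟨h1, h2⟩ | ⟨h1, h2⟩ | ⟨h1, h2⟩
  · have hr := ratio_rpow_le_two (a := a) hp hq h1 h2
    have hr0 : 0 ≤ jb ξ ^ a * jb η ^ (-a) := by positivity
    have e1 : jb ξ ^ a * jb η ^ (-a) = (jb ξ / jb η) ^ a := by
      rw [Real.div_rpow hp.le hq.le, Real.rpow_neg hq.le]; rfl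
    have e2 : jb ξ ^ (-a) * jb η ^ a = (jb ξ / jb η) ^ (-a) := by
      rw [Real.div_rpow hp.le hq.le, Real.rpow_neg hq.le, div_inv_eq_mul]
    have h3 := hC (jb ξ / jb η)
      ⟨by rw [le_div_iff₀ hq]; linarith, by rw [div_le_iff₀ hq]; exact h1⟩
    have h4 : |jb ξ / jb η - 1| ≤ |ξ - η| / jb η := by
      rw [div_sub_one hq.ne', abs_div, abs_of_pos hq]
      exact div_le_div_of_nonneg_right (abs_jb_sub_le _ _) hq.le
    have h5 : |ξ| * |jb ξ ^ a * jb η ^ (-a) - jb ξ ^ (-a) * jb η ^ a| ≤ 2 * C * |ξ - η| := by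
      rw [e1, e2]
      calc _ ≤ (2 * jb η) * (C * (|ξ - η| / jb η)) := by
            apply mul_le_mul ((abs_le_jb ξ).trans h1) _ (abs_nonneg _) (by positivity)
            exact h3.trans (by gcongr)
        _ = _ := by field_simp
    have h6 : |η * (jb ξ ^ a * jb η ^ (-a)) - ξ * (jb ξ ^ (-a) * jb η ^ a)| ≤
        (2 ^ k + 2 * C) * jb (ξ - η) := by
      -- With `r = (⟨ξ⟩/⟨η⟩)^a` the kernel is `-(ξ-η) r + ξ (r - r⁻¹)`, and `r - r⁻¹` is of size
      -- `|ξ-η|/⟨η⟩`.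
      have e : η * (jb ξ ^ a * jb η ^ (-a)) - ξ * (jb ξ ^ (-a) * jb η ^ a) =
          -((ξ - η) * (jb ξ ^ a * jb η ^ (-a))) +
            ξ * (jb ξ ^ a * jb η ^ (-a) - jb ξ ^ (-a) * jb η ^ a) := by ring
      rw [e]
      refine (abs_add_le _ _).trans ?_
      rw [abs_neg, abs_mul (ξ - η), abs_mul ξ, abs_of_nonneg hr0]
      have h7 : (2 : ℝ) ^ |a| ≤ 2 ^ k :=
        Real.rpow_le_rpow_of_exponent_le (by norm_num) (by linarith)
      calc _ ≤ |ξ - η| * 2 ^ k + 2 * C * |ξ - η| := by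
            gcongr; exact hr.trans h7
        _ = (2 ^ k + 2 * C) * |ξ - η| := by ring
        _ ≤ _ := by gcongr; exact abs_le_jb _
    calc _ ≤ (2 ^ k + 2 * C) * jb (ξ - η) * jb (ξ - η) ^ (-k) := by gcongr
      _ = (2 ^ k + 2 * C) * jb (ξ - η) ^ (-(k - 1)) := by rw [mul_assoc, jb_mul_rpow_neg]
      _ ≤ (2 ^ k + 2 * C) * (jb (ξ - η) ^ 2)⁻¹ := by
          gcongr; exact jb_rpow_neg_le (by linarith) _
      _ ≤ (2 ^ k + 2 * C + 4 * 2 ^ k) * kerBound ξ η := by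
          apply mul_le_mul _ _ (by positivity) (by positivity)
          · have : (0 : ℝ) < 2 ^ k := by positivity
            linarith
          · have := inv_pos.2 hp; have := inv_pos.2 hq
            unfold kerBound; linarith
  · refine (commutator_kernel_aux hk ha h1 h2).trans ?_
    gcongr
    have : (0 : ℝ) < 2 ^ k := by positivity
    linarith
  -- The kernel is antisymmetric in `ξ` and `η`, so this case is the previous one with the variables
  -- exchanged.
  · rw [jb_sub_comm] at h2
    have := commutator_kernel_aux hk ha h1 h2
    rw [kerBound_comm, jb_sub_comm η ξ, abs_sub_comm] at this
    calc _ = |η * (jb η ^ (-a) * jb ξ ^ a) - ξ * (jb η ^ a * jb ξ ^ (-a))| *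
          jb (ξ - η) ^ (-k) := by
          rw [mul_comm (jb η ^ (-a)), mul_comm (jb η ^ a)]
      _ ≤ _ := this
      _ ≤ _ := by
        gcongr
        have : (0 : ℝ) < 2 ^ k := by positivity
        linarith

/-! ### Integral operators on `L²` with dominated kernels -/

abbrev L2 : Type := Lp ℂ 2 (volume : Measure ℝ)

lemma norm_le_of_norm_inner_le {E : Type*} [NormedAddCommGroup E] [InnerProductSpace ℂ E] {h : E}
    {c : ℝ} (hc : 0 ≤ c) (H : ∀ f : E, ‖⟪f, h⟫_ℂ‖ ≤ c * ‖f‖) : ‖h‖ ≤ c := by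
  have h1 := H h
  rw [inner_self_eq_norm_sq_to_K, norm_pow, RCLike.norm_ofReal, abs_norm] at h1
  by_contra! h2
  nlinarith [norm_nonneg h]

section KernelForm

/-- The `L²` norm of an `ℝ≥0∞`-valued function. -/
def lnorm (F : ℝ → ℝ≥0∞) : ℝ≥0∞ := (∫⁻ x, F x ^ 2) ^ (1 / 2 : ℝ)

lemma lintegral_mul_le_lnorm {F G : ℝ → ℝ≥0∞} (hF : Measurable F) (hG : Measurable G) :
    ∫⁻ x, F x * G x ≤ lnorm F * lnorm G := by
  have := ENNReal.lintegral_mul_le_Lp_mul_Lq (volume : Measure ℝ)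
    (Real.HolderConjugate.two_two) hF.aemeasurable hG.aemeasurable
  simpa [lnorm] using this

lemma lnorm_comp_sub_left (F : ℝ → ℝ≥0∞) (a : ℝ) : lnorm (fun x => F (a - x)) = lnorm F := by
  unfold lnorm
  rw [lintegral_sub_left_eq_self (fun x => F x ^ 2) a]

lemma lnorm_comp_sub_right (F : ℝ → ℝ≥0∞) (a : ℝ) : lnorm (fun x => F (x - a)) = lnorm F := by
  unfold lnorm
  rw [lintegral_sub_right_eq_self (fun x => F x ^ 2) a]

lemma lnorm_comp_add_left (F : ℝ → ℝ≥0∞) (a : ℝ) : lnorm (fun x => F (a + x)) = lnorm F := by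
  unfold lnorm
  rw [lintegral_add_left_eq_self (fun x => F x ^ 2) a]

lemma lnorm_coe (f : L2) : lnorm (fun x => ‖f x‖ₑ) = ‖f‖ₑ := by
  rw [Lp.enorm_def, eLpNorm_eq_lintegral_rpow_enorm_toReal (by norm_num) (by norm_num)]
  simp [lnorm]

variable {F G K : ℝ → ℝ≥0∞}

/-- In this and the next two bounds one of the three factors is integrated in `L¹`, and
Cauchy–Schwarz in the remaining variable handles the other two. -/
lemma trilinear_le_left (hF : Measurable F) (hG : Measurable G) (hK : Measurable K) :
    ∫⁻ p : ℝ × ℝ, F p.1 * G (p.1 - p.2) * K p.2 ≤ (∫⁻ x, F x) * (lnorm G * lnorm K) := by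
  rw [Measure.volume_eq_prod, lintegral_prod _ (by fun_prop), ← lintegral_mul_const _ hF]
  apply lintegral_mono fun x => ?_
  simp only [mul_assoc]
  rw [lintegral_const_mul _ (by fun_prop)]
  gcongr
  refine (lintegral_mul_le_lnorm (by fun_prop) hK).trans ?_
  rw [lnorm_comp_sub_left]

lemma trilinear_le_right (hF : Measurable F) (hG : Measurable G) (hK : Measurable K) :
    ∫⁻ p : ℝ × ℝ, F p.1 * G (p.1 - p.2) * K p.2 ≤ (∫⁻ x, K x) * (lnorm F * lnorm G) := by
  rw [Measure.volume_eq_prod, lintegral_prod_symm' _ (by fun_prop), ← lintegral_mul_const _ hK]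
  apply lintegral_mono fun x => ?_
  dsimp only
  rw [lintegral_mul_const _ (by fun_prop), mul_comm]
  gcongr
  refine (lintegral_mul_le_lnorm hF (by fun_prop)).trans ?_
  rw [lnorm_comp_sub_right]

lemma trilinear_le_middle (hF : Measurable F) (hG : Measurable G) (hK : Measurable K) :
    ∫⁻ p : ℝ × ℝ, F p.1 * G (p.1 - p.2) * K p.2 ≤ (∫⁻ x, G x) * (lnorm F * lnorm K) := by
  rw [Measure.volume_eq_prod, lintegral_prod_symm' _ (by fun_prop)]
  have : ∀ y, ∫⁻ x, F x * G (x - y) * K y = ∫⁻ z, F (y + z) * G z * K y := fun y => by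
    rw [← lintegral_add_left_eq_self (fun x => F x * G (x - y) * K y) y]
    simp
  simp only [this]
  rw [lintegral_lintegral_swap (by fun_prop), ← lintegral_mul_const _ hG]
  apply lintegral_mono fun z => ?_
  dsimp only
  have e : ∀ y, F (y + z) * G z * K y = G z * (F (z + y) * K y) := fun y => by
    rw [add_comm y z]; ring
  simp only [e]
  rw [lintegral_const_mul _ (by fun_prop)]
  gcongr
  refine (lintegral_mul_le_lnorm (by fun_prop) hK).trans ?_
  rw [lnorm_comp_add_left]

/-- `‖⟨·⟩⁻¹‖_{L²}`. -/
def kerConst : ℝ≥0∞ := lnorm (fun x => ENNReal.ofReal (jb x)⁻¹)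

lemma kerConst_ne_top : kerConst ≠ ∞ := by
  unfold kerConst lnorm
  apply ENNReal.rpow_ne_top_of_nonneg (by norm_num)
  have h := (integrable_inv_one_add_sq).lintegral_lt_top
  refine ne_of_lt (lt_of_le_of_lt (le_of_eq ?_) h)
  congr 1; ext x
  rw [← ENNReal.ofReal_pow (inv_nonneg.2 (jb_pos x).le), inv_pow, jb_sq]

/-- Each summand of `kerBound` puts at least one inverse bracket on one of the three factors. As
`⟨·⟩⁻¹` is in `L²`, that factor becomes integrable, and the matching trilinear bound applies. -/
lemma trilinear_kerBound_le (hF : Measurable F) (hG : Measurable G) (hK : Measurable K) :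
    ∫⁻ p : ℝ × ℝ, ENNReal.ofReal (kerBound p.1 p.2) * (F p.1 * G (p.1 - p.2) * K p.2) ≤
      3 * kerConst * (lnorm F * lnorm G * lnorm K) := by
  have hj : Measurable fun x => ENNReal.ofReal (jb x)⁻¹ := by fun_prop
  have hmul : ∀ {L : ℝ → ℝ≥0∞}, Measurable L →
      ∫⁻ x, ENNReal.ofReal (jb x)⁻¹ * L x ≤ kerConst * lnorm L := fun hL =>
    lintegral_mul_le_lnorm hj hL
  have hpt : ∀ p : ℝ × ℝ, ENNReal.ofReal (kerBound p.1 p.2) * (F p.1 * G (p.1 - p.2) * K p.2) ≤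
      F p.1 * (ENNReal.ofReal (jb (p.1 - p.2))⁻¹ * G (p.1 - p.2)) * K p.2 +
      (ENNReal.ofReal (jb p.1)⁻¹ * F p.1) * G (p.1 - p.2) * K p.2 +
      F p.1 * G (p.1 - p.2) * (ENNReal.ofReal (jb p.2)⁻¹ * K p.2) := fun p => by
    have h1 := inv_pos.2 (jb_pos p.1)
    have h2 := inv_pos.2 (jb_pos p.2)
    have h3 := inv_pos.2 (jb_pos (p.1 - p.2))
    have h4 : kerBound p.1 p.2 ≤ (jb (p.1 - p.2))⁻¹ + (jb p.1)⁻¹ + (jb p.2)⁻¹ := by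
      unfold kerBound
      gcongr
      · exact jb_pos _
      · have := one_le_jb (p.1 - p.2); nlinarith
    calc _ ≤ ENNReal.ofReal ((jb (p.1 - p.2))⁻¹ + (jb p.1)⁻¹ + (jb p.2)⁻¹) *
          (F p.1 * G (p.1 - p.2) * K p.2) := by gcongr
      _ = _ := by
        rw [ENNReal.ofReal_add (by positivity) h2.le, ENNReal.ofReal_add h3.le h1.le]
        ring
  refine (lintegral_mono hpt).trans ?_
  rw [lintegral_add_left (by fun_prop), lintegral_add_left (by fun_prop)]
  have e1 := trilinear_le_middle hF (hj.mul hG) hK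
  have e2 := trilinear_le_left (hj.mul hF) hG hK
  have e3 := trilinear_le_right hF hG (hj.mul hK)
  calc _ ≤ kerConst * lnorm G * (lnorm F * lnorm K) + kerConst * lnorm F * (lnorm G * lnorm K) +
        kerConst * lnorm K * (lnorm F * lnorm G) := by
        refine add_le_add (add_le_add (e1.trans ?_) (e2.trans ?_)) (e3.trans ?_) <;> gcongr
        · exact hmul hG
        · exact hmul hF
        · exact hmul hK
    _ = _ := by ring

/-- Measurable kernels with `|κ| ≤ C kerBound`. -/
structure Admissible (κ : ℝ → ℝ → ℂ) (C : ℝ) : Prop where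
  measurable : Measurable fun p : ℝ × ℝ => κ p.1 p.2
  nonneg : 0 ≤ C
  bound : ∀ ξ η, ‖κ ξ η‖ ≤ C * kerBound ξ η

/-- The integrand of `⟨f, ∫ κ(·, η) v(· - η) g(η) dη⟩`. -/
def kform (κ : ℝ → ℝ → ℂ) (f v g : ℝ → ℂ) (p : ℝ × ℝ) : ℂ :=
  conj (f p.1) * (κ p.1 p.2 * v (p.1 - p.2) * g p.2)

variable {κ κ' : ℝ → ℝ → ℂ} {C C' : ℝ}

lemma lintegral_kform_le (hκ : Admissible κ C) (f v g : L2) :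
    ∫⁻ p, ‖kform κ f v g p‖ₑ ≤ ENNReal.ofReal C * (3 * kerConst) * (‖f‖ₑ * ‖v‖ₑ * ‖g‖ₑ) := by
  have hf := (Lp.stronglyMeasurable f).measurable.enorm
  have hv := (Lp.stronglyMeasurable v).measurable.enorm
  have hg := (Lp.stronglyMeasurable g).measurable.enorm
  rw [← lnorm_coe f, ← lnorm_coe v, ← lnorm_coe g, mul_assoc]
  have hpt : ∀ p : ℝ × ℝ, ‖kform κ f v g p‖ₑ ≤ ENNReal.ofReal C *
      (ENNReal.ofReal (kerBound p.1 p.2) * (‖f p.1‖ₑ * ‖v (p.1 - p.2)‖ₑ * ‖g p.2‖ₑ)) := fun p => by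
    have h1 : ‖κ p.1 p.2‖ₑ ≤ ENNReal.ofReal C * ENNReal.ofReal (kerBound p.1 p.2) := by
      rw [← ENNReal.ofReal_mul hκ.nonneg, ← ofReal_norm]
      exact ENNReal.ofReal_le_ofReal (hκ.bound _ _)
    have h2 : ‖conj (f p.1)‖ₑ = ‖f p.1‖ₑ := by
      rw [← ofReal_norm, RCLike.norm_conj, ofReal_norm]
    rw [kform, enorm_mul, enorm_mul, enorm_mul, h2]
    calc _ ≤ ‖f p.1‖ₑ * (ENNReal.ofReal C * ENNReal.ofReal (kerBound p.1 p.2) *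
          ‖v (p.1 - p.2)‖ₑ * ‖g p.2‖ₑ) := by gcongr
      _ = _ := by ring
  refine (lintegral_mono hpt).trans ?_
  have hkm : Measurable fun p : ℝ × ℝ => ENNReal.ofReal (kerBound p.1 p.2) := by
    unfold kerBound; fun_prop
  rw [lintegral_const_mul _ (by fun_prop)]
  gcongr
  exact trilinear_kerBound_le hf hv hg

lemma measurable_kform (hκ : Admissible κ C) (f v g : L2) : Measurable (kform κ f v g) := by
  have hf := (Lp.stronglyMeasurable f).measurable
  have hv := (Lp.stronglyMeasurable v).measurable
  have hg := (Lp.stronglyMeasurable g).measurable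
  have := hκ.measurable
  unfold kform
  have h1 : Measurable fun p : ℝ × ℝ => conj (f p.1) :=
    Complex.continuous_conj.measurable.comp (hf.comp measurable_fst)
  fun_prop

lemma integrable_kform (hκ : Admissible κ C) (f v g : L2) : Integrable (kform κ f v g) := by
  refine ⟨(measurable_kform hκ f v g).aestronglyMeasurable, ?_⟩
  refine lt_of_le_of_lt (lintegral_kform_le hκ f v g) ?_
  have := kerConst_ne_top
  finiteness

lemma norm_integral_kform_le (hκ : Admissible κ C) (f v g : L2) :
    ‖∫ p, kform κ f v g p‖ ≤ C * (3 * kerConst.toReal) * (‖f‖ * ‖v‖ * ‖g‖) := by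
  have h := (enorm_integral_le_lintegral_enorm (kform κ f v g)).trans (lintegral_kform_le hκ f v g)
  have hk := kerConst_ne_top
  have h2 := ENNReal.toReal_mono (by finiteness) h
  simpa [ENNReal.toReal_mul, ENNReal.toReal_ofReal hκ.nonneg] using h2

lemma qmp_sub : Measure.QuasiMeasurePreserving (fun p : ℝ × ℝ => p.1 - p.2) volume volume :=
  quasiMeasurePreserving_sub_of_right_invariant volume volume

lemma qmp_fst : Measure.QuasiMeasurePreserving (Prod.fst : ℝ × ℝ → ℝ) volume volume :=
  Measure.quasiMeasurePreserving_fst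

lemma qmp_snd : Measure.QuasiMeasurePreserving (Prod.snd : ℝ × ℝ → ℝ) volume volume :=
  Measure.quasiMeasurePreserving_snd

lemma kform_congr {f f' v v' g g' : ℝ → ℂ} (hf : f =ᵐ[volume] f') (hv : v =ᵐ[volume] v')
    (hg : g =ᵐ[volume] g') : kform κ f v g =ᵐ[volume] kform κ f' v' g' := by
  filter_upwards [qmp_fst.ae hf, qmp_sub.ae hv, qmp_snd.ae hg] with p h1 h2 h3
  simp only [kform, h1, h2, h3]

/-- Riesz representation of the bounded trilinear form. Defining the operators weakly makes every
later identity between them an identity of kernels. -/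
lemma exists_inner_eq_integral_kform (hκ : Admissible κ C) (v g : L2) :
    ∃ h : L2, ∀ f : L2, ⟪f, h⟫_ℂ = ∫ p, kform κ f v g p := by
  let ℓ₀ : L2 →ₗ[ℂ] ℂ :=
    { toFun := fun f => conj (∫ p, kform κ f v g p)
      map_add' := fun f₁ f₂ => by
        rw [← map_add, ← integral_add (integrable_kform hκ _ _ _) (integrable_kform hκ _ _ _),
          integral_congr_ae (kform_congr (Lp.coeFn_add f₁ f₂) ae_eq_rfl ae_eq_rfl)]
        congr 2; ext p; simp [kform, add_mul]
      map_smul' := fun c f => by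
        rw [integral_congr_ae (kform_congr (Lp.coeFn_smul c f) ae_eq_rfl ae_eq_rfl)]
        have : ∀ p, kform κ (c • ⇑f) v g p = conj c * kform κ f v g p := fun p => by
          simp [kform, mul_assoc]
        simp only [this]
        rw [integral_const_mul, map_mul, Complex.conj_conj]; rfl }
  let ℓ : L2 →L[ℂ] ℂ := ℓ₀.mkContinuous (C * (3 * kerConst.toReal) * (‖v‖ * ‖g‖)) fun f => by
    change ‖conj _‖ ≤ _
    rw [RCLike.norm_conj]
    refine (norm_integral_kform_le hκ f v g).trans (le_of_eq (by ring))
  refine ⟨(InnerProductSpace.toDual ℂ L2).symm ℓ, fun f => ?_⟩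
  rw [← inner_conj_symm, InnerProductSpace.toDual_symm_apply]
  exact Complex.conj_conj _

lemma exists_kop (hκ : Admissible κ C) :
    ∃ B : L2 →L[ℂ] L2 →L[ℂ] L2, ∀ f v g : L2, ⟪f, B v g⟫_ℂ = ∫ p, kform κ f v g p := by
  choose e he using exists_inner_eq_integral_kform hκ
  let B₀ : L2 →ₗ[ℂ] L2 →ₗ[ℂ] L2 := LinearMap.mk₂ ℂ e
    (fun v₁ v₂ g => ext_inner_left ℂ fun f => by
      rw [inner_add_right, he, he, he,
        ← integral_add (integrable_kform hκ _ _ _) (integrable_kform hκ _ _ _),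
        integral_congr_ae (kform_congr ae_eq_rfl (Lp.coeFn_add v₁ v₂) ae_eq_rfl)]
      congr 1; ext p; simp only [kform, Pi.add_apply]; ring)
    (fun c v g => ext_inner_left ℂ fun f => by
      rw [inner_smul_right, he, he, ← integral_const_mul,
        integral_congr_ae (kform_congr ae_eq_rfl (Lp.coeFn_smul c v) ae_eq_rfl)]
      congr 1; ext p; simp only [kform, Pi.smul_apply, smul_eq_mul]; ring)
    (fun v g₁ g₂ => ext_inner_left ℂ fun f => by
      rw [inner_add_right, he, he, he,
        ← integral_add (integrable_kform hκ _ _ _) (integrable_kform hκ _ _ _),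
        integral_congr_ae (kform_congr ae_eq_rfl ae_eq_rfl (Lp.coeFn_add g₁ g₂))]
      congr 1; ext p; simp only [kform, Pi.add_apply]; ring)
    (fun c v g => ext_inner_left ℂ fun f => by
      rw [inner_smul_right, he, he, ← integral_const_mul,
        integral_congr_ae (kform_congr ae_eq_rfl ae_eq_rfl (Lp.coeFn_smul c g))]
      congr 1; ext p; simp only [kform, Pi.smul_apply, smul_eq_mul]; ring)
  refine ⟨B₀.mkContinuous₂ (C * (3 * kerConst.toReal)) fun v g => ?_, fun f v g => he v g f⟩
  refine norm_le_of_norm_inner_le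
    (by have := hκ.nonneg; have := ENNReal.toReal_nonneg (a := kerConst); positivity) fun f => ?_
  change ‖⟪f, e v g⟫_ℂ‖ ≤ _
  rw [he]
  exact (norm_integral_kform_le hκ f v g).trans (le_of_eq (by ring))

open Classical in
/-- The operator `(v, g) ↦ ∫ κ(·, η) v(· - η) g(η) dη`. -/
def kop (κ : ℝ → ℝ → ℂ) : L2 →L[ℂ] L2 →L[ℂ] L2 :=
  if h : ∃ C, Admissible κ C then (exists_kop h.choose_spec).choose else 0

lemma inner_kop (hκ : Admissible κ C) (f v g : L2) : ⟪f, kop κ v g⟫_ℂ = ∫ p, kform κ f v g p := by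
  have h : ∃ C, Admissible κ C := ⟨C, hκ⟩
  rw [kop, dif_pos h]
  exact (exists_kop h.choose_spec).choose_spec f v g

lemma norm_inner_kop_le (hκ : Admissible κ C) (f v g : L2) :
    ‖⟪f, kop κ v g⟫_ℂ‖ ≤ C * (3 * kerConst.toReal) * ‖v‖ * ‖f‖ * ‖g‖ := by
  rw [inner_kop hκ]
  exact (norm_integral_kform_le hκ f v g).trans (le_of_eq (by ring))

lemma norm_kop_le (hκ : Admissible κ C) (v g : L2) :
    ‖kop κ v g‖ ≤ C * (3 * kerConst.toReal) * ‖v‖ * ‖g‖ := by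
  have := hκ.nonneg
  have := ENNReal.toReal_nonneg (a := kerConst)
  refine norm_le_of_norm_inner_le (by positivity) fun f => ?_
  exact (norm_inner_kop_le hκ f v g).trans (le_of_eq (by ring))

lemma inner_eq_integral (f g : L2) : ⟪f, g⟫_ℂ = ∫ x, conj (f x) * g x := by
  rw [L2.inner_def]
  congr 1; ext x
  rw [RCLike.inner_apply, mul_comm]

/-- Testing with indicators of sets of finite measure recovers the pointwise formula from the weak
definition. It is needed only to identify products with actual functions. -/
lemma kop_ae_eq (hκ : Admissible κ C) (v g : L2) :
    kop κ v g =ᵐ[volume] fun ξ => ∫ η, κ ξ η * v (ξ - η) * g η := by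
  have key : ∀ s : Set ℝ, MeasurableSet s → volume s < ∞ →
      Integrable (s.indicator fun ξ => ∫ η, κ ξ η * v (ξ - η) * g η) ∧
      ∫ ξ in s, kop κ v g ξ = ∫ ξ in s, ∫ η, κ ξ η * v (ξ - η) * g η := fun s hs hsv => by
    set f : L2 := indicatorConstLp 2 hs hsv.ne (1 : ℂ) with hf
    have hfs : f =ᵐ[volume] s.indicator fun _ => (1 : ℂ) := indicatorConstLp_coeFn
    have hint := (integrable_kform hκ f v g).congr (kform_congr hfs ae_eq_rfl ae_eq_rfl)
    have e : ∀ ξ, ∫ η, kform κ (s.indicator fun _ => (1 : ℂ)) v g (ξ, η) =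
        s.indicator (fun ξ => ∫ η, κ ξ η * v (ξ - η) * g η) ξ := fun ξ => by
      by_cases hξ : ξ ∈ s <;> simp [kform, hξ]
    have hint' := hint.integral_prod_left
    simp only [e] at hint'
    refine ⟨hint', ?_⟩
    have h1 := inner_kop hκ f v g
    rw [integral_congr_ae (kform_congr hfs ae_eq_rfl ae_eq_rfl), Measure.volume_eq_prod,
      integral_prod _ hint] at h1
    simp only [e] at h1
    rw [integral_indicator hs] at h1
    rw [← h1, hf, L2.inner_indicatorConstLp_one]
  refine ae_eq_of_forall_setIntegral_eq_of_sigmaFinite (fun s hs hsv => ?_) (fun s hs hsv => ?_)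
    (fun s hs hsv => (key s hs hsv).2)
  · exact integrableOn_Lp_of_measure_ne_top _ (by norm_num) hsv.ne
  · rw [← integrable_indicator_iff hs]
    exact (key s hs hsv).1

lemma Admissible.add (hκ : Admissible κ C) (hκ' : Admissible κ' C') :
    Admissible (fun ξ η => κ ξ η + κ' ξ η) (C + C') where
  measurable := hκ.measurable.add hκ'.measurable
  nonneg := add_nonneg hκ.nonneg hκ'.nonneg
  bound ξ η := (norm_add_le _ _).trans (by rw [add_mul]; exact add_le_add (hκ.bound _ _) (hκ'.bound _ _))

lemma Admissible.adjoint (hκ : Admissible κ C) :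
    Admissible (fun ξ η => conj (κ η ξ)) C where
  measurable := Complex.continuous_conj.measurable.comp (hκ.measurable.comp measurable_swap)
  nonneg := hκ.nonneg
  bound ξ η := by rw [RCLike.norm_conj, kerBound_comm]; exact hκ.bound _ _

lemma kop_add (hκ : Admissible κ C) (hκ' : Admissible κ' C') (v g : L2) :
    kop (fun ξ η => κ ξ η + κ' ξ η) v g = kop κ v g + kop κ' v g := by
  refine ext_inner_left ℂ fun f => ?_
  rw [inner_add_right, inner_kop hκ, inner_kop hκ', inner_kop (hκ.add hκ'),
    ← integral_add (integrable_kform hκ _ _ _) (integrable_kform hκ' _ _ _)]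
  congr 1; ext p; simp only [kform]; ring

/-- The symmetry of the Fourier transform of a real-valued function, expressed through the kernel
operators: it is closed under limits. -/
def RealSymbol (v : L2) : Prop :=
  ∀ κ C, Admissible κ C → ∀ f g : L2, ⟪kop κ v f, g⟫_ℂ = ⟪f, kop (fun ξ η => conj (κ η ξ)) v g⟫_ℂ

/-- The symmetry of `V̂(t)` is known for almost every `t`, but the energy estimate uses it at every
`t`; closedness and continuity in time bridge the gap. -/
lemma isClosed_realSymbol : IsClosed {v | RealSymbol v} := by
  simp only [RealSymbol, ofPred_forall]
  refine isClosed_iInter fun κ => isClosed_iInter fun C => isClosed_iInter fun hκ =>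
    isClosed_iInter fun f => isClosed_iInter fun g => isClosed_eq ?_ ?_ <;> fun_prop

/-- Exchanging the two variables sends `v(ξ-η)` to `v(η-ξ)`, which is its conjugate by Hermitian
symmetry. -/
lemma realSymbol_of_ae {v : L2} (hv : ∀ᵐ x, v (-x) = conj (v x)) : RealSymbol v := by
  intro κ C hκ f g
  rw [← inner_conj_symm, inner_kop hκ, inner_kop hκ.adjoint, ← integral_conj,
    Measure.volume_eq_prod, ← integral_prod_swap]
  refine integral_congr_ae ?_
  filter_upwards [qmp_sub.ae hv] with p hp
  simp only [kform, Prod.fst_swap, Prod.snd_swap, map_mul, Complex.conj_conj]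
  rw [neg_sub] at hp
  rw [hp, Complex.conj_conj]
  ring

end KernelForm

/-! ### Bounded Fourier multipliers -/

section MulOp

/-- Bounded measurable multipliers. -/
structure BddMul (m : ℝ → ℂ) (C : ℝ) : Prop where
  measurable : Measurable m
  bound : ∀ x, ‖m x‖ ≤ C

variable {m n : ℝ → ℂ} {C C' : ℝ} {κ κ' : ℝ → ℝ → ℂ}

lemma BddMul.nonneg (hm : BddMul m C) : 0 ≤ C := (norm_nonneg _).trans (hm.bound 0)

lemma BddMul.memLp (hm : BddMul m C) (f : L2) : MemLp (fun x => m x * f x) 2 volume :=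
  (Lp.memLp f).of_le_mul (hm.measurable.aestronglyMeasurable.mul (Lp.aestronglyMeasurable f))
    (Filter.Eventually.of_forall fun x => by
      rw [norm_mul]; exact mul_le_mul_of_nonneg_right (hm.bound x) (norm_nonneg _))

lemma BddMul.mul (hm : BddMul m C) (hn : BddMul n C') : BddMul (fun x => m x * n x) (C * C') where
  measurable := hm.measurable.mul hn.measurable
  bound x := by
    rw [norm_mul]
    exact mul_le_mul (hm.bound x) (hn.bound x) (norm_nonneg _) hm.nonneg

lemma BddMul.conj (hm : BddMul m C) : BddMul (fun x => conj (m x)) C where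
  measurable := Complex.continuous_conj.measurable.comp hm.measurable
  bound x := by rw [RCLike.norm_conj]; exact hm.bound x

lemma BddMul.const (c : ℂ) : BddMul (fun _ => c) ‖c‖ := ⟨measurable_const, fun _ => le_rfl⟩

lemma exists_mulOp (hm : BddMul m C) :
    ∃ B : L2 →L[ℂ] L2, ∀ f : L2, B f =ᵐ[volume] fun x => m x * f x := by
  let B₀ : L2 →ₗ[ℂ] L2 :=
    { toFun := fun f => (hm.memLp f).toLp _
      map_add' := fun f g => by
        rw [← MemLp.toLp_add, MemLp.toLp_eq_toLp_iff]
        filter_upwards [Lp.coeFn_add f g] with x hx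
        change m x * (f + g : L2) x = m x * f x + m x * g x
        rw [hx, Pi.add_apply, mul_add]
      map_smul' := fun c f => by
        rw [RingHom.id_apply, ← MemLp.toLp_const_smul, MemLp.toLp_eq_toLp_iff]
        filter_upwards [Lp.coeFn_smul c f] with x hx
        simp only [hx, Pi.smul_apply, smul_eq_mul]; ring }
  refine ⟨B₀.mkContinuous C fun f => ?_, fun f => (hm.memLp f).coeFn_toLp⟩
  refine Lp.norm_le_mul_norm_of_ae_le_mul ?_
  filter_upwards [(hm.memLp f).coeFn_toLp] with x hx
  change ‖((hm.memLp f).toLp _ : L2) x‖ ≤ _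
  rw [hx, norm_mul]
  exact mul_le_mul_of_nonneg_right (hm.bound x) (norm_nonneg _)

open Classical in
/-- Multiplication by a bounded measurable function on `L²`. -/
def mulOp (m : ℝ → ℂ) : L2 →L[ℂ] L2 :=
  if h : ∃ C, BddMul m C then (exists_mulOp h.choose_spec).choose else 0

lemma mulOp_ae_eq (hm : BddMul m C) (f : L2) : mulOp m f =ᵐ[volume] fun x => m x * f x := by
  have h : ∃ C, BddMul m C := ⟨C, hm⟩
  rw [mulOp, dif_pos h]
  exact (exists_mulOp h.choose_spec).choose_spec f

lemma norm_mulOp_le (hm : BddMul m C) (f : L2) : ‖mulOp m f‖ ≤ C * ‖f‖ := by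
  refine Lp.norm_le_mul_norm_of_ae_le_mul ?_
  filter_upwards [mulOp_ae_eq hm f] with x hx
  rw [hx, norm_mul]
  exact mul_le_mul_of_nonneg_right (hm.bound x) (norm_nonneg _)

lemma mulOp_mulOp (hm : BddMul m C) (hn : BddMul n C') (f : L2) :
    mulOp m (mulOp n f) = mulOp (fun x => m x * n x) f := by
  refine Lp.ext ?_
  filter_upwards [mulOp_ae_eq hm (mulOp n f), mulOp_ae_eq hn f, mulOp_ae_eq (hm.mul hn) f]
    with x h1 h2 h3
  rw [h1, h2, h3, mul_assoc]

lemma mulOp_const (c : ℂ) (f : L2) : mulOp (fun _ => c) f = c • f := by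
  refine Lp.ext ?_
  filter_upwards [mulOp_ae_eq (BddMul.const c) f, Lp.coeFn_smul c f] with x h1 h2
  rw [h1, h2]; rfl

lemma inner_mulOp_left (hm : BddMul m C) (f g : L2) :
    ⟪mulOp m f, g⟫_ℂ = ⟪f, mulOp (fun x => conj (m x)) g⟫_ℂ := by
  rw [inner_eq_integral, inner_eq_integral]
  refine integral_congr_ae ?_
  filter_upwards [mulOp_ae_eq hm f, mulOp_ae_eq hm.conj g] with x h1 h2
  simp only [h1, h2, map_mul]; ring

lemma Admissible.mul_left (hκ : Admissible κ C) (hm : BddMul m C') :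
    Admissible (fun ξ η => m ξ * κ ξ η) (C' * C) where
  measurable := (hm.measurable.comp measurable_fst).mul hκ.measurable
  nonneg := mul_nonneg hm.nonneg hκ.nonneg
  bound ξ η := by
    rw [norm_mul, mul_assoc]
    exact mul_le_mul (hm.bound _) (hκ.bound _ _) (norm_nonneg _) hm.nonneg

lemma Admissible.mul_right (hκ : Admissible κ C) (hm : BddMul m C') :
    Admissible (fun ξ η => κ ξ η * m η) (C' * C) where
  measurable := hκ.measurable.mul (hm.measurable.comp measurable_snd)
  nonneg := mul_nonneg hm.nonneg hκ.nonneg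
  bound ξ η := by
    rw [norm_mul, mul_assoc, mul_comm]
    exact mul_le_mul (hm.bound _) (hκ.bound _ _) (norm_nonneg _) hm.nonneg

lemma mulOp_kop (hκ : Admissible κ C) (hm : BddMul m C') (v g : L2) :
    mulOp m (kop κ v g) = kop (fun ξ η => m ξ * κ ξ η) v g := by
  refine ext_inner_left ℂ fun f => ?_
  have := inner_mulOp_left hm.conj f (kop κ v g)
  simp only [Complex.conj_conj] at this
  rw [← this, inner_kop hκ, inner_kop (hκ.mul_left hm)]
  refine integral_congr_ae ((kform_congr (mulOp_ae_eq hm.conj f) ae_eq_rfl ae_eq_rfl).trans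
    (Filter.Eventually.of_forall fun p => ?_))
  simp only [kform, map_mul, Complex.conj_conj]; ring

lemma kop_mulOp (hκ : Admissible κ C) (hm : BddMul m C') (v g : L2) :
    kop κ v (mulOp m g) = kop (fun ξ η => κ ξ η * m η) v g := by
  refine ext_inner_left ℂ fun f => ?_
  rw [inner_kop hκ, inner_kop (hκ.mul_right hm)]
  refine integral_congr_ae ((kform_congr ae_eq_rfl ae_eq_rfl (mulOp_ae_eq hm g)).trans
    (Filter.Eventually.of_forall fun p => ?_))
  simp only [kform]; ring

/-- Comparison of two compositions of multipliers and kernel operators. -/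
lemma mulOp_kop_mulOp_congr {m' n' : ℝ → ℂ} {D D' E E' : ℝ} (hκ : Admissible κ C)
    (hκ' : Admissible κ' C') (hm : BddMul m D) (hm' : BddMul m' D') (hn : BddMul n E)
    (hn' : BddMul n' E') (h : ∀ ξ η, m ξ * κ ξ η * n η = m' ξ * κ' ξ η * n' η) (v g : L2) :
    mulOp m (kop κ v (mulOp n g)) = mulOp m' (kop κ' v (mulOp n' g)) := by
  rw [kop_mulOp hκ hn, kop_mulOp hκ' hn', mulOp_kop (hκ.mul_right hn) hm,
    mulOp_kop (hκ'.mul_right hn') hm']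
  simp only [← mul_assoc, h]

end MulOp

/-! ### The abstract energy estimate -/

section Energy

variable {E : Type*} [NormedAddCommGroup E] [InnerProductSpace ℂ E]

lemma norm_sq_eq_re_inner' (x : E) : ‖x‖ ^ 2 = (⟪x, x⟫_ℂ).re := by
  rw [inner_self_eq_norm_sq_to_K, ← RCLike.ofReal_pow]; exact (Complex.ofReal_re _).symm

lemma re_inner_comm (x y : E) : (⟪x, y⟫_ℂ).re = (⟪y, x⟫_ℂ).re := by
  rw [← inner_conj_symm, Complex.conj_re]

lemma abs_re_inner_le (x y : E) : |(⟪x, y⟫_ℂ).re| ≤ ‖x‖ * ‖y‖ :=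
  (Complex.abs_re_le_norm _).trans (norm_inner_le_norm _ _)

lemma hasDerivAt_norm_sq [NormedSpace ℝ E] {x : ℝ → E} {x' : E} {t : ℝ} (h : HasDerivAt x x' t) :
    HasDerivAt (fun t => ‖x t‖ ^ 2) (2 * (⟪x t, x'⟫_ℂ).re) t := by
  have h1 := (h.inner ℂ h)
  have h2 := (Complex.reCLM.hasFDerivAt (x := ⟪x t, x t⟫_ℂ)).comp_hasDerivAt t h1
  have h3 : (fun t => ‖x t‖ ^ 2) = Complex.reCLM ∘ fun t => ⟪x t, x t⟫_ℂ :=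
    funext fun t => norm_sq_eq_re_inner' (x t)
  rw [h3]
  refine h2.congr_deriv ?_
  change (⟪x t, x'⟫_ℂ + ⟪x', x t⟫_ℂ).re = _
  rw [Complex.add_re, re_inner_comm x' (x t)]; ring

/-- An integral curve of an integrable function is absolutely continuous. -/
lemma absolutelyContinuousOnInterval_of_integral {E : Type*} [NormedAddCommGroup E]
    [NormedSpace ℝ E] {T : ℝ} (hT : 0 ≤ T)
    {b y : ℝ → E} (hb : IntervalIntegrable b volume 0 T)
    (hy : ∀ t ∈ Icc 0 T, y t = y 0 + ∫ τ in (0 : ℝ)..t, b τ) :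
    AbsolutelyContinuousOnInterval y 0 T := by
  have hsub : ∀ s ∈ Icc 0 T, ∀ t ∈ Icc 0 T, dist (y s) (y t) ≤
      dist (∫ τ in (0 : ℝ)..s, ‖b τ‖) (∫ τ in (0 : ℝ)..t, ‖b τ‖) := by
    intro s hs t ht
    have hI : ∀ r ∈ Icc 0 T, IntervalIntegrable b volume 0 r := fun r hr =>
      hb.mono_set (by rw [uIcc_of_le hr.1, uIcc_of_le hT]; exact Icc_subset_Icc_right hr.2)
    rw [hy s hs, hy t ht, dist_add_left, dist_eq_norm, dist_eq_norm,
      intervalIntegral.integral_interval_sub_left (hI s hs) (hI t ht),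
      intervalIntegral.integral_interval_sub_left (hI s hs).norm (hI t ht).norm, Real.norm_eq_abs]
    exact intervalIntegral.norm_integral_le_abs_integral_norm
  have hac := hb.norm.absolutelyContinuousOnInterval_intervalIntegral (c := 0) (by simp)
  rw [absolutelyContinuousOnInterval_iff] at hac ⊢
  intro ε hε
  obtain ⟨δ, hδ, H⟩ := hac ε hε
  refine ⟨δ, hδ, fun J hJ hlt => lt_of_le_of_lt (Finset.sum_le_sum fun i hi => ?_) (H J hJ hlt)⟩
  have h2 := hJ.1 i hi
  rw [uIcc_of_le hT] at h2
  exact hsub _ h2.1 _ h2.2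

/-- The curve `y` is differentiable only almost everywhere, since the force is merely integrable in
time. But `‖y‖²` is absolutely continuous, so the fundamental theorem of calculus still holds. -/
lemma norm_sq_eq_integral [NormedSpace ℝ E] [CompleteSpace E] {T : ℝ} {b y : ℝ → E}
    (hb : IntervalIntegrable b volume 0 T)
    (hy : ∀ t ∈ Icc 0 T, y t = y 0 + ∫ τ in (0 : ℝ)..t, b τ) :
    ∀ t ∈ Icc 0 T, IntervalIntegrable (fun τ => 2 * (⟪y τ, b τ⟫_ℂ).re) volume 0 t ∧
      ‖y t‖ ^ 2 = ‖y 0‖ ^ 2 + ∫ τ in (0 : ℝ)..t, 2 * (⟪y τ, b τ⟫_ℂ).re := by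
  intro t ht
  have hb' : IntervalIntegrable b volume 0 t := hb.mono_set (by
    rw [uIcc_of_le ht.1, uIcc_of_le (ht.1.trans ht.2)]; exact Icc_subset_Icc_right ht.2)
  have hy' : ∀ r ∈ Icc 0 t, y r = y 0 + ∫ τ in (0 : ℝ)..r, b τ := fun r hr =>
    hy r ⟨hr.1, hr.2.trans ht.2⟩
  have hac := absolutelyContinuousOnInterval_of_integral ht.1 hb' hy'
  have hnorm : AbsolutelyContinuousOnInterval (fun τ => ‖y τ‖) 0 t := by
    rw [absolutelyContinuousOnInterval_iff] at hac ⊢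
    intro ε hε
    obtain ⟨δ, hδ, H⟩ := hac ε hε
    refine ⟨δ, hδ, fun J hJ hlt => lt_of_le_of_lt (Finset.sum_le_sum fun i hi => ?_) (H J hJ hlt)⟩
    rw [dist_eq_norm (y _)]
    exact dist_norm_norm_le _ _
  have hsq : AbsolutelyContinuousOnInterval (fun τ => ‖y τ‖ ^ 2) 0 t := by
    simp only [sq]; exact hnorm.mul hnorm
  have hderiv : ∀ᵐ τ, τ ∈ uIoc 0 t →
      deriv (fun τ => ‖y τ‖ ^ 2) τ = 2 * (⟪y τ, b τ⟫_ℂ).re := by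
    -- The formula for `y` is known on `[0,t]` only, so the endpoint is discarded to have it in a
    -- neighbourhood of `τ`.
    have hne : ∀ᵐ τ : ℝ, τ ≠ t := by simp [ae_iff, measure_singleton]
    filter_upwards [hb'.ae_hasDerivAt_integral, hne] with τ h1 h2 h3
    rw [uIoc_of_le ht.1] at h3
    have h4 := h1 (by rw [uIcc_of_le ht.1]; exact Ioc_subset_Icc_self h3) 0 (by simp)
    have h5 : HasDerivAt y (b τ) τ := by
      refine (h4.const_add (y 0)).congr_of_eventuallyEq ?_
      filter_upwards [Ioo_mem_nhds h3.1 (lt_of_le_of_ne h3.2 h2)] with r hr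
      exact hy' r ⟨hr.1.le, hr.2.le⟩
    exact (hasDerivAt_norm_sq h5).deriv
  have hint := hsq.intervalIntegrable_deriv
  have h6 := hsq.integral_deriv_eq_sub
  rw [intervalIntegral.integral_congr_ae hderiv] at h6
  refine ⟨hint.congr_ae ?_, by linarith⟩
  rw [Filter.EventuallyEq, ae_restrict_iff' measurableSet_uIoc]
  exact hderiv

/-- With `Φ` the primitive of `F`, the quantity `e^{-Cr}(CΦ(r) + D)` is nonincreasing; no sign of
`F` is needed. -/
lemma gronwall_integral {T C D : ℝ} {F : ℝ → ℝ} (hC : 0 ≤ C) (hF : ContinuousOn F (Icc 0 T))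
    (h : ∀ t ∈ Icc 0 T, F t ≤ D + C * ∫ τ in (0 : ℝ)..t, F τ) :
    ∀ t ∈ Icc 0 T, F t ≤ D * Real.exp (C * t) := by
  intro t ht
  have hT : 0 ≤ T := ht.1.trans ht.2
  have hI : IntervalIntegrable F volume 0 T := by
    apply ContinuousOn.intervalIntegrable; rwa [uIcc_of_le hT]
  set Φ : ℝ → ℝ := fun t => ∫ τ in (0 : ℝ)..t, F τ with hΦ
  have hΦc : ContinuousOn Φ (Icc 0 T) := by
    have := intervalIntegral.continuousOn_primitive_interval' hI (left_mem_uIcc)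
    rwa [uIcc_of_le hT] at this
  have hd : ∀ r ∈ Ioo 0 T, HasDerivAt Φ (F r) r := fun r hr => by
    have hn : Icc 0 T ∈ nhds r := Icc_mem_nhds hr.1 hr.2
    exact intervalIntegral.integral_hasDerivAt_right
      (hI.mono_set (by
        rw [uIcc_of_le hr.1.le, uIcc_of_le hT]; exact Icc_subset_Icc_right hr.2.le))
      (hF.stronglyMeasurableAtFilter_nhdsWithin measurableSet_Icc r |>.filter_mono
        (by rw [nhdsWithin_eq_nhds.2 hn]))
      (hF.continuousAt hn)
  have hanti : AntitoneOn (fun r => Real.exp (-C * r) * (C * Φ r + D)) (Icc 0 T) := by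
    apply antitoneOn_of_deriv_nonpos (convex_Icc _ _)
    · fun_prop
    · intro r hr
      rw [interior_Icc] at hr
      have := hd r hr
      exact ((by fun_prop : DifferentiableAt ℝ (fun r => Real.exp (-C * r)) r).mul
        ((this.differentiableAt.const_mul C).add_const D)).differentiableWithinAt
    · intro r hr
      rw [interior_Icc] at hr
      have h1 : HasDerivAt (fun r => Real.exp (-C * r)) (Real.exp (-C * r) * (-C)) r := by
        simpa using ((hasDerivAt_id r).const_mul (-C)).exp
      have h2 := h1.mul (((hd r hr).const_mul C).add_const D)
      rw [show deriv (fun r => Real.exp (-C * r) * (C * Φ r + D)) r = _ from h2.deriv]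
      have h3 := h r ⟨hr.1.le, hr.2.le⟩
      have h4 := Real.exp_pos (-C * r)
      have h5 : 0 ≤ Real.exp (-C * r) * (C * (D + C * Φ r - F r)) := by
        apply mul_nonneg h4.le; apply mul_nonneg hC; linarith
      nlinarith
  have h1 := hanti ⟨le_rfl, hT⟩ ht ht.1
  simp only [hΦ, intervalIntegral.integral_same, mul_zero, Real.exp_zero, zero_add, one_mul] at h1
  have h2 := h t ht
  have h3 : Real.exp (C * t) * Real.exp (-C * t) = 1 := by rw [← Real.exp_add]; simp
  calc F t ≤ C * Φ t + D := by linarith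
    _ = (Real.exp (C * t) * Real.exp (-C * t)) * (C * Φ t + D) := by rw [h3, one_mul]
    _ = Real.exp (C * t) * (Real.exp (-C * t) * (C * Φ t + D)) := by ring
    _ ≤ Real.exp (C * t) * D := by gcongr
    _ = _ := mul_comm _ _

/-- The coefficient of the lower order term in the energy. -/
def energyCoeff (M : ℝ) : ℝ := 1 / 2 + 4 * (1 + M ^ 2) ^ 3

/-- The exponential growth rate of the energy. -/
def energyRate (M M' : ℝ) : ℝ := 2 * (4 * M + 2 * M ^ 2 + 2 * M * M' + 2 * energyCoeff M + 1)

lemma energyCoeff_ge_one (M : ℝ) : 1 ≤ energyCoeff M := by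
  unfold energyCoeff
  have : 1 ≤ (1 + M ^ 2) ^ 3 := one_le_pow₀ (by nlinarith [sq_nonneg M])
  linarith

/-- The quadratic form controlled by the energy. -/
def stateSq (A : E →L[ℂ] E) (x y : E) : ℝ := ‖y‖ ^ 2 + ‖A x‖ ^ 2 + ‖x‖ ^ 2

lemma stateSq_nonneg (A : E →L[ℂ] E) (x y : E) : 0 ≤ stateSq A x y := by
  unfold stateSq; positivity

/-- The choice `δ = 1/(2(1+M²))` lets half of `‖Ax‖²` absorb the negative energy term; the price
`M²δ⁻²` is at most `4(1+M²)³`, which explains `energyCoeff`. -/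
lemma coercivity {M d a x : ℝ} (hx : 0 ≤ x) (ha : 0 ≤ a)
    (h : ∀ δ > 0, d ≤ δ * a + δ⁻¹ ^ 2 * x) :
    M ^ 2 * d ≤ 1 / 2 * a + 4 * (1 + M ^ 2) ^ 3 * x := by
  have h1 : 0 < 1 + M ^ 2 := by positivity
  have h2 := h (2 * (1 + M ^ 2))⁻¹ (by positivity)
  rw [inv_inv] at h2
  have h3 : M ^ 2 * (2 * (1 + M ^ 2))⁻¹ ≤ 1 / 2 := by
    rw [← div_eq_mul_inv, div_le_iff₀ (by positivity)]; nlinarith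
  have h4 : M ^ 2 * (2 * (1 + M ^ 2)) ^ 2 ≤ 4 * (1 + M ^ 2) ^ 3 := by
    nlinarith [sq_nonneg (1 + M ^ 2)]
  calc M ^ 2 * d ≤ M ^ 2 * ((2 * (1 + M ^ 2))⁻¹ * a + (2 * (1 + M ^ 2)) ^ 2 * x) := by gcongr
    _ = M ^ 2 * (2 * (1 + M ^ 2))⁻¹ * a + M ^ 2 * (2 * (1 + M ^ 2)) ^ 2 * x := by ring
    _ ≤ _ := by gcongr

/-- The hypotheses of the abstract energy estimate on the operators `A = |D|^{3/2}`, `D = ∂`, the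
frequency cutoff `P`, and the family `V t` with derivative `V' t`. -/
structure EnergyOps [NormedSpace ℝ E] (T M M' : ℝ) (A D P : E →L[ℂ] E) (V V' : ℝ → E →L[ℂ] E) : Prop where
  M_nonneg : 0 ≤ M
  M'_nonneg : 0 ≤ M'
  symm_A : ∀ f g, ⟪A f, g⟫_ℂ = ⟪f, A g⟫_ℂ
  symm_P : ∀ f g, ⟪P f, g⟫_ℂ = ⟪f, P g⟫_ℂ
  absorb_A : ∀ f, P (A f) = A f
  absorb_D : ∀ f, P (D f) = D f
  idem_P : ∀ f, P (P f) = P f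
  continuous_V : Continuous V
  continuous_V' : Continuous V'
  deriv_V : ∀ t (z : ℝ → E) (z' : E), HasDerivAt z z' t →
    HasDerivAt (fun t => V t (z t)) (V' t (z t) + V t z') t
  bound_V : ∀ t ∈ Icc 0 T, ∀ f, ‖V t f‖ ≤ M * ‖f‖
  bound_V' : ∀ t ∈ Icc 0 T, ∀ f, ‖V' t f‖ ≤ M' * ‖f‖
  comm_one : ∀ t ∈ Icc 0 T, ∀ f, P f = f → |(⟪f, V t (D f)⟫_ℂ).re| ≤ M * ‖f‖ ^ 2
  comm_two : ∀ t ∈ Icc 0 T, ∀ f g, P f = f → P g = g →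
    |(⟪f, V t (V t (D g))⟫_ℂ + ⟪V t (D f), V t g⟫_ℂ).re| ≤ M ^ 2 * ‖f‖ * ‖g‖
  interp : ∀ δ > 0, ∀ f, ‖D f‖ ^ 2 ≤ δ * ‖A f‖ ^ 2 + δ⁻¹ ^ 2 * ‖f‖ ^ 2

variable [NormedSpace ℝ E] [LinearMap.CompatibleSMul E E ℝ ℂ] [CompleteSpace E]

set_option maxHeartbeats 1000000 in
/-- The energy estimate for the frequency-localised equation. -/
theorem energy_estimate {T M M' : ℝ} {A D P : E →L[ℂ] E} {V V' : ℝ → E →L[ℂ] E}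
    (H : EnergyOps T M M' A D P V V') (hT : 0 ≤ T) {x y r : ℝ → E} {ρ : ℝ → ℝ}
    (hyc : Continuous y) (hx : ∀ t, HasDerivAt x (y t) t) (hr : IntervalIntegrable r volume 0 T)
    (hPy : ∀ t ∈ Icc 0 T, P (y t) = y t)
    (hy : ∀ t ∈ Icc 0 T, y t = y 0 + ∫ τ in (0 : ℝ)..t,
      (-(A (A (x τ))) - (2 : ℂ) • P (V τ (D (y τ))) - P (V τ (V τ (D (D (x τ))))) + r τ))
    (hρ : IntervalIntegrable ρ volume 0 T) (hρ0 : ∀ τ, 0 ≤ ρ τ)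
    (hyr : ∀ᵐ τ, τ ∈ Icc 0 T → 2 * (⟪y τ, r τ⟫_ℂ).re ≤ stateSq A (x τ) (y τ) + ρ τ) :
    ∀ t ∈ Icc 0 T, stateSq A (x t) (y t) ≤ 2 * Real.exp (energyRate M M' * T) *
      (energyCoeff M * stateSq A (x 0) (y 0) + ∫ τ in (0 : ℝ)..T, ρ τ) := by
  have hM := H.M_nonneg
  have hM' := H.M'_nonneg
  have hxc : Continuous x := continuous_iff_continuousAt.2 fun t => (hx t).continuousAt
  have hVc := H.continuous_V
  have hVc' := H.continuous_V'
  set K := energyCoeff M with hK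
  have hK1 : 1 ≤ K := energyCoeff_ge_one M
  have hclm : ∀ (B : E →L[ℂ] E) t, HasDerivAt (fun t => B (x t)) (B (y t)) t := fun B t =>
    ((B.restrictScalars ℝ).hasFDerivAt.comp_hasDerivAt t (hx t))
  -- The energy is `‖y‖² + G`. The part `G` is differentiable everywhere because `x` and `V` are;
  -- only `‖y‖²` needs the absolutely continuous version of the chain rule.
  set G : ℝ → ℝ := fun t => ‖A (x t)‖ ^ 2 - ‖V t (D (x t))‖ ^ 2 + K * ‖x t‖ ^ 2 with hG
  set g : ℝ → ℝ := fun t => 2 * (⟪A (x t), A (y t)⟫_ℂ).re -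
    2 * (⟪V t (D (x t)), V' t (D (x t)) + V t (D (y t))⟫_ℂ).re +
    K * (2 * (⟪x t, y t⟫_ℂ).re) with hg
  have hGd : ∀ t, HasDerivAt G (g t) t := fun t =>
    ((hasDerivAt_norm_sq (hclm A t)).sub
      (hasDerivAt_norm_sq (H.deriv_V t _ _ (hclm D t)))).add
      ((hasDerivAt_norm_sq (hx t)).const_mul K)
  have hgc : Continuous g := by
    simp only [hg]; fun_prop
  have hGc : Continuous G := continuous_iff_continuousAt.2 fun t => (hGd t).continuousAt
  set b : ℝ → E := fun τ => -(A (A (x τ))) - (2 : ℂ) • P (V τ (D (y τ))) -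
    P (V τ (V τ (D (D (x τ))))) + r τ with hb
  have hbi : IntervalIntegrable b volume 0 T :=
    (Continuous.intervalIntegrable (by fun_prop) _ _).add hr
  have hyn := norm_sq_eq_integral hbi hy
  set F : ℝ → ℝ := fun t => ‖y t‖ ^ 2 + G t with hF
  have hFc : Continuous F := by simp only [hF]; fun_prop
  have hcoer : ∀ t ∈ Icc 0 T, stateSq A (x t) (y t) ≤ 2 * F t := fun t ht => by
    have h1 := coercivity (M := M) (sq_nonneg ‖x t‖) (sq_nonneg ‖A (x t)‖)
      (fun δ hδ => H.interp δ hδ (x t))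
    have h2 : ‖V t (D (x t))‖ ^ 2 ≤ M ^ 2 * ‖D (x t)‖ ^ 2 := by
      rw [← mul_pow]; gcongr; exact H.bound_V t ht _
    simp only [hF, hG, stateSq, hK, energyCoeff]
    nlinarith [sq_nonneg ‖y t‖]
  have hpt : ∀ᵐ τ, τ ∈ Icc 0 T →
      2 * (⟪y τ, b τ⟫_ℂ).re + g τ ≤ energyRate M M' * F τ + ρ τ := by
    filter_upwards [hyr] with τ h1 hτ
    have h1 := h1 hτ
    have hS := stateSq_nonneg A (x τ) (y τ)
    have hSF := hcoer τ hτ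
    have hPD : P (D (x τ)) = D (x τ) := H.absorb_D _
    have c1 := H.comm_one τ hτ (y τ) (hPy τ hτ)
    have c2 := H.comm_two τ hτ (y τ) (D (x τ)) (hPy τ hτ) hPD
    have e1 : (⟪y τ, b τ⟫_ℂ).re = -(⟪A (x τ), A (y τ)⟫_ℂ).re -
        2 * (⟪y τ, V τ (D (y τ))⟫_ℂ).re - (⟪y τ, V τ (V τ (D (D (x τ))))⟫_ℂ).re +
        (⟪y τ, r τ⟫_ℂ).re := by
      have a1 : (⟪y τ, A (A (x τ))⟫_ℂ).re = (⟪A (x τ), A (y τ)⟫_ℂ).re := by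
        rw [← H.symm_A, re_inner_comm]
      have a2 : ∀ z, ⟪y τ, P z⟫_ℂ = ⟪y τ, z⟫_ℂ := fun z => by rw [← H.symm_P, hPy τ hτ]
      simp only [hb, inner_add_right, inner_sub_right, inner_neg_right, inner_smul_right, a2]
      simp [a1]
    have e2 : g τ = 2 * (⟪A (x τ), A (y τ)⟫_ℂ).re -
        2 * (⟪V τ (D (x τ)), V' τ (D (x τ))⟫_ℂ).re - 2 * (⟪V τ (D (y τ)), V τ (D (x τ))⟫_ℂ).re +
        2 * K * (⟪x τ, y τ⟫_ℂ).re := by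
      simp only [hg, inner_add_right, Complex.add_re]
      rw [re_inner_comm (V τ (D (x τ))) (V τ (D (y τ)))]; ring
    rw [Complex.add_re] at c2
    have hD := H.interp 1 one_pos (x τ)
    have c3 : |(⟪V τ (D (x τ)), V' τ (D (x τ))⟫_ℂ).re| ≤ M * M' * ‖D (x τ)‖ ^ 2 := by
      refine (abs_re_inner_le _ _).trans ?_
      calc _ ≤ (M * ‖D (x τ)‖) * (M' * ‖D (x τ)‖) := by
            gcongr
            · exact H.bound_V τ hτ _
            · exact H.bound_V' τ hτ _
        _ = _ := by ring
    have c4 := abs_re_inner_le (x τ) (y τ)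
    have c5 : ‖D (x τ)‖ ^ 2 + ‖y τ‖ ^ 2 ≤ stateSq A (x τ) (y τ) := by
      unfold stateSq; linarith
    have c6 : ‖x τ‖ ^ 2 + ‖y τ‖ ^ 2 ≤ stateSq A (x τ) (y τ) := by
      unfold stateSq; nlinarith [sq_nonneg ‖A (x τ)‖]
    have d1 : -(4 * (⟪y τ, V τ (D (y τ))⟫_ℂ).re) ≤ 4 * M * stateSq A (x τ) (y τ) := by
      have := neg_abs_le (⟪y τ, V τ (D (y τ))⟫_ℂ).re
      have : M * ‖y τ‖ ^ 2 ≤ M * stateSq A (x τ) (y τ) := by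
        gcongr; nlinarith [sq_nonneg ‖x τ‖]
      linarith
    -- The decisive cancellation. The term `V V ∂∂x` of the equation and the derivative of `-‖V∂x‖²`
    -- combine into the double commutator of `y` with `∂x`, which loses no derivative beyond `‖∂x‖`.
    have d2 : -(2 * ((⟪y τ, V τ (V τ (D (D (x τ))))⟫_ℂ).re +
        (⟪V τ (D (y τ)), V τ (D (x τ))⟫_ℂ).re)) ≤ 2 * M ^ 2 * stateSq A (x τ) (y τ) := by
      have h3 := neg_abs_le ((⟪y τ, V τ (V τ (D (D (x τ))))⟫_ℂ).re +
        (⟪V τ (D (y τ)), V τ (D (x τ))⟫_ℂ).re)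
      have h4 : ‖y τ‖ * ‖D (x τ)‖ ≤ stateSq A (x τ) (y τ) := by
        nlinarith [sq_nonneg (‖y τ‖ - ‖D (x τ)‖), sq_nonneg ‖y τ‖, sq_nonneg ‖D (x τ)‖]
      have h5 : M ^ 2 * (‖y τ‖ * ‖D (x τ)‖) ≤ M ^ 2 * stateSq A (x τ) (y τ) := by gcongr
      linarith
    have d3 : -(2 * (⟪V τ (D (x τ)), V' τ (D (x τ))⟫_ℂ).re) ≤
        2 * M * M' * stateSq A (x τ) (y τ) := by
      have h3 := neg_abs_le (⟪V τ (D (x τ)), V' τ (D (x τ))⟫_ℂ).re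
      have h4 : M * M' * ‖D (x τ)‖ ^ 2 ≤ M * M' * stateSq A (x τ) (y τ) := by
        gcongr; nlinarith [sq_nonneg ‖y τ‖]
      linarith
    have d4 : 2 * K * (⟪x τ, y τ⟫_ℂ).re ≤ 2 * K * stateSq A (x τ) (y τ) := by
      gcongr
      nlinarith [le_abs_self (⟪x τ, y τ⟫_ℂ).re, sq_nonneg (‖x τ‖ - ‖y τ‖), sq_nonneg ‖y τ‖,
        sq_nonneg ‖x τ‖]
    have hrate : (4 * M + 2 * M ^ 2 + 2 * M * M' + 2 * K + 1) * stateSq A (x τ) (y τ) ≤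
        energyRate M M' * F τ := by
      have h0 : 0 ≤ 4 * M + 2 * M ^ 2 + 2 * M * M' + 2 * K + 1 := by positivity
      have := mul_le_mul_of_nonneg_left hSF h0
      unfold energyRate; linarith
    rw [e1, e2]
    linarith only [d1, d2, d3, d4, h1, hrate]
  have hFint : ∀ t ∈ Icc 0 T, F t ≤ (F 0 + ∫ τ in (0 : ℝ)..T, ρ τ) +
      energyRate M M' * ∫ τ in (0 : ℝ)..t, F τ := by
    intro t ht
    have hsub : uIcc 0 t ⊆ uIcc 0 T := by
      rw [uIcc_of_le ht.1, uIcc_of_le hT]; exact Icc_subset_Icc_right ht.2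
    obtain ⟨hi, hn⟩ := hyn t ht
    have hG' : ∫ τ in (0 : ℝ)..t, g τ = G t - G 0 :=
      intervalIntegral.integral_eq_sub_of_hasDerivAt (fun τ _ => hGd τ) (hgc.intervalIntegrable _ _)
    have hsum : F t = F 0 + ∫ τ in (0 : ℝ)..t, (2 * (⟪y τ, b τ⟫_ℂ).re + g τ) := by
      rw [intervalIntegral.integral_add hi (hgc.intervalIntegrable _ _), hG']
      simp only [hF]; rw [hn]; ring
    have hmono : ∫ τ in (0 : ℝ)..t, (2 * (⟪y τ, b τ⟫_ℂ).re + g τ) ≤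
        ∫ τ in (0 : ℝ)..t, (energyRate M M' * F τ + ρ τ) := by
      refine intervalIntegral.integral_mono_ae_restrict ht.1 (hi.add (hgc.intervalIntegrable _ _))
        (((hFc.intervalIntegrable _ _).const_mul _).add (hρ.mono_set hsub)) ?_
      rw [Filter.EventuallyLE, ae_restrict_iff' measurableSet_Icc]
      filter_upwards [hpt] with τ h1 hτ
      exact h1 ⟨hτ.1, hτ.2.trans ht.2⟩
    have hρt : ∫ τ in (0 : ℝ)..t, ρ τ ≤ ∫ τ in (0 : ℝ)..T, ρ τ :=
      intervalIntegral.integral_mono_interval le_rfl ht.1 ht.2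
        (Filter.Eventually.of_forall hρ0) hρ
    rw [intervalIntegral.integral_add ((hFc.intervalIntegrable _ _).const_mul _)
      (hρ.mono_set hsub), intervalIntegral.integral_const_mul] at hmono
    linarith
  have hrate0 : 0 ≤ energyRate M M' := by unfold energyRate; positivity
  intro t ht
  have h1 := gronwall_integral hrate0 hFc.continuousOn hFint t ht
  have h2 := hcoer t ht
  have h3 : F 0 ≤ K * stateSq A (x 0) (y 0) := by
    simp only [hF, hG, stateSq]
    nlinarith [sq_nonneg ‖V 0 (D (x 0))‖, sq_nonneg ‖y 0‖, sq_nonneg ‖A (x 0)‖]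
  have h4 : 0 ≤ ∫ τ in (0 : ℝ)..T, ρ τ := intervalIntegral.integral_nonneg hT fun τ _ => hρ0 τ
  have h5 : 0 ≤ K * stateSq A (x 0) (y 0) :=
    mul_nonneg (by linarith) (stateSq_nonneg _ _ _)
  have h6 : Real.exp (energyRate M M' * t) ≤ Real.exp (energyRate M M' * T) := by
    apply Real.exp_le_exp.2; exact mul_le_mul_of_nonneg_left ht.2 hrate0
  calc stateSq A (x t) (y t) ≤ 2 * F t := h2
    _ ≤ 2 * ((F 0 + ∫ τ in (0 : ℝ)..T, ρ τ) * Real.exp (energyRate M M' * t)) := by gcongr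
    _ ≤ 2 * ((K * stateSq A (x 0) (y 0) + ∫ τ in (0 : ℝ)..T, ρ τ) *
        Real.exp (energyRate M M' * t)) := by gcongr
    _ ≤ 2 * ((K * stateSq A (x 0) (y 0) + ∫ τ in (0 : ℝ)..T, ρ τ) *
        Real.exp (energyRate M M' * T)) := by gcongr
    _ = _ := by ring

end Energy

/-! ### Linear ODEs in Banach spaces -/

/-- Global solvability of Lipschitz Volterra equations. -/
theorem exists_volterra {X : Type*} [NormedAddCommGroup X] [NormedSpace ℝ X] [CompleteSpace X]
    {T a : ℝ} (hT : 0 ≤ T) (ha : 0 ≤ a) {A : ℝ → X → X} (hAc : Continuous fun p : ℝ × X => A p.1 p.2)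
    (hA : ∀ t ∈ Icc 0 T, ∀ x y, ‖A t x - A t y‖ ≤ a * ‖x - y‖) {F : ℝ → X} (hF : Continuous F) :
    ∃ y : ℝ → X, Continuous y ∧ ∀ t ∈ Icc 0 T, y t = F t + ∫ τ in (0 : ℝ)..t, A τ (y τ) := by
  -- The unknown is `e^{-λt} y(t)`. In this weighted norm the Volterra map has Lipschitz constant at
  -- most `a/λ ≤ 1/2`, so a single fixed point covers all of `[0,T]`.
  set lam : ℝ := 2 * a + 1 with hlam
  have hlam0 : 0 < lam := by positivity
  let ext : C(Icc 0 T, X) → ℝ → X := fun z t => Real.exp (lam * t) • z (projIcc 0 T hT t)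
  have hext : ∀ z, Continuous (ext z) := fun z =>
    (by fun_prop : Continuous fun t : ℝ => Real.exp (lam * t)).smul
      (z.continuous.comp continuous_projIcc)
  have hint : ∀ z, Continuous fun τ => A τ (ext z τ) := fun z =>
    hAc.comp (continuous_id.prodMk (hext z))
  let Φ : C(Icc 0 T, X) → C(Icc 0 T, X) := fun z =>
    ⟨fun t => Real.exp (-(lam * t)) • (F t + ∫ τ in (0 : ℝ)..t, A τ (ext z τ)), by
      have h1 : Continuous fun t : ℝ => ∫ τ in (0 : ℝ)..t, A τ (ext z τ) :=
        intervalIntegral.continuous_primitive (fun a b => (hint z).intervalIntegrable a b) 0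
      fun_prop⟩
  have hΦ : ContractingWith (1 / 2) Φ := by
    refine ⟨by norm_num, LipschitzWith.of_dist_le_mul fun z z' => ?_⟩
    rw [ContinuousMap.dist_le (by positivity)]
    intro t
    have h1 : ∀ τ ∈ Icc 0 (t : ℝ), ‖A τ (ext z τ) - A τ (ext z' τ)‖ ≤
        a * dist z z' * Real.exp (lam * τ) := fun τ hτ => by
      refine (hA τ ⟨hτ.1, hτ.2.trans t.2.2⟩ _ _).trans ?_
      rw [mul_assoc]
      gcongr
      simp only [ext]
      rw [← smul_sub, norm_smul, Real.norm_eq_abs, Real.abs_exp, mul_comm, ← dist_eq_norm]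
      gcongr
      exact ContinuousMap.dist_apply_le_dist _
    have h2 : ‖∫ τ in (0 : ℝ)..t, (A τ (ext z τ) - A τ (ext z' τ))‖ ≤
        ∫ τ in (0 : ℝ)..t, a * dist z z' * Real.exp (lam * τ) :=
      intervalIntegral.norm_integral_le_of_norm_le t.2.1
        (ae_of_all _ fun τ hτ => h1 τ (Ioc_subset_Icc_self hτ))
        (Continuous.intervalIntegrable (by fun_prop) _ _)
    have h3 : ∫ τ in (0 : ℝ)..t, a * dist z z' * Real.exp (lam * τ) =
        a * dist z z' * ((Real.exp (lam * t) - 1) / lam) := by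
      rw [intervalIntegral.integral_const_mul]
      congr 1
      rw [intervalIntegral.integral_eq_sub_of_hasDerivAt (f := fun τ => Real.exp (lam * τ) / lam)]
      · simp; ring
      · intro τ _
        have := (((hasDerivAt_id τ).const_mul lam).exp).div_const lam
        simpa [hlam0.ne'] using this
      · exact Continuous.intervalIntegrable (by fun_prop) _ _
    have h4 : Φ z t - Φ z' t = Real.exp (-(lam * t)) •
        ∫ τ in (0 : ℝ)..t, (A τ (ext z τ) - A τ (ext z' τ)) := by
      simp only [Φ, ContinuousMap.coe_mk]
      rw [intervalIntegral.integral_sub ((hint z).intervalIntegrable _ _)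
        ((hint z').intervalIntegrable _ _), ← smul_sub, add_sub_add_left_eq_sub]
    rw [dist_eq_norm, h4, norm_smul, Real.norm_eq_abs, Real.abs_exp]
    calc _ ≤ Real.exp (-(lam * t)) * (a * dist z z' * ((Real.exp (lam * t) - 1) / lam)) := by
          gcongr; exact h2.trans h3.le
      _ = a / lam * (1 - Real.exp (-(lam * t))) * dist z z' := by
          have : Real.exp (-(lam * t)) * Real.exp (lam * t) = 1 := by rw [← Real.exp_add]; simp
          field_simp
          linear_combination (a * dist z z') * this
      _ ≤ 1 / 2 * 1 * dist z z' := by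
          have e1 : a / lam ≤ 1 / 2 := by rw [div_le_div_iff₀ hlam0 two_pos]; linarith
          have e2 : 0 ≤ 1 - Real.exp (-(lam * t)) := by
            rw [sub_nonneg, Real.exp_le_one_iff, Left.neg_nonpos_iff]
            exact mul_nonneg hlam0.le t.2.1
          have e3 := Real.exp_pos (-(lam * t))
          exact mul_le_mul_of_nonneg_right
            (mul_le_mul e1 (by linarith) e2 (by norm_num)) dist_nonneg
      _ = _ := by simp
  have : Nonempty C(Icc 0 T, X) := ⟨0⟩
  set z := hΦ.fixedPoint with hz
  have hfix : Φ z = z := hΦ.fixedPoint_isFixedPt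
  refine ⟨ext z, hext z, fun t ht => ?_⟩
  have h1 : z ⟨t, ht⟩ = Real.exp (-(lam * t)) • (F t + ∫ τ in (0 : ℝ)..t, A τ (ext z τ)) := by
    conv_lhs => rw [← hfix]
    rfl
  simp only [ext]
  rw [projIcc_of_mem hT ht, h1, smul_smul, ← Real.exp_add]
  simp [ext]

/-! ### Weak limits and weak measurability in Hilbert spaces -/

section Hilbert

variable {E : Type*} [NormedAddCommGroup E] [InnerProductSpace ℂ E]

/-- Weak compactness of balls, along an ultrafilter. -/
lemma exists_weak_limit [CompleteSpace E] (U : Ultrafilter ℕ) {f : ℕ → E} {B : ℝ} (hB : ∀ n, ‖f n‖ ≤ B) :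
    ∃ g : E, ‖g‖ ≤ B ∧ ∀ φ, Tendsto (fun n => ⟪φ, f n⟫_ℂ) U (𝓝 ⟪φ, g⟫_ℂ) := by
  have hc := WeakDual.isCompact_closedBall (𝕜 := ℂ) (E := E) (0 : StrongDual ℂ E) B
  let F : ℕ → WeakDual ℂ E := fun n => StrongDual.toWeakDual (InnerProductSpace.toDual ℂ E (f n))
  have hF : ∀ n, F n ∈ WeakDual.toStrongDual ⁻¹' Metric.closedBall (0 : StrongDual ℂ E) B :=
    fun n => by
      refine mem_closedBall_zero_iff.2 ?_
      change ‖InnerProductSpace.toDual ℂ E (f n)‖ ≤ B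
      rw [LinearIsometryEquiv.norm_map]
      exact hB n
  obtain ⟨ℓ, hℓ, hlim⟩ := hc.ultrafilter_le_nhds (U.map F) (by
    rw [le_principal_iff]; exact Filter.mem_map.2 (Filter.Eventually.of_forall hF))
  refine ⟨(InnerProductSpace.toDual ℂ E).symm (WeakDual.toStrongDual ℓ), ?_, fun φ => ?_⟩
  · rw [LinearIsometryEquiv.norm_map]
    exact mem_closedBall_zero_iff.1 hℓ
  · have h1 : Tendsto (fun n => F n φ) U (𝓝 (ℓ φ)) :=
      ((WeakDual.eval_continuous φ).tendsto ℓ).comp hlim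
    have h2 := (Complex.continuous_conj.tendsto _).comp h1
    rw [← inner_conj_symm, InnerProductSpace.toDual_symm_apply]
    refine h2.congr fun n => ?_
    change conj (InnerProductSpace.toDual ℂ E (f n) φ) = _
    rw [InnerProductSpace.toDual_apply_apply, inner_conj_symm]

/-- Pointwise weak convergence of a bounded, weakly equicontinuous sequence of curves passes to
time integrals. -/
lemma tendsto_integral_inner {T B : ℝ} (U : Ultrafilter ℕ) {Yn : ℕ → ℝ → E} {Y : ℝ → E}
    (hB : ∀ n, ∀ t ∈ Icc 0 T, ‖Yn n t‖ ≤ B)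
    (hlim : ∀ t ∈ Icc 0 T, ∀ φ, Tendsto (fun n => ⟪φ, Yn n t⟫_ℂ) U (𝓝 ⟪φ, Y t⟫_ℂ))
    {S : Set E} (hS : Dense S) (heq : ∀ φ ∈ S, ∃ w : ℝ → ℝ, Continuous w ∧
      ∀ n, ∀ t ∈ Icc 0 T, ∀ t' ∈ Icc 0 T, ‖⟪φ, Yn n t - Yn n t'⟫_ℂ‖ ≤ |w t - w t'|)
    {χ : ℝ → E} (hχ : Continuous χ) :
    ContinuousOn (fun τ => ⟪χ τ, Y τ⟫_ℂ) (Icc 0 T) ∧ ∀ t ∈ Icc 0 T,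
      Tendsto (fun n => ∫ τ in (0 : ℝ)..t, ⟪χ τ, Yn n τ⟫_ℂ) U
        (𝓝 (∫ τ in (0 : ℝ)..t, ⟪χ τ, Y τ⟫_ℂ)) := by
  let F : ℕ → Icc 0 T → ℂ := fun n τ => ⟪χ τ, Yn n τ⟫_ℂ
  let F0 : Icc 0 T → ℂ := fun τ => ⟪χ τ, Y τ⟫_ℂ
  have hF : Equicontinuous F := by
    intro t₀
    rw [Metric.equicontinuousAt_iff_right]
    intro ε hε
    have hB0 : 0 ≤ B := (norm_nonneg _).trans (hB 0 t₀ t₀.2)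
    obtain ⟨φ, hφS, hφ⟩ := hS.exists_dist_lt (χ t₀) (show 0 < ε / (8 * (B + 1)) by positivity)
    obtain ⟨w, hwc, hw⟩ := heq φ hφS
    have hc1 : ∀ᶠ t : Icc 0 T in 𝓝 t₀, dist (χ t) (χ t₀) < ε / (4 * (B + 1)) :=
      (Metric.continuous_iff'.1 (hχ.comp continuous_subtype_val)) t₀ _ (by positivity)
    have hc2 : ∀ᶠ t : Icc 0 T in 𝓝 t₀, dist (w t) (w t₀) < ε / 4 :=
      (Metric.continuous_iff'.1 (hwc.comp continuous_subtype_val)) t₀ _ (by positivity)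
    filter_upwards [hc1, hc2] with t h1 h2 n
    rw [dist_comm, dist_eq_norm]
    -- Three sources of variation: the moving test vector, the error in replacing it by an element
    -- of the dense set, and the equicontinuity assumed on that set.
    have e : F n t - F n t₀ = ⟪χ t - χ t₀, Yn n t⟫_ℂ + ⟪χ t₀ - φ, Yn n t - Yn n t₀⟫_ℂ +
        ⟪φ, Yn n t - Yn n t₀⟫_ℂ := by
      simp only [F, inner_sub_left, inner_sub_right]; ring
    have b1 : ‖⟪χ t - χ t₀, Yn n t⟫_ℂ‖ ≤ ε / (4 * (B + 1)) * B := by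
      refine (norm_inner_le_norm _ _).trans ?_
      gcongr
      · rw [← dist_eq_norm]; exact h1.le
      · exact hB n t t.2
    have b2 : ‖⟪χ t₀ - φ, Yn n t - Yn n t₀⟫_ℂ‖ ≤ ε / (8 * (B + 1)) * (B + B) := by
      refine (norm_inner_le_norm _ _).trans ?_
      gcongr
      · rw [← dist_eq_norm]; exact hφ.le
      · exact (norm_sub_le _ _).trans (add_le_add (hB n t t.2) (hB n t₀ t₀.2))
    have b3 := hw n t t.2 t₀ t₀.2
    rw [Real.dist_eq] at h2
    have b4 : ε / (4 * (B + 1)) * B ≤ ε / 4 := by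
      rw [div_mul_eq_mul_div, div_le_div_iff₀ (by positivity) (by positivity)]; nlinarith
    have b5 : ε / (8 * (B + 1)) * (B + B) ≤ ε / 4 := by
      rw [div_mul_eq_mul_div, div_le_div_iff₀ (by positivity) (by positivity)]; nlinarith
    rw [e]
    refine lt_of_le_of_lt (norm_add₃_le) ?_
    linarith
  -- On a compact interval an equicontinuous family that converges pointwise converges uniformly;
  -- continuity of the limit and convergence of the integrals follow.
  have hu : TendstoUniformly F F0 U := by
    have := (hF.tendsto_uniformFun_iff_pi U F0).2 (tendsto_pi_nhds.2 fun τ => hlim τ τ.2 _)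
    exact UniformFun.tendsto_iff_tendstoUniformly.1 this
  have hFc : ∀ n, ContinuousOn (fun τ => ⟪χ τ, Yn n τ⟫_ℂ) (Icc 0 T) := fun n =>
    continuousOn_iff_continuous_domRestrict.2 (hF.continuous n)
  have hF0c : ContinuousOn (fun τ => ⟪χ τ, Y τ⟫_ℂ) (Icc 0 T) :=
    continuousOn_iff_continuous_domRestrict.2
      (hu.continuous (Frequently.of_forall fun n => hF.continuous n))
  refine ⟨hF0c, fun t ht => ?_⟩
  have hI : ∀ {f : ℝ → ℂ}, ContinuousOn f (Icc 0 T) → IntervalIntegrable f volume 0 t :=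
    fun hf => ContinuousOn.intervalIntegrable (by
      rw [uIcc_of_le ht.1]; exact hf.mono (Icc_subset_Icc_right ht.2))
  rw [Metric.tendsto_nhds]
  intro ε hε
  have hε' : 0 < ε / (t + 1) := div_pos hε (by linarith [ht.1])
  filter_upwards [Metric.tendstoUniformly_iff.1 hu _ hε'] with n hn
  rw [dist_comm, dist_eq_norm, ← intervalIntegral.integral_sub (hI hF0c) (hI (hFc n))]
  refine lt_of_le_of_lt (intervalIntegral.norm_integral_le_of_norm_le_const
    (C := ε / (t + 1)) fun τ hτ => ?_) ?_
  · rw [uIoc_of_le ht.1] at hτ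
    have := hn ⟨τ, hτ.1.le, hτ.2.trans ht.2⟩
    rw [dist_eq_norm] at this
    exact this.le
  · rw [sub_zero, abs_of_nonneg ht.1, div_mul_eq_mul_div, div_lt_iff₀ (by linarith [ht.1])]
    nlinarith [ht.1]

/-- Pettis' theorem in a separable Hilbert space, tested on a dense set. -/
lemma aestronglyMeasurable_of_inner [CompleteSpace E] [SecondCountableTopology E] {α : Type*}
    [MeasurableSpace α] {μ : Measure α} {f : α → E} {S : Set E} (hS : Dense S)
    (h : ∀ φ ∈ S, AEMeasurable (fun a => ⟪φ, f a⟫_ℂ) μ) : AEStronglyMeasurable f μ := by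
  have h' : ∀ φ, AEMeasurable (fun a => ⟪φ, f a⟫_ℂ) μ := fun φ => by
    obtain ⟨u, hu, hlim⟩ := mem_closure_iff_seq_limit.1 (hS φ)
    exact aemeasurable_of_tendsto_metrizable_ae' (fun n => h (u n) (hu n))
      (ae_of_all _ fun a => hlim.inner tendsto_const_nhds)
  obtain ⟨w, b, hb⟩ := exists_hilbertBasis ℂ E
  -- Distinct orthonormal vectors are `√2` apart, so the balls of radius `1/2` around them are
  -- disjoint open sets in a separable space.
  have hw : Countable w := by
    refine Pairwise.countable_of_isOpen_disjoint (s := fun i : w => Metric.ball (b i) (1 / 2))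
      (fun i j hij => ?_) (fun i => Metric.isOpen_ball) fun i =>
        ⟨b i, Metric.mem_ball_self (by norm_num)⟩
    refine Metric.ball_disjoint_ball ?_
    have h1 : ‖b i - b j‖ ^ 2 = 2 := by
      rw [@norm_sub_sq ℂ, b.orthonormal.1, b.orthonormal.1, b.orthonormal.2 hij]; norm_num
    rw [dist_eq_norm]
    nlinarith [norm_nonneg (b i - b j)]
  refine aestronglyMeasurable_of_tendsto_ae (atTop : Filter (Finset w))
    (f := fun s a => ∑ i ∈ s, ⟪b i, f a⟫_ℂ • b i) (fun s => ?_) (ae_of_all _ fun a => ?_)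
  · refine Finset.aestronglyMeasurable_fun_sum _ fun i _ => ?_
    exact ((h' (b i)).aestronglyMeasurable).smul aestronglyMeasurable_const
  · have := b.hasSum_repr (f a)
    simp only [b.repr_apply_apply] at this
    exact this

end Hilbert

/-! ### Symbols and conjugated multiplication kernels -/

section Symbols

/-- The sharp frequency cutoff `|ξ| ≤ N`. -/
def cut (N : ℕ) (ξ : ℝ) : ℂ := if |ξ| ≤ N then 1 else 0

/-- The symbol `2πiξ` of `∂`. -/
def dsym (ξ : ℝ) : ℂ := 2 * Real.pi * Complex.I * ξ

/-- The symbol `|2πξ|^{3/2}`. -/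
def asym (ξ : ℝ) : ℂ := (Real.sqrt (|2 * Real.pi * ξ| ^ 3) : ℝ)

/-- The kernel of `⟨D⟩^a V ⟨D⟩^{-a}`, acting on `⟨·⟩^k V̂`. -/
def multKer (a k ξ η : ℝ) : ℂ := (jb ξ ^ a * jb η ^ (-a) * jb (ξ - η) ^ (-k) : ℝ)

/-- The kernel of `⟨D⟩^a (∂V) ⟨D⟩^{-a}`, acting on `⟨·⟩^k V̂`. -/
def derivKer (a k ξ η : ℝ) : ℂ := dsym (ξ - η) * multKer a k ξ η

lemma cut_mul_self (N : ℕ) (ξ : ℝ) : cut N ξ * cut N ξ = cut N ξ := by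
  unfold cut; split_ifs <;> simp

lemma conj_cut (N : ℕ) (ξ : ℝ) : conj (cut N ξ) = cut N ξ := by
  unfold cut; split_ifs <;> simp

lemma conj_dsym (ξ : ℝ) : conj (dsym ξ) = -dsym ξ := by
  simp only [dsym, map_mul, Complex.conj_I, Complex.conj_ofReal, map_ofNat]; ring

lemma conj_asym (ξ : ℝ) : conj (asym ξ) = asym ξ := Complex.conj_ofReal _

lemma conj_multKer (a k ξ η : ℝ) : conj (multKer a k ξ η) = multKer a k ξ η :=
  Complex.conj_ofReal _

lemma dsym_sub (ξ η : ℝ) : dsym (ξ - η) = dsym ξ - dsym η := by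
  simp only [dsym]; push_cast; ring

lemma norm_dsym (ξ : ℝ) : ‖dsym ξ‖ = 2 * Real.pi * |ξ| := by
  simp [dsym, abs_of_pos Real.pi_pos]

lemma norm_asym_sq (ξ : ℝ) : ‖asym ξ‖ ^ 2 = (2 * Real.pi * |ξ|) ^ 3 := by
  rw [asym, Complex.norm_real, Real.norm_eq_abs, sq_abs, Real.sq_sqrt (by positivity), abs_mul,
    abs_of_pos Real.two_pi_pos]

lemma asym_mul_self (ξ : ℝ) : asym ξ * asym ξ = ((2 * Real.pi * |ξ|) ^ 3 : ℝ) := by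
  rw [asym, ← Complex.ofReal_mul, Real.mul_self_sqrt (by positivity), abs_mul,
    abs_of_pos Real.two_pi_pos]

@[fun_prop]
lemma measurable_cut (N : ℕ) : Measurable (cut N) :=
  Measurable.ite (measurableSet_le (by fun_prop) (by fun_prop)) measurable_const measurable_const

@[fun_prop]
lemma measurable_dsym : Measurable dsym := by unfold dsym; fun_prop

@[fun_prop]
lemma measurable_asym : Measurable asym := by unfold asym; fun_prop

lemma norm_cut_le (N : ℕ) (ξ : ℝ) : ‖cut N ξ‖ ≤ 1 := by unfold cut; split_ifs <;> simp

lemma bddMul_cut (N : ℕ) : BddMul (cut N) 1 := ⟨by fun_prop, norm_cut_le N⟩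

lemma bddMul_cut_mul (N : ℕ) {m : ℝ → ℂ} (hm : Measurable m) {C : ℝ}
    (h : ∀ ξ : ℝ, |ξ| ≤ N → ‖m ξ‖ ≤ C) : BddMul (fun ξ => cut N ξ * m ξ) C where
  measurable := by fun_prop
  bound ξ := by
    have hC : 0 ≤ C := (norm_nonneg _).trans (h 0 (by simp))
    unfold cut; split_ifs with h1
    · simpa using h ξ h1
    · simpa using hC

lemma bddMul_cut_dsym (N : ℕ) : BddMul (fun ξ => cut N ξ * dsym ξ) (2 * Real.pi * N) :=
  bddMul_cut_mul N (by fun_prop) fun ξ hξ => by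
    rw [norm_dsym]; have := Real.pi_pos; gcongr

lemma bddMul_cut_asym (N : ℕ) :
    BddMul (fun ξ => cut N ξ * asym ξ) (Real.sqrt ((2 * Real.pi * N) ^ 3)) :=
  bddMul_cut_mul N (by fun_prop) fun ξ hξ => by
    apply Real.le_sqrt_of_sq_le
    rw [norm_asym_sq]; have := Real.pi_pos; gcongr

lemma norm_multKer (a k ξ η : ℝ) :
    ‖multKer a k ξ η‖ = jb ξ ^ a * jb η ^ (-a) * jb (ξ - η) ^ (-k) := by
  have := jb_pos ξ; have := jb_pos η; have := jb_pos (ξ - η)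
  rw [multKer, Complex.norm_real, Real.norm_eq_abs, abs_of_nonneg (by positivity)]

lemma measurable_multKer (a k : ℝ) : Measurable fun p : ℝ × ℝ => multKer a k p.1 p.2 := by
  unfold multKer; fun_prop

lemma admissible_multKer {a k : ℝ} (hk : 3 ≤ k) (ha : |a| ≤ k) :
    Admissible (multKer a k) (2 ^ k) where
  measurable := measurable_multKer a k
  nonneg := by positivity
  bound ξ η := by rw [norm_multKer]; exact multiplication_kernel_le hk ha ξ η

lemma admissible_derivKer {a k : ℝ} (hk : 3 ≤ k) (ha : |a| ≤ k - 1) :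
    Admissible (derivKer a k) (2 * Real.pi * 2 ^ k) where
  measurable := by
    have := measurable_multKer a k
    unfold derivKer; fun_prop
  nonneg := by positivity
  bound ξ η := by
    rw [derivKer, norm_mul, norm_multKer, norm_dsym, mul_assoc, mul_assoc (2 * Real.pi)]
    exact mul_le_mul_of_nonneg_left (derivative_kernel_le hk ha ξ η) Real.two_pi_pos.le

end Symbols

/-! ### Frequency-localised operators and commutators -/

section Operators

/-- The frequency projection `P_N`. -/
def Pop (N : ℕ) : L2 →L[ℂ] L2 := mulOp (cut N)

/-- `P_N ∂`. -/
def Dop (N : ℕ) : L2 →L[ℂ] L2 := mulOp fun ξ => cut N ξ * dsym ξ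

/-- `P_N |D|^{3/2}`. -/
def Aop (N : ℕ) : L2 →L[ℂ] L2 := mulOp fun ξ => cut N ξ * asym ξ

lemma integrable_mul_conj_L2 (f g : L2) : Integrable fun x => conj (f x) * g x := by
  have := L2.integrable_inner (𝕜 := ℂ) f g
  refine this.congr (ae_of_all _ fun x => ?_)
  simp only [RCLike.inner_apply, mul_comm]

lemma norm_sq_eq_integral_L2 (f : L2) :
    Integrable (fun x => ‖f x‖ ^ 2) ∧ ‖f‖ ^ 2 = ∫ x, ‖f x‖ ^ 2 := by
  have h1 := integrable_mul_conj_L2 f f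
  have e : ∀ x, conj (f x) * f x = ((‖f x‖ ^ 2 : ℝ) : ℂ) := fun x => by
    rw [mul_comm, Complex.mul_conj, Complex.normSq_eq_norm_sq]
  simp only [e] at h1
  refine ⟨h1.re.congr (ae_of_all _ fun x => Complex.ofReal_re _), ?_⟩
  have h2 := norm_sq_eq_re_inner' f
  rw [inner_eq_integral] at h2
  simp only [e] at h2
  rw [integral_complex_ofReal] at h2
  exact h2

lemma norm_sq_mulOp_le {m n p : ℝ → ℂ} {Cm Cn Cp a b : ℝ} (hm : BddMul m Cm) (hn : BddMul n Cn)
    (hp : BddMul p Cp) (h : ∀ x, ‖m x‖ ^ 2 ≤ a * ‖n x‖ ^ 2 + b * ‖p x‖ ^ 2) (f : L2) :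
    ‖mulOp m f‖ ^ 2 ≤ a * ‖mulOp n f‖ ^ 2 + b * ‖mulOp p f‖ ^ 2 := by
  obtain ⟨i1, e1⟩ := norm_sq_eq_integral_L2 (mulOp m f)
  obtain ⟨i2, e2⟩ := norm_sq_eq_integral_L2 (mulOp n f)
  obtain ⟨i3, e3⟩ := norm_sq_eq_integral_L2 (mulOp p f)
  rw [e1, e2, e3, ← integral_const_mul, ← integral_const_mul,
    ← integral_add (i2.const_mul a) (i3.const_mul b)]
  refine integral_mono_ae i1 ((i2.const_mul a).add (i3.const_mul b)) ?_
  filter_upwards [mulOp_ae_eq hm f, mulOp_ae_eq hn f, mulOp_ae_eq hp f] with x h1 h2 h3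
  simp only [h1, h2, h3, norm_mul, mul_pow]
  nlinarith [mul_le_mul_of_nonneg_right (h x) (sq_nonneg ‖f x‖)]

lemma mulOp_comm {m n : ℝ → ℂ} {Cm Cn : ℝ} (hm : BddMul m Cm) (hn : BddMul n Cn) (f : L2) :
    mulOp m (mulOp n f) = mulOp n (mulOp m f) := by
  rw [mulOp_mulOp hm hn, mulOp_mulOp hn hm]; simp only [mul_comm]

lemma tendsto_Pop (f : L2) : Tendsto (fun N => Pop N f) atTop (𝓝 f) := by
  have key : Tendsto (fun N => ∫ x, ‖(Pop N f - f : L2) x‖ ^ 2) atTop (𝓝 (∫ _ : ℝ, (0 : ℝ))) := by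
    refine tendsto_integral_of_dominated_convergence (fun x => ‖f x‖ ^ 2)
      (fun N => (norm_sq_eq_integral_L2 _).1.aestronglyMeasurable) (norm_sq_eq_integral_L2 f).1
      (fun N => ?_) ?_
    · filter_upwards [mulOp_ae_eq (bddMul_cut N) f, Lp.coeFn_sub (Pop N f) f] with x h1 h2
      rw [h2, Pi.sub_apply, Pop, h1]
      unfold cut; split_ifs <;> simp
    · have h : ∀ᵐ x, ∀ N, (Pop N f - f : L2) x = cut N x * f x - f x := by
        rw [ae_all_iff]; intro N
        filter_upwards [mulOp_ae_eq (bddMul_cut N) f, Lp.coeFn_sub (Pop N f) f] with x h1 h2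
        rw [h2, Pi.sub_apply, Pop, h1]
      filter_upwards [h] with x hx
      refine tendsto_const_nhds.congr' ?_
      filter_upwards [eventually_ge_atTop ⌈|x|⌉₊] with N hN
      rw [hx, cut, if_pos (Nat.ceil_le.1 hN)]; simp
  rw [tendsto_iff_norm_sub_tendsto_zero]
  simp only [integral_zero] at key
  have h2 : Tendsto (fun N => Real.sqrt (∫ x, ‖(Pop N f - f : L2) x‖ ^ 2)) atTop (𝓝 0) := by
    simpa using key.sqrt
  refine h2.congr fun N => ?_
  rw [← (norm_sq_eq_integral_L2 _).2, Real.sqrt_sq (norm_nonneg _)]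

lemma inner_Pop (N : ℕ) (f g : L2) : ⟪Pop N f, g⟫_ℂ = ⟪f, Pop N g⟫_ℂ := by
  rw [Pop, inner_mulOp_left (bddMul_cut N)]; simp only [conj_cut]

lemma norm_Pop_le (N : ℕ) (f : L2) : ‖Pop N f‖ ≤ ‖f‖ := by
  have := norm_mulOp_le (bddMul_cut N) f
  rwa [one_mul] at this

lemma Pop_Pop (N : ℕ) (f : L2) : Pop N (Pop N f) = Pop N f := by
  rw [Pop, mulOp_mulOp (bddMul_cut N) (bddMul_cut N)]; simp only [cut_mul_self]

lemma cut_mul_cut {N M : ℕ} (h : N ≤ M) (ξ : ℝ) : cut M ξ * cut N ξ = cut N ξ := by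
  unfold cut
  split_ifs with h1 h2 <;> simp
  exact h1 (le_trans ‹_› (by exact_mod_cast h))

lemma Pop_of_le {N M : ℕ} (h : N ≤ M) {f : L2} (hf : Pop N f = f) : Pop M f = f := by
  rw [← hf, Pop, Pop, mulOp_mulOp (bddMul_cut M) (bddMul_cut N)]
  simp only [cut_mul_cut h]

lemma Dop_of_le {N M : ℕ} (h : N ≤ M) {f : L2} (hf : Pop N f = f) : Dop M f = Dop N f := by
  rw [← hf, Pop, Dop, Dop, mulOp_mulOp (bddMul_cut_dsym M) (bddMul_cut N),
    mulOp_mulOp (bddMul_cut_dsym N) (bddMul_cut N)]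
  congr 2; ext ξ
  rw [mul_right_comm, cut_mul_cut h, mul_right_comm, cut_mul_self]

variable {a k : ℝ}

/-- The commutator estimate for `⟨D⟩^a V ∂ ⟨D⟩^{-a}`. -/
lemma exists_commutator_bound (hk : 3 ≤ k) (ha : |a| ≤ k - 1) :
    ∃ C : ℝ, 0 ≤ C ∧ ∀ (N : ℕ) (v f g : L2), RealSymbol v → Pop N f = f → Pop N g = g →
      ‖⟪f, kop (multKer a k) v (Dop N g)⟫_ℂ + ⟪kop (multKer a k) v (Dop N f), g⟫_ℂ‖ ≤
        C * ‖v‖ * ‖f‖ * ‖g‖ := by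
  obtain ⟨C, hC0, hC⟩ := commutator_kernel_le hk ha
  refine ⟨2 * Real.pi * C * (3 * kerConst.toReal), by positivity, fun N v f g hv hf hg => ?_⟩
  have hm := admissible_multKer hk (ha.trans (by linarith) : |a| ≤ k)
  have h1 := hm.mul_right (bddMul_cut_dsym N)
  have h3 := h1.add h1.adjoint
  -- As `f` and `g` are band-limited, cutoffs can be inserted on both sides of the kernel for free.
  -- The second inner product is moved onto `g` through the adjoint kernel; this is where `V` real
  -- is used.
  have e : ⟪f, kop (multKer a k) v (Dop N g)⟫_ℂ + ⟪kop (multKer a k) v (Dop N f), g⟫_ℂ =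
      ⟪f, kop (fun ξ η => cut N ξ * ((multKer a k ξ η * (cut N η * dsym η) +
        conj (multKer a k η ξ * (cut N ξ * dsym ξ))) * cut N η)) v g⟫_ℂ := by
    rw [← mulOp_kop (h3.mul_right (bddMul_cut N)) (bddMul_cut N), ← kop_mulOp h3 (bddMul_cut N),
      kop_add h1 h1.adjoint]
    have e1 : mulOp (cut N) g = g := hg
    rw [e1, ← Pop, ← inner_Pop, hf, inner_add_right, ← hv _ _ h1, Dop,
      kop_mulOp hm (bddMul_cut_dsym N), kop_mulOp hm (bddMul_cut_dsym N)]
  have hadm : Admissible (fun ξ η => cut N ξ * ((multKer a k ξ η * (cut N η * dsym η) +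
        conj (multKer a k η ξ * (cut N ξ * dsym ξ))) * cut N η)) (2 * Real.pi * C) := by
    refine ⟨((h3.mul_right (bddMul_cut N)).mul_left (bddMul_cut N)).measurable, by positivity,
      fun ξ η => ?_⟩
    -- The outer cutoffs absorb the inner ones, and the conjugate of the symbol of `∂` supplies the
    -- minus sign; what is left is the kernel of `commutator_kernel_le`.
    have e2 : cut N ξ * ((multKer a k ξ η * (cut N η * dsym η) +
        conj (multKer a k η ξ * (cut N ξ * dsym ξ))) * cut N η) =
        (cut N ξ * cut N η) * ((2 * Real.pi * Complex.I) *
          (((η * (jb ξ ^ a * jb η ^ (-a)) - ξ * (jb ξ ^ (-a) * jb η ^ a)) *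
            jb (ξ - η) ^ (-k) : ℝ) : ℂ)) := by
      simp only [map_mul, conj_multKer, conj_cut, conj_dsym]
      have hx := cut_mul_self N ξ
      have hy := cut_mul_self N η
      have : cut N ξ * ((multKer a k ξ η * (cut N η * dsym η) +
        multKer a k η ξ * (cut N ξ * -dsym ξ)) * cut N η) =
        cut N ξ * (cut N η * cut N η) * multKer a k ξ η * dsym η -
        (cut N ξ * cut N ξ) * cut N η * multKer a k η ξ * dsym ξ := by ring
      rw [this, hx, hy]
      simp only [multKer, dsym]
      rw [jb_sub_comm η ξ]
      push_cast
      ring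
    rw [e2, norm_mul, norm_mul, norm_mul, Complex.norm_real, Real.norm_eq_abs, abs_mul,
      abs_of_nonneg (Real.rpow_nonneg (jb_pos (ξ - η)).le _)]
    have e3 : ‖(2 * Real.pi * Complex.I : ℂ)‖ = 2 * Real.pi := by
      simp [abs_of_pos Real.pi_pos]
    rw [e3]
    have hb := hC ξ η
    have hn : 0 ≤ |η * (jb ξ ^ a * jb η ^ (-a)) - ξ * (jb ξ ^ (-a) * jb η ^ a)| *
        jb (ξ - η) ^ (-k) := mul_nonneg (abs_nonneg _) (Real.rpow_nonneg (jb_pos (ξ - η)).le _)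
    calc _ ≤ 1 * 1 * (2 * Real.pi * (C * kerBound ξ η)) := by
          gcongr
          · exact norm_cut_le _ _
          · exact norm_cut_le _ _
      _ = _ := by ring
  rw [e]
  exact norm_inner_kop_le hadm f v g

/-- `∂ V = V ∂ + (∂V)` at low frequencies. -/
lemma Dop_kop (hk : 3 ≤ k) (ha : |a| ≤ k - 1) {N M : ℕ} {h : L2} (hh : Pop N h = h) (v : L2) :
    Dop M (kop (multKer a k) v h) =
      Pop M (kop (multKer a k) v (Dop N h) + kop (derivKer a k) v h) := by
  have hm := admissible_multKer hk (ha.trans (by linarith) : |a| ≤ k)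
  have hd := admissible_derivKer hk ha
  have e1 : kop (multKer a k) v h = kop (multKer a k) v (mulOp (cut N) h) := by
    rw [← Pop, hh]
  have e2 : kop (derivKer a k) v h = kop (derivKer a k) v (mulOp (cut N) h) := by
    rw [← Pop, hh]
  rw [e1, e2, Dop, Dop, Pop, kop_mulOp hm (bddMul_cut N), kop_mulOp hm (bddMul_cut_dsym N),
    kop_mulOp hd (bddMul_cut N), ← kop_add (hm.mul_right (bddMul_cut_dsym N))
      (hd.mul_right (bddMul_cut N)), mulOp_kop (hm.mul_right (bddMul_cut N)) (bddMul_cut_dsym M),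
    mulOp_kop ((hm.mul_right (bddMul_cut_dsym N)).add (hd.mul_right (bddMul_cut N)))
      (bddMul_cut M)]
  refine congrArg (fun κ => kop κ v h) ?_
  funext ξ η
  simp only [derivKer, dsym_sub]
  ring

/-- The single commutator bound is applied to the pair `f`, `V_a g`. Then `∂ V_a g = V_a ∂g + (∂V)_a
g` gives the required form up to the bounded term `V_a (∂V)_a g`. -/
lemma exists_double_commutator_bound (hk : 3 ≤ k) (ha : |a| ≤ k - 1) :
    ∃ C : ℝ, 0 ≤ C ∧ ∀ (N : ℕ) (v f g : L2), RealSymbol v → Pop N f = f → Pop N g = g →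
      ‖⟪f, kop (multKer a k) v (kop (multKer a k) v (Dop N g))⟫_ℂ +
        ⟪kop (multKer a k) v (Dop N f), kop (multKer a k) v g⟫_ℂ‖ ≤
        C * ‖v‖ ^ 2 * ‖f‖ * ‖g‖ := by
  obtain ⟨C, hC0, hC⟩ := exists_commutator_bound hk ha
  have hm := admissible_multKer hk (ha.trans (by linarith) : |a| ≤ k)
  have hd := admissible_derivKer hk ha
  set B := 2 ^ k * (3 * kerConst.toReal) with hB
  set B' := 2 * Real.pi * 2 ^ k * (3 * kerConst.toReal) with hB'
  have hB0 : 0 ≤ B := by positivity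
  have hB'0 : 0 ≤ B' := by positivity
  refine ⟨C * B + B * B', by positivity, fun N v f g hv hf hg => ?_⟩
  set T := kop (multKer a k) v with hT
  have hTn : ∀ w, ‖T w‖ ≤ B * ‖v‖ * ‖w‖ := norm_kop_le hm v
  set S := kop (derivKer a k) v with hS
  have hSn : ∀ w, ‖S w‖ ≤ B' * ‖v‖ * ‖w‖ := norm_kop_le hd v
  -- The function `V_a g` is not band-limited, so it is cut off at a second frequency `M`, which is
  -- sent to infinity. The bound is uniform in `M`, and `∂f` does not see `M ≥ N`.
  have hM : ∀ M, N ≤ M → ‖⟪f, T (Pop M (T (Dop N g) + S g))⟫_ℂ + ⟪T (Dop N f), Pop M (T g)⟫_ℂ‖ ≤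
      C * ‖v‖ * ‖f‖ * ‖T g‖ := fun M hNM => by
    have h1 := hC M v f (Pop M (T g)) hv (Pop_of_le hNM hf) (Pop_Pop M _)
    rw [Dop_of_le hNM hf] at h1
    have h2 : Dop M (Pop M (T g)) = Pop M (T (Dop N g) + S g) := by
      rw [← Dop_kop hk ha hg, Dop, Pop, mulOp_mulOp (bddMul_cut_dsym M) (bddMul_cut M)]
      congr 2; ext ξ
      rw [mul_right_comm, cut_mul_self]
    rw [h2] at h1
    refine h1.trans ?_
    gcongr
    exact norm_Pop_le _ _
  have hlim : Tendsto (fun M => ‖⟪f, T (Pop M (T (Dop N g) + S g))⟫_ℂ +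
      ⟪T (Dop N f), Pop M (T g)⟫_ℂ‖) atTop
      (𝓝 ‖⟪f, T (T (Dop N g) + S g)⟫_ℂ + ⟪T (Dop N f), T g⟫_ℂ‖) := by
    refine (Tendsto.add ?_ ?_).norm
    · exact tendsto_const_nhds.inner ((T.continuous.tendsto _).comp (tendsto_Pop _))
    · exact tendsto_const_nhds.inner (tendsto_Pop _)
  have hfin := le_of_tendsto hlim (eventually_atTop.2 ⟨N, hM⟩)
  rw [map_add, inner_add_right] at hfin
  have h3 : ‖⟪f, T (S g)⟫_ℂ‖ ≤ ‖f‖ * (B * ‖v‖ * (B' * ‖v‖ * ‖g‖)) := by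
    refine (norm_inner_le_norm _ _).trans ?_
    gcongr
    refine (hTn _).trans ?_
    gcongr
    exact hSn g
  have e : ⟪f, T (T (Dop N g))⟫_ℂ + ⟪T (Dop N f), T g⟫_ℂ =
      (⟪f, T (T (Dop N g))⟫_ℂ + ⟪f, T (S g)⟫_ℂ + ⟪T (Dop N f), T g⟫_ℂ) - ⟪f, T (S g)⟫_ℂ := by ring
  rw [e]
  refine (norm_sub_le _ _).trans ?_
  calc _ ≤ C * ‖v‖ * ‖f‖ * (B * ‖v‖ * ‖g‖) + ‖f‖ * (B * ‖v‖ * (B' * ‖v‖ * ‖g‖)) := by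
        refine add_le_add (hfin.trans ?_) h3
        gcongr
        exact hTn g
    _ = _ := by ring

/-- Pointwise, with `z = 2π|ξ|`: either `δz ≥ 1` and `z² ≤ δz³`, or `z² ≤ δ⁻²`. -/
lemma interpolation (N : ℕ) {δ : ℝ} (hδ : 0 < δ) (f : L2) :
    ‖Dop N f‖ ^ 2 ≤ δ * ‖Aop N f‖ ^ 2 + δ⁻¹ ^ 2 * ‖f‖ ^ 2 := by
  have h := norm_sq_mulOp_le (bddMul_cut_dsym N) (bddMul_cut_asym N) (BddMul.const 1)
    (a := δ) (b := δ⁻¹ ^ 2) (fun ξ => ?_) f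
  · rwa [mulOp_const, one_smul] at h
  · simp only [norm_mul, mul_pow, norm_asym_sq, norm_dsym, norm_one]
    have h1 : ‖cut N ξ‖ ^ 2 ≤ 1 := pow_le_one₀ (norm_nonneg _) (norm_cut_le _ _)
    set z := 2 * Real.pi * |ξ| with hz
    have hz0 : 0 ≤ z := by positivity
    have e : (2 : ℝ) ^ 2 * Real.pi ^ 2 * |ξ| ^ 2 = z ^ 2 := by rw [hz]; ring
    have e' : (2 : ℝ) ^ 3 * Real.pi ^ 3 * |ξ| ^ 3 = z ^ 3 := by rw [hz]; ring
    have key : z ^ 2 ≤ δ * z ^ 3 + δ⁻¹ ^ 2 := by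
      rcases le_or_gt δ⁻¹ z with h2 | h2
      · have h3 : 1 ≤ δ * z := by
          have := mul_le_mul_of_nonneg_left h2 hδ.le
          rwa [mul_inv_cancel₀ hδ.ne'] at this
        have h4 : 0 ≤ δ⁻¹ ^ 2 := by positivity
        nlinarith [sq_nonneg z]
      · have : z ^ 2 ≤ δ⁻¹ ^ 2 := by gcongr
        have : 0 ≤ δ * z ^ 3 := by positivity
        linarith
    have h5 : 0 ≤ δ⁻¹ ^ 2 := by positivity
    have h6 : 0 ≤ ‖cut N ξ‖ ^ 2 := by positivity
    rw [e, e']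
    nlinarith [mul_le_mul_of_nonneg_left key h6]

end Operators

/-- A `C¹` coefficient in `H^k`, in terms of `⟨·⟩^k V̂`. -/
structure Coeff (T b b' : ℝ) (v v' : ℝ → L2) : Prop where
  deriv : ∀ t, HasDerivAt v (v' t) t
  continuous_deriv : Continuous v'
  real : ∀ t ∈ Icc 0 T, RealSymbol (v t)
  bound : ∀ t ∈ Icc 0 T, ‖v t‖ ≤ b
  bound_deriv : ∀ t ∈ Icc 0 T, ‖v' t‖ ≤ b'

lemma Coeff.continuous {T b b' : ℝ} {v v' : ℝ → L2} (h : Coeff T b b' v v') : Continuous v :=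
  continuous_iff_continuousAt.2 fun t => (h.deriv t).continuousAt

lemma exists_energyOps {a k : ℝ} (hk : 3 ≤ k) (ha : |a| ≤ k - 1) :
    ∃ c : ℝ, 0 ≤ c ∧ ∀ (T b b' : ℝ) (v v' : ℝ → L2), 0 ≤ b → 0 ≤ b' → Coeff T b b' v v' → ∀ N,
      EnergyOps T (c * b) (c * b') (Aop N) (Dop N) (Pop N) (fun t => kop (multKer a k) (v t))
        (fun t => kop (multKer a k) (v' t)) := by
  obtain ⟨C₁, hC₁, h₁⟩ := exists_commutator_bound hk ha
  obtain ⟨C₂, hC₂, h₂⟩ := exists_double_commutator_bound hk ha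
  have hm := admissible_multKer hk (ha.trans (by linarith) : |a| ≤ k)
  set B := 2 ^ k * (3 * kerConst.toReal) with hB
  have hB0 : 0 ≤ B := by positivity
  -- One constant serves all the bounds; the summand `1` makes its square dominate `C₂`, as the
  -- double commutator bound is quadratic in `V`.
  refine ⟨1 + C₁ + C₂ + B, by positivity, fun T b b' v v' hb hb' hv N => ?_⟩
  have hvc := hv.continuous
  have hvc' := hv.continuous_deriv
  exact
  { M_nonneg := by positivity
    M'_nonneg := by positivity
    symm_A := fun f g => by
      rw [Aop, inner_mulOp_left (bddMul_cut_asym N)]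
      simp only [map_mul, conj_cut, conj_asym]
    symm_P := inner_Pop N
    absorb_A := fun f => by
      rw [Pop, Aop, mulOp_mulOp (bddMul_cut N) (bddMul_cut_asym N)]
      simp only [← mul_assoc, cut_mul_self]
    absorb_D := fun f => by
      rw [Pop, Dop, mulOp_mulOp (bddMul_cut N) (bddMul_cut_dsym N)]
      simp only [← mul_assoc, cut_mul_self]
    idem_P := Pop_Pop N
    continuous_V := by fun_prop
    continuous_V' := by fun_prop
    deriv_V := fun t z z' hz => by
      have h := ((kop (multKer a k)).bilinearRestrictScalars ℝ).hasFDerivAt_of_bilinear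
        (hv.deriv t).hasFDerivAt hz.hasFDerivAt
      refine h.hasDerivAt.congr_deriv ?_
      simp [add_comm]
    bound_V := fun t ht f => by
      refine (norm_kop_le hm (v t) f).trans ?_
      have := hv.bound t ht
      gcongr
      linarith
    bound_V' := fun t ht f => by
      refine (norm_kop_le hm (v' t) f).trans ?_
      have := hv.bound_deriv t ht
      gcongr
      linarith
    comm_one := fun t ht f hf => by
      have h := h₁ N (v t) f f (hv.real t ht) hf hf
      set T := kop (multKer a k) (v t)
      -- The real part of a quadratic form only sees the symmetrised operator, to which the
      -- commutator bound applies.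
      have e : (⟪f, T (Dop N f)⟫_ℂ).re = (⟪f, T (Dop N f)⟫_ℂ + ⟪T (Dop N f), f⟫_ℂ).re / 2 := by
        rw [Complex.add_re, re_inner_comm (T (Dop N f))]; ring
      rw [e, abs_div, abs_two]
      have h3 := (Complex.abs_re_le_norm _).trans h
      have h4 : C₁ * ‖v t‖ * ‖f‖ * ‖f‖ ≤ (1 + C₁ + C₂ + B) * b * ‖f‖ ^ 2 := by
        rw [mul_assoc _ ‖f‖, ← sq]
        have := hv.bound t ht
        gcongr
        linarith
      have h5 : 0 ≤ (1 + C₁ + C₂ + B) * b * ‖f‖ ^ 2 := by positivity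
      linarith
    comm_two := fun t ht f g hf hg => by
      refine (Complex.abs_re_le_norm _).trans ((h₂ N (v t) f g (hv.real t ht) hf hg).trans ?_)
      have := hv.bound t ht
      rw [mul_pow]
      gcongr
      nlinarith
    interp := fun δ hδ f => interpolation N hδ f }

/-! ### Galerkin equations and passage to the limit in time integrals -/

section Galerkin

variable {E : Type*} [NormedAddCommGroup E] [InnerProductSpace ℂ E] [CompleteSpace E]

/-- Solvability of the frequency-localised equation. -/
lemma exists_galerkin [NormedSpace ℝ E] [LinearMap.CompatibleSMul E E ℝ ℂ] {T M M' : ℝ} {A D P : E →L[ℂ] E} {V V' : ℝ → E →L[ℂ] E}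
    (H : EnergyOps T M M' A D P V V') (hT : 0 ≤ T) {x₀ y₀ : E} {r : ℝ → E} (hr : Integrable r)
    (hPx : P x₀ = x₀) (hPy : P y₀ = y₀) (hPr : ∀ τ, P (r τ) = r τ) :
    ∃ x y : ℝ → E, Continuous y ∧ (∀ t, HasDerivAt x (y t) t) ∧ x 0 = x₀ ∧ y 0 = y₀ ∧
      (∀ t ∈ Icc 0 T, P (x t) = x t) ∧ (∀ t ∈ Icc 0 T, P (y t) = y t) ∧
      ∀ t ∈ Icc 0 T, y t = y 0 + ∫ τ in (0 : ℝ)..t,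
        (-(A (A (x τ))) - (2 : ℂ) • P (V τ (D (y τ))) - P (V τ (V τ (D (D (x τ))))) + r τ) := by
  have hVc := H.continuous_V
  let L : ℝ → E × E → E := fun t p =>
    -(A (A p.1)) - (2 : ℂ) • P (V t (D p.2)) - P (V t (V t (D (D p.1))))
  have hLc : Continuous fun q : ℝ × (E × E) => L q.1 q.2 := by simp only [L]; fun_prop
  set c := ‖A‖ * ‖A‖ + 2 * (‖P‖ * (M * ‖D‖)) + ‖P‖ * (M * (M * (‖D‖ * ‖D‖))) with hc
  have hM := H.M_nonneg
  have hc0 : 0 ≤ c := by positivity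
  have hLb : ∀ t ∈ Icc 0 T, ∀ p, ‖L t p‖ ≤ c * ‖p‖ := fun t ht p => by
    have h1 : ‖A (A p.1)‖ ≤ ‖A‖ * (‖A‖ * ‖p‖) :=
      (A.le_opNorm _).trans (by gcongr; exact (A.le_opNorm _).trans (by gcongr; exact norm_fst_le p))
    have h2 : ‖P (V t (D p.2))‖ ≤ ‖P‖ * (M * (‖D‖ * ‖p‖)) :=
      (P.le_opNorm _).trans (by
        gcongr
        refine (H.bound_V t ht _).trans ?_
        gcongr
        exact (D.le_opNorm _).trans (by gcongr; exact norm_snd_le p))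
    have h3 : ‖P (V t (V t (D (D p.1))))‖ ≤ ‖P‖ * (M * (M * (‖D‖ * (‖D‖ * ‖p‖)))) :=
      (P.le_opNorm _).trans (by
        gcongr
        refine (H.bound_V t ht _).trans ?_
        gcongr
        refine (H.bound_V t ht _).trans ?_
        gcongr
        refine (D.le_opNorm _).trans ?_
        gcongr
        exact (D.le_opNorm _).trans (by gcongr; exact norm_fst_le p))
    refine (norm_sub_le _ _).trans ?_
    refine (add_le_add (norm_sub_le _ _) le_rfl).trans ?_
    rw [norm_neg, norm_smul]
    have : ‖(2 : ℂ)‖ = 2 := by simp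
    rw [this]
    calc _ ≤ ‖A‖ * (‖A‖ * ‖p‖) + 2 * (‖P‖ * (M * (‖D‖ * ‖p‖))) +
          ‖P‖ * (M * (M * (‖D‖ * (‖D‖ * ‖p‖)))) := by gcongr
      _ = _ := by rw [hc]; ring
  have hprim : Continuous fun t : ℝ => ∫ τ in (0 : ℝ)..t, r τ :=
    intervalIntegral.continuous_primitive (fun a b => hr.intervalIntegrable) 0
  -- The force is only integrable in time, so it enters through its continuous primitive, as the
  -- inhomogeneous term of the first order system for the pair (position, velocity).
  obtain ⟨z, hzc, hz⟩ := exists_volterra (X := E × E) hT (by positivity : 0 ≤ c + 1)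
    (A := fun t p => (p.2, L t p)) (F := fun t => (x₀, y₀ + ∫ τ in (0 : ℝ)..t, r τ))
    (by fun_prop) (fun t ht p q => by
      have e : L t p - L t q = L t (p - q) := by
        simp only [L, Prod.fst_sub, Prod.snd_sub, map_sub, smul_sub]; abel
      rw [Prod.mk_sub_mk, e, Prod.norm_def]
      refine max_le ?_ ?_
      · calc _ ≤ 1 * ‖p - q‖ := by rw [one_mul]; exact norm_snd_le (p - q)
          _ ≤ _ := by gcongr; linarith
      · refine (hLb t ht _).trans ?_
        gcongr; linarith) (by fun_prop)
  have hLz : Continuous fun τ => L τ (z τ) := hLc.comp (continuous_id.prodMk hzc)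
  have hpi : ∀ t, IntervalIntegrable (fun τ => ((z τ).2, L τ (z τ))) volume 0 t := fun t =>
    Continuous.intervalIntegrable (by fun_prop) _ _
  have hz1 : ∀ t ∈ Icc 0 T, (z t).1 = x₀ + ∫ τ in (0 : ℝ)..t, (z τ).2 := fun t ht => by
    have := congrArg Prod.fst (hz t ht)
    rw [Prod.fst_add] at this
    rw [this]
    congr 1
    exact ((ContinuousLinearMap.fst ℝ E E).intervalIntegral_comp_comm (hpi t)).symm
  have hz2 : ∀ t ∈ Icc 0 T, (z t).2 = y₀ + (∫ τ in (0 : ℝ)..t, r τ) +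
      ∫ τ in (0 : ℝ)..t, L τ (z τ) := fun t ht => by
    have := congrArg Prod.snd (hz t ht)
    rw [Prod.snd_add] at this
    rw [this]
    congr 1
    exact ((ContinuousLinearMap.snd ℝ E E).intervalIntegral_comp_comm (hpi t)).symm
  have hyc : Continuous fun t => (z t).2 := by fun_prop
  have hT0 : (0 : ℝ) ∈ Icc 0 T := ⟨le_rfl, hT⟩
  have hPL : ∀ τ, P (L τ (z τ)) = L τ (z τ) := fun τ => by
    simp only [L, map_sub, map_neg, map_smul, H.absorb_A, H.idem_P]
  have hcomm : ∀ {f : ℝ → E} {t : ℝ}, IntervalIntegrable f volume 0 t → (∀ τ, P (f τ) = f τ) →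
      P (∫ τ in (0 : ℝ)..t, f τ) = ∫ τ in (0 : ℝ)..t, f τ := fun hf hPf => by
    have := (P.restrictScalars ℝ).intervalIntegral_comp_comm hf
    simp only [ContinuousLinearMap.coe_restrictScalars', hPf] at this
    exact this.symm
  have hPy' : ∀ t ∈ Icc 0 T, P (z t).2 = (z t).2 := fun t ht => by
    rw [hz2 t ht, map_add, map_add, hPy, hcomm hr.intervalIntegrable hPr,
      hcomm (hLz.intervalIntegrable _ _) hPL]
  -- The position is redefined as the primitive of the velocity, so that it is differentiable on the
  -- whole line; it agrees with the first component on `[0,T]`.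
  refine ⟨fun t => x₀ + ∫ τ in (0 : ℝ)..t, (z τ).2, fun t => (z t).2, hyc, fun t => ?_, by simp,
    by simpa using hz2 0 hT0, fun t ht => ?_, hPy', fun t ht => ?_⟩
  · exact (hyc.integral_hasStrictDerivAt 0 t).hasDerivAt.const_add x₀
  · rw [map_add, hPx]
    congr 1
    have := (P.restrictScalars ℝ).intervalIntegral_comp_comm (hyc.intervalIntegrable (μ := volume) 0 t)
    simp only [ContinuousLinearMap.coe_restrictScalars'] at this
    rw [← this]
    refine intervalIntegral.integral_congr fun τ hτ => ?_
    rw [uIcc_of_le ht.1] at hτ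
    exact hPy' τ ⟨hτ.1, hτ.2.trans ht.2⟩
  · have e0 : (z 0).2 = y₀ := by simpa using hz2 0 hT0
    dsimp only
    rw [e0, hz2 t ht, add_assoc]
    congr 1
    rw [add_comm, ← intervalIntegral.integral_add (hLz.intervalIntegrable _ _)
      hr.intervalIntegrable]
    refine intervalIntegral.integral_congr fun τ hτ => ?_
    rw [uIcc_of_le ht.1] at hτ
    simp only [L]
    rw [hz1 τ ⟨hτ.1, hτ.2.trans ht.2⟩]

/-- Passage to the limit in time integrals with moving test vectors. -/
lemma tendsto_integral_inner_clm {T B : ℝ} {U : Ultrafilter ℕ} {Yn : ℕ → ℝ → E} {Y : ℝ → E}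
    (hYc : ∀ n, Continuous (Yn n)) (hB : ∀ n, ∀ t ∈ Icc 0 T, ‖Yn n t‖ ≤ B)
    (hlim : ∀ t ∈ Icc 0 T, ∀ φ, Tendsto (fun n => ⟪φ, Yn n t⟫_ℂ) U (𝓝 ⟪φ, Y t⟫_ℂ))
    {S : Set E} (hS : Dense S) (heq : ∀ φ ∈ S, ∃ w : ℝ → ℝ, Continuous w ∧
      ∀ n, ∀ t ∈ Icc 0 T, ∀ t' ∈ Icc 0 T, ‖⟪φ, Yn n t - Yn n t'⟫_ℂ‖ ≤ |w t - w t'|)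
    {L : ℝ → E →L[ℂ] E} (hL : Continuous L) {ψ : ℕ → E} {φ : E} (hψ : Tendsto ψ U (𝓝 φ)) :
    ContinuousOn (fun τ => ⟪φ, L τ (Y τ)⟫_ℂ) (Icc 0 T) ∧ ∀ t ∈ Icc 0 T,
      Tendsto (fun n => ∫ τ in (0 : ℝ)..t, ⟪ψ n, L τ (Yn n τ)⟫_ℂ) U
        (𝓝 (∫ τ in (0 : ℝ)..t, ⟪φ, L τ (Y τ)⟫_ℂ)) := by
  -- The adjoint moves the time-dependent operator onto the test vector, where a continuous
  -- dependence on time is allowed.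
  have hadj : Continuous fun τ => ContinuousLinearMap.adjoint (L τ) :=
    (ContinuousLinearMap.adjoint (𝕜 := ℂ) (E := E) (F := E)).continuous.comp hL
  have hχ : Continuous fun τ => ContinuousLinearMap.adjoint (L τ) φ := by fun_prop
  obtain ⟨h1, h2⟩ := tendsto_integral_inner U hB hlim hS heq hχ
  simp only [ContinuousLinearMap.adjoint_inner_left] at h1 h2
  refine ⟨h1, fun t ht => ?_⟩
  obtain ⟨CL, hCL⟩ := (isCompact_Icc (a := (0 : ℝ)) (b := t)).exists_bound_of_continuousOn
    hL.continuousOn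
  have hc : ∀ n (χ : E), IntervalIntegrable (fun τ => ⟪χ, L τ (Yn n τ)⟫_ℂ) volume 0 t :=
    fun n χ => Continuous.intervalIntegrable (by have := hYc n; fun_prop) _ _
  -- Replacing `ψ n` by its strong limit costs `‖ψ n - φ‖` times a bound uniform in `n`.
  have h3 : Tendsto (fun n => ∫ τ in (0 : ℝ)..t, ⟪ψ n - φ, L τ (Yn n τ)⟫_ℂ) U (𝓝 0) := by
    have h4 : Tendsto (fun n => ‖ψ n - φ‖ * (CL * B) * |t - 0|) U (𝓝 0) := by
      have := (tendsto_iff_norm_sub_tendsto_zero.1 hψ)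
      simpa using (this.mul_const (CL * B)).mul_const |t - 0|
    refine squeeze_zero_norm (fun n => ?_) h4
    refine intervalIntegral.norm_integral_le_of_norm_le_const fun τ hτ => ?_
    rw [uIoc_of_le ht.1] at hτ
    refine (norm_inner_le_norm _ _).trans ?_
    gcongr
    have hCL' := hCL τ ⟨hτ.1.le, hτ.2⟩
    refine ((L τ).le_opNorm _).trans ?_
    gcongr
    · exact (norm_nonneg _).trans hCL'
    · exact hB n τ ⟨hτ.1.le, hτ.2.trans ht.2⟩
  have h5 := h3.add (h2 t ht)
  rw [zero_add] at h5
  refine h5.congr fun n => ?_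
  rw [← intervalIntegral.integral_add (hc n _) (hc n _)]
  simp only [inner_sub_left, sub_add_cancel]

end Galerkin

/-! ### Bessel weights and the equation in the variables `Z` and `Y` -/

/-- The symbol `⟨ξ⟩^c`. -/
def wsym (c ξ : ℝ) : ℂ := (jb ξ ^ c : ℝ)

lemma norm_wsym (c ξ : ℝ) : ‖wsym c ξ‖ = jb ξ ^ c := by
  rw [wsym, Complex.norm_real, Real.norm_eq_abs, abs_of_nonneg (Real.rpow_nonneg (jb_pos ξ).le _)]

lemma conj_wsym (c ξ : ℝ) : conj (wsym c ξ) = wsym c ξ := Complex.conj_ofReal _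

lemma wsym_mul (c d ξ : ℝ) : wsym c ξ * wsym d ξ = wsym (c + d) ξ := by
  rw [wsym, wsym, wsym, ← Complex.ofReal_mul, Real.rpow_add (jb_pos ξ)]

lemma wsym_zero (ξ : ℝ) : wsym 0 ξ = 1 := by simp [wsym]

@[fun_prop]
lemma measurable_wsym (c : ℝ) : Measurable (wsym c) := by unfold wsym; fun_prop

lemma bddMul_wsym {c : ℝ} (hc : c ≤ 0) : BddMul (wsym c) 1 where
  measurable := by fun_prop
  bound ξ := by rw [norm_wsym]; exact Real.rpow_le_one_of_one_le_of_nonpos (one_le_jb ξ) hc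

lemma bddMul_cut_wsym (N : ℕ) {c : ℝ} (hc : 0 ≤ c) :
    BddMul (fun ξ => cut N ξ * wsym c ξ) (jb N ^ c) :=
  bddMul_cut_mul N (by fun_prop) fun ξ hξ => by
    rw [norm_wsym]
    refine Real.rpow_le_rpow (jb_pos ξ).le ?_ hc
    unfold jb
    refine Real.sqrt_le_sqrt (add_le_add_right ?_ 1)
    exact sq_le_sq.2 (hξ.trans (le_abs_self _))

/-- `⟨ξ⟩^c m(ξ)` is bounded when `m` grows slower than `|ξ|^n`, `n ≤ -c`. -/
lemma bddMul_wsym_mul {c : ℝ} {n : ℕ} (hc : c + n ≤ 0) {m : ℝ → ℂ} (hm : Measurable m) {C : ℝ}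
    (hC : 0 ≤ C) (h : ∀ ξ, ‖m ξ‖ ≤ C * |ξ| ^ n) : BddMul (fun ξ => wsym c ξ * m ξ) C where
  measurable := by fun_prop
  bound ξ := by
    rw [norm_mul, norm_wsym]
    have hj := jb_pos ξ
    calc _ ≤ jb ξ ^ c * (C * jb ξ ^ n) := by
          gcongr
          exact (h ξ).trans (by gcongr; exact abs_le_jb ξ)
      _ = C * jb ξ ^ (c + n) := by rw [Real.rpow_add hj, Real.rpow_natCast]; ring
      _ ≤ C * 1 := by
          gcongr
          exact Real.rpow_le_one_of_one_le_of_nonpos (one_le_jb ξ) hc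
      _ = C := mul_one C

lemma bddMul_wsym_dsym : BddMul (fun ξ => wsym (-(3 / 2)) ξ * dsym ξ) (2 * Real.pi) :=
  bddMul_wsym_mul (n := 1) (by norm_num) (by fun_prop) Real.two_pi_pos.le fun ξ => by
    rw [norm_dsym, pow_one]

lemma bddMul_wsym_dsym_sq : BddMul (fun ξ => wsym (-3) ξ * (dsym ξ * dsym ξ)) ((2 * Real.pi) ^ 2) :=
  bddMul_wsym_mul (n := 2) (by norm_num) (by fun_prop) (by positivity) fun ξ => by
    rw [norm_mul, norm_dsym]; exact le_of_eq (by ring)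

lemma bddMul_wsym_asym_sq : BddMul (fun ξ => wsym (-3) ξ * (asym ξ * asym ξ)) ((2 * Real.pi) ^ 3) :=
  bddMul_wsym_mul (n := 3) (by norm_num) (by fun_prop) (by positivity) fun ξ => by
    rw [norm_mul, ← sq, norm_asym_sq]; exact le_of_eq (by ring)

/-- `⟨D⟩^{-3/2}`. -/
def ell : L2 →L[ℂ] L2 := mulOp (wsym (-(3 / 2)))

/-- The operator sending `⟨D⟩^{s+3/2} u` to `⟨D⟩^a (H ∂³ u - V² ∂² u)`, `a = s - 3/2`. -/
def accZ (a k : ℝ) (v : L2) : L2 →L[ℂ] L2 :=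
  -(mulOp fun ξ => wsym (-3) ξ * (asym ξ * asym ξ)) -
    (kop (multKer a k) v).comp ((kop (multKer a k) v).comp
      (mulOp fun ξ => wsym (-3) ξ * (dsym ξ * dsym ξ)))

/-- The operator sending `⟨D⟩^s w` to `-2 ⟨D⟩^a V ∂ w`, `a = s - 3/2`. -/
def accY (a k : ℝ) (v : L2) : L2 →L[ℂ] L2 :=
  -((2 : ℂ) • (kop (multKer a k) v).comp (mulOp fun ξ => wsym (-(3 / 2)) ξ * dsym ξ))

lemma continuous_accZ {a k : ℝ} {v : ℝ → L2} (hv : Continuous v) :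
    Continuous fun t => accZ a k (v t) := by
  have : Continuous fun t => kop (multKer a k) (v t) := by fun_prop
  exact continuous_const.sub (this.clm_comp (this.clm_comp continuous_const))

lemma continuous_accY {a k : ℝ} {v : ℝ → L2} (hv : Continuous v) :
    Continuous fun t => accY a k (v t) := by
  have : Continuous fun t => kop (multKer a k) (v t) := by fun_prop
  have h : Continuous fun t => (kop (multKer a k) (v t)).comp
      (mulOp fun ξ => wsym (-(3 / 2)) ξ * dsym ξ) := this.clm_comp continuous_const
  exact (h.const_smul (2 : ℂ)).neg

lemma wsym_mul_multKer (a k c ξ η : ℝ) :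
    wsym c ξ * multKer a k ξ η = multKer (a + c) k ξ η * wsym c η := by
  simp only [wsym, multKer]
  rw [Real.rpow_add (jb_pos ξ), neg_add, Real.rpow_add (jb_pos η), Real.rpow_neg (jb_pos η).le c]
  have : jb η ^ c ≠ 0 := (Real.rpow_pos_of_pos (jb_pos η) c).ne'
  push_cast
  have : ((jb η ^ c : ℝ) : ℂ) ≠ 0 := by exact_mod_cast this
  field_simp

/-- `⟨D⟩^c (⟨D⟩^a V ⟨D⟩^{-a}) = (⟨D⟩^{a+c} V ⟨D⟩^{-a-c}) ⟨D⟩^c`. -/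
lemma mulOp_wsym_kop {a k c : ℝ} (hk : 3 ≤ k) (ha : |a| ≤ k) (hac : |a + c| ≤ k) (hc : c ≤ 0)
    (v g : L2) : mulOp (wsym c) (kop (multKer a k) v g) =
      kop (multKer (a + c) k) v (mulOp (wsym c) g) := by
  rw [mulOp_kop (admissible_multKer hk ha) (bddMul_wsym hc),
    kop_mulOp (admissible_multKer hk hac) (bddMul_wsym hc)]
  simp only [wsym_mul_multKer]

lemma ell_mulOp_cut_wsym (N : ℕ) (f : L2) :
    ell (mulOp (fun ξ => cut N ξ * wsym (3 / 2) ξ) f) = Pop N f := by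
  rw [ell, mulOp_mulOp (bddMul_wsym (by norm_num)) (bddMul_cut_wsym N (by norm_num)), Pop]
  congr 2; ext ξ
  rw [mul_left_comm, wsym_mul, neg_add_cancel, wsym_zero, mul_one]

lemma denseRange_ell : DenseRange ell := fun f =>
  mem_closure_of_tendsto (tendsto_Pop f) (Eventually.of_forall fun N =>
    ⟨_, ell_mulOp_cut_wsym N f⟩)

lemma inner_ell (f g : L2) : ⟪ell f, g⟫_ℂ = ⟪f, ell g⟫_ℂ := by
  rw [ell, inner_mulOp_left (bddMul_wsym (by norm_num))]; simp only [conj_wsym]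

lemma norm_ell_le (f : L2) : ‖ell f‖ ≤ ‖f‖ := by
  have := norm_mulOp_le (bddMul_wsym (c := -(3 / 2)) (by norm_num)) f
  rwa [one_mul] at this

lemma ell_Pop (N : ℕ) (f : L2) : ell (Pop N f) = Pop N (ell f) :=
  mulOp_comm (bddMul_wsym (by norm_num)) (bddMul_cut N) f

lemma mulOp_wsym_injective {c : ℝ} (hc : c ≤ 0) : Function.Injective (mulOp (wsym c)) :=
  fun f g h => by
  refine Lp.ext ?_
  filter_upwards [mulOp_ae_eq (bddMul_wsym hc) f, mulOp_ae_eq (bddMul_wsym hc) g] with x h1 h2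
  rw [h, h2] at h1
  have : wsym c x ≠ 0 := by
    rw [← norm_ne_zero_iff, norm_wsym]; exact (Real.rpow_pos_of_pos (jb_pos x) _).ne'
  exact (mul_left_cancel₀ this h1).symm

lemma ell_injective : Function.Injective ell := mulOp_wsym_injective (by norm_num)

/-- The Galerkin right-hand side, seen at the regularity of the limit equation. -/
lemma ell_galerkin {s k : ℝ} (hk : 3 ≤ k) (hs : |s| ≤ k) (hs' : |s - 3 / 2| ≤ k) (N : ℕ) (v : L2)
    {x y : L2} (hy : Pop N y = y) :
    ell (-(Aop N (Aop N x)) - (2 : ℂ) • Pop N (kop (multKer s k) v (Dop N y)) -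
      Pop N (kop (multKer s k) v (kop (multKer s k) v (Dop N (Dop N x))))) =
    Pop N (accZ (s - 3 / 2) k v (mulOp (fun ξ => cut N ξ * wsym (3 / 2) ξ) x) +
      accY (s - 3 / 2) k v y) := by
  have hc : ∀ g, ell (kop (multKer s k) v g) = kop (multKer (s - 3 / 2) k) v (ell g) := fun g =>
    mulOp_wsym_kop hk hs hs' (by norm_num) v g
  have b := bddMul_cut_wsym N (c := 3 / 2) (by norm_num)
  have bw := bddMul_wsym (c := -(3 / 2)) (by norm_num)
  have e3 : wsym (-(3 : ℝ)) = fun ξ => wsym (-(3 / 2)) ξ * wsym (-(3 / 2)) ξ := by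
    ext ξ; rw [wsym_mul]; norm_num
  have ew : ∀ ξ, wsym (-(3 / 2)) ξ * wsym (3 / 2) ξ = 1 := fun ξ => by
    rw [wsym_mul, neg_add_cancel, wsym_zero]
  have h1 : ell (Aop N (Aop N x)) = Pop N (mulOp (fun ξ => wsym (-3) ξ * (asym ξ * asym ξ))
      (mulOp (fun ξ => cut N ξ * wsym (3 / 2) ξ) x)) := by
    rw [ell, Aop, Pop, mulOp_mulOp (bddMul_cut_asym N) (bddMul_cut_asym N),
      mulOp_mulOp bw ((bddMul_cut_asym N).mul (bddMul_cut_asym N)),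
      mulOp_mulOp bddMul_wsym_asym_sq b, mulOp_mulOp (bddMul_cut N) (bddMul_wsym_asym_sq.mul b), e3]
    congr 2; ext ξ
    linear_combination (-(cut N ξ * cut N ξ * wsym (-(3/2)) ξ * asym ξ * asym ξ)) * ew ξ
  have h2 : ell (Dop N y) = mulOp (fun ξ => wsym (-(3 / 2)) ξ * dsym ξ) y := by
    conv_rhs => rw [← hy]
    rw [ell, Dop, Pop, mulOp_mulOp bw (bddMul_cut_dsym N),
      mulOp_mulOp bddMul_wsym_dsym (bddMul_cut N)]
    congr 2; ext ξ; ring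
  have h3 : ell (Dop N (Dop N x)) = mulOp (fun ξ => wsym (-3) ξ * (dsym ξ * dsym ξ))
      (mulOp (fun ξ => cut N ξ * wsym (3 / 2) ξ) x) := by
    rw [ell, Dop, mulOp_mulOp (bddMul_cut_dsym N) (bddMul_cut_dsym N),
      mulOp_mulOp bw ((bddMul_cut_dsym N).mul (bddMul_cut_dsym N)),
      mulOp_mulOp bddMul_wsym_dsym_sq b, e3]
    congr 2; ext ξ
    linear_combination (-(cut N ξ * wsym (-(3/2)) ξ * dsym ξ * dsym ξ)) * ew ξ +
      (wsym (-(3/2)) ξ * dsym ξ * dsym ξ) * cut_mul_self N ξ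
  simp only [map_sub, map_neg, map_smul, ell_Pop, hc, h1, h2, h3, accZ, accY,
    sub_apply, neg_apply, ContinuousLinearMap.comp_apply,
    smul_apply, map_add]
  abel

/-- From `⟨ξ⟩³ ≤ 4(1 + |ξ|³)`: the energy, which contains `‖|D|^{3/2}x‖² + ‖x‖²`, controls `Z =
⟨D⟩^{3/2} x`. The `4` is the square of the factor `2` in the bound on the approximations. -/
lemma norm_sq_cut_wsym_le (N : ℕ) (x : L2) :
    ‖mulOp (fun ξ => cut N ξ * wsym (3 / 2) ξ) x‖ ^ 2 ≤ 4 * ‖Aop N x‖ ^ 2 + 4 * ‖Pop N x‖ ^ 2 := by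
  refine norm_sq_mulOp_le (bddMul_cut_wsym N (by norm_num)) (bddMul_cut_asym N) (bddMul_cut N)
    (fun ξ => ?_) x
  rw [norm_mul, norm_mul, mul_pow, mul_pow, norm_asym_sq, norm_wsym, ← Real.rpow_natCast (jb ξ ^ _),
    ← Real.rpow_mul (jb_pos ξ).le]
  have h1 : jb ξ ≤ 1 + |ξ| := by
    unfold jb
    rw [Real.sqrt_le_left (by positivity)]
    nlinarith [abs_nonneg ξ, sq_abs ξ]
  have e : jb ξ ^ ((3 / 2 : ℝ) * (2 : ℕ)) = jb ξ ^ 3 := by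
    rw [← Real.rpow_natCast]; norm_num
  rw [e]
  have h2 : jb ξ ^ 3 ≤ 4 * (1 + |ξ| ^ 3) := by
    have : jb ξ ^ 3 ≤ (1 + |ξ|) ^ 3 := by have := jb_pos ξ; gcongr
    nlinarith [mul_nonneg (add_nonneg zero_le_one (abs_nonneg ξ)) (sq_nonneg (1 - |ξ|))]
  have h3 : |ξ| ^ 3 ≤ (2 * Real.pi * |ξ|) ^ 3 := by
    have := Real.pi_gt_three
    gcongr
    nlinarith [abs_nonneg ξ]
  have h4 : 0 ≤ ‖cut N ξ‖ ^ 2 := by positivity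
  nlinarith

/-- Bounds the initial energy by the data uniformly in the cutoff; the origin of `(2π)³` in
`energyBound`. -/
lemma norm_sq_Aop_ell_le (N : ℕ) (z : L2) : ‖Aop N (ell z)‖ ^ 2 ≤ (2 * Real.pi) ^ 3 * ‖z‖ ^ 2 := by
  rw [Aop, ell, mulOp_mulOp (bddMul_cut_asym N) (bddMul_wsym (by norm_num))]
  have b : BddMul (fun ξ => cut N ξ * asym ξ * wsym (-(3 / 2)) ξ) (Real.sqrt ((2 * Real.pi) ^ 3)) :=
    ⟨by fun_prop, fun ξ => Real.le_sqrt_of_sq_le (by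
      rw [norm_mul, norm_mul, mul_pow, mul_pow, norm_asym_sq, norm_wsym,
        ← Real.rpow_natCast (jb ξ ^ _), ← Real.rpow_mul (jb_pos ξ).le]
      have e : jb ξ ^ (-(3 / 2) * ((2 : ℕ) : ℝ)) = (jb ξ ^ 3)⁻¹ := by
        rw [← Real.rpow_natCast, ← Real.rpow_neg (jb_pos ξ).le]; norm_num
      have hj := jb_pos ξ
      rw [e, ← div_eq_mul_inv, div_le_iff₀ (by positivity), mul_pow (2 * Real.pi)]
      have h1 : |ξ| ^ 3 ≤ jb ξ ^ 3 := by gcongr; exact abs_le_jb ξ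
      have h2 : ‖cut N ξ‖ ^ 2 ≤ 1 := pow_le_one₀ (norm_nonneg _) (norm_cut_le N ξ)
      have h3 : 0 ≤ (2 * Real.pi) ^ 3 := by positivity
      calc _ ≤ 1 * ((2 * Real.pi) ^ 3 * jb ξ ^ 3) := by gcongr
        _ = _ := one_mul _)⟩
  have h := norm_mulOp_le b z
  calc _ ≤ (Real.sqrt ((2 * Real.pi) ^ 3) * ‖z‖) ^ 2 := by gcongr
    _ = _ := by rw [mul_pow, Real.sq_sqrt (by positivity)]

/-! ### Approximate solutions and their weak limit -/

section

/-- The energy bound for data `Z₀`, `Y₀` and a force of squared `L²` norm `ρ`. -/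
def energyBound (T M M' : ℝ) (Z₀ Y₀ : L2) (ρ : ℝ) : ℝ :=
  2 * Real.exp (energyRate M M' * T) *
    (energyCoeff M * (‖Y₀‖ ^ 2 + ((2 * Real.pi) ^ 3 + 1) * ‖Z₀‖ ^ 2) + ρ)

/-- Weak solutions of the equation in terms of `Z = ⟨D⟩^{s+3/2} u` and `Y = ⟨D⟩^s ∂_t u`, where
`a = s - 3/2`. -/
structure IsWeakSolution (a k T : ℝ) (v R Z Y : ℝ → L2) : Prop where
  continuousOn_Y : ∀ φ, ContinuousOn (fun t => ⟪φ, Y t⟫_ℂ) (Icc 0 T)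
  eq_Z : ∀ φ, ∀ t ∈ Icc 0 T, ⟪φ, ell (Z t)⟫_ℂ = ⟪φ, ell (Z 0)⟫_ℂ + ∫ τ in (0 : ℝ)..t, ⟪φ, Y τ⟫_ℂ
  continuousOn_acc : ∀ φ, ContinuousOn
    (fun t => ⟪φ, accZ a k (v t) (Z t) + accY a k (v t) (Y t)⟫_ℂ) (Icc 0 T)
  eq_Y : ∀ φ, ∀ t ∈ Icc 0 T, ⟪φ, ell (Y t)⟫_ℂ = ⟪φ, ell (Y 0)⟫_ℂ +
    ((∫ τ in (0 : ℝ)..t, ⟪φ, accZ a k (v τ) (Z τ) + accY a k (v τ) (Y τ)⟫_ℂ) +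
      ∫ τ in (0 : ℝ)..t, ⟪φ, ell (R τ)⟫_ℂ)

/-- The approximate solutions. -/
structure IsApprox (a k T B : ℝ) (v R : ℝ → L2) (Z₀ Y₀ : L2) (Zn Yn : ℕ → ℝ → L2) : Prop where
  continuous_Z : ∀ n, Continuous (Zn n)
  continuous_Y : ∀ n, Continuous (Yn n)
  bound_Z : ∀ n, ∀ t ∈ Icc 0 T, ‖Zn n t‖ ≤ B
  bound_Y : ∀ n, ∀ t ∈ Icc 0 T, ‖Yn n t‖ ≤ B
  initial_Z : ∀ n, Zn n 0 = Pop n Z₀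
  initial_Y : ∀ n, Yn n 0 = Pop n Y₀
  eq_Z : ∀ n, ∀ t ∈ Icc 0 T, ell (Zn n t) = ell (Zn n 0) + ∫ τ in (0 : ℝ)..t, Yn n τ
  eq_Y : ∀ n, ∀ t ∈ Icc 0 T, ell (Yn n t) = ell (Yn n 0) + ∫ τ in (0 : ℝ)..t,
    (Pop n (accZ a k (v τ) (Zn n τ) + accY a k (v τ) (Yn n τ)) + Pop n (ell (R τ)))

/-- The Galerkin equation is posed at level `s`, where the energy estimate holds with `ρ = ‖R‖²`,
because `2 Re⟨y, P_N R⟩ ≤ ‖y‖² + ‖R‖²`. Applying `⟨D⟩^{-3/2}` rewrites it at the level `s - 3/2`, at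
which its operators stay bounded when the cutoff is removed. -/
lemma exists_approx {s k : ℝ} (hk : 3 ≤ k) (hs : |s| ≤ k - 1) (hs' : |s - 3 / 2| ≤ k) :
    ∃ c : ℝ, 0 ≤ c ∧ ∀ (T b b' : ℝ) (v v' : ℝ → L2), 0 ≤ T → 0 ≤ b → 0 ≤ b' →
      Coeff T b b' v v' → ∀ (R : ℝ → L2) (Z₀ Y₀ : L2), Integrable R →
      Integrable (fun t => ‖R t‖ ^ 2) → ∃ Zn Yn : ℕ → ℝ → L2,
      IsApprox (s - 3 / 2) k T
        (2 * Real.sqrt (energyBound T (c * b) (c * b') Z₀ Y₀ (∫ τ in (0 : ℝ)..T, ‖R τ‖ ^ 2)))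
        v R Z₀ Y₀ Zn Yn := by
  obtain ⟨c, hc, H⟩ := exists_energyOps hk hs
  refine ⟨c, hc, fun T b b' v v' hT hb hb' hv R Z₀ Y₀ hR hR2 => ?_⟩
  have hT0 : (0 : ℝ) ∈ Icc 0 T := ⟨le_rfl, hT⟩
  set Bd := energyBound T (c * b) (c * b') Z₀ Y₀ (∫ τ in (0 : ℝ)..T, ‖R τ‖ ^ 2) with hBd
  have hg := fun N : ℕ => exists_galerkin (H T b b' v v' hb hb' hv N) hT (x₀ := Pop N (ell Z₀))
    (y₀ := Pop N Y₀) (r := fun τ => Pop N (R τ)) ((Pop N).integrable_comp hR) (Pop_Pop N _)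
    (Pop_Pop N _) (fun τ => Pop_Pop N _)
  choose x y hyc hx hx0 hy0 hPx hPy hy using hg
  have hxc : ∀ N, Continuous (x N) := fun N =>
    continuous_iff_continuousAt.2 fun t => (hx N t).continuousAt
  have hE : ∀ N, ∀ t ∈ Icc 0 T, stateSq (Aop N) (x N t) (y N t) ≤ Bd := fun N t ht => by
    have h := energy_estimate (H T b b' v v' hb hb' hv N) hT (hyc N) (hx N)
      ((Pop N).integrable_comp hR).intervalIntegrable (hPy N) (hy N)
      hR2.intervalIntegrable (fun τ => by positivity) (ae_of_all _ fun τ hτ => by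
        have h1 : (⟪y N τ, Pop N (R τ)⟫_ℂ).re ≤ ‖y N τ‖ * ‖R τ‖ := by
          refine (Complex.re_le_norm _).trans ((norm_inner_le_norm _ _).trans ?_)
          gcongr; exact norm_Pop_le N _
        have h2 := two_mul_le_add_sq ‖y N τ‖ ‖R τ‖
        unfold stateSq
        nlinarith [sq_nonneg ‖Aop N (x N τ)‖, sq_nonneg ‖x N τ‖]) t ht
    refine h.trans ?_
    rw [hBd, energyBound, stateSq, hx0, hy0]
    have hK := energyCoeff_ge_one (c * b)
    have e1 : Aop N (Pop N (ell Z₀)) = Aop N (ell Z₀) := by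
      rw [Aop, Pop, mulOp_mulOp (bddMul_cut_asym N) (bddMul_cut N)]
      congr 2; ext ξ; rw [mul_right_comm, cut_mul_self]
    rw [e1]
    have h1 := norm_sq_Aop_ell_le N Z₀
    have h2 : ‖Pop N (ell Z₀)‖ ^ 2 ≤ ‖Z₀‖ ^ 2 := by
      gcongr; exact (norm_Pop_le N _).trans (norm_ell_le _)
    have h3 : ‖Pop N Y₀‖ ^ 2 ≤ ‖Y₀‖ ^ 2 := by gcongr; exact norm_Pop_le N _
    refine mul_le_mul_of_nonneg_left (add_le_add (mul_le_mul_of_nonneg_left ?_ ?_) le_rfl) ?_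
    · linarith
    · linarith
    · positivity
  have hBd0 : 0 ≤ Bd := le_trans (by unfold stateSq; positivity) (hE 0 0 hT0)
  have hell : ∀ N, ∀ t ∈ Icc 0 T, ell (mulOp (fun ξ => cut N ξ * wsym (3 / 2) ξ) (x N t)) = x N t :=
    fun N t ht => by rw [ell_mulOp_cut_wsym, hPx N t ht]
  refine ⟨fun N t => mulOp (fun ξ => cut N ξ * wsym (3 / 2) ξ) (x N t), y,
    fun N => (ContinuousLinearMap.continuous _).comp (hxc N), hyc, fun N t ht => ?_,
    fun N t ht => ?_, fun N => ?_, hy0, fun N t ht => ?_, fun N t ht => ?_⟩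
  · refine abs_le_of_sq_le_sq' ?_ (by positivity) |>.2
    have h1 := norm_sq_cut_wsym_le N (x N t)
    have h2 := hE N t ht
    rw [hPx N t ht] at h1
    rw [mul_pow, Real.sq_sqrt hBd0]
    unfold stateSq at h2
    nlinarith [sq_nonneg ‖y N t‖]
  · refine abs_le_of_sq_le_sq' ?_ (by positivity) |>.2
    have h2 := hE N t ht
    rw [mul_pow, Real.sq_sqrt hBd0]
    unfold stateSq at h2
    nlinarith [sq_nonneg ‖Aop N (x N t)‖, sq_nonneg ‖x N t‖]
  · apply ell_injective
    rw [hell N 0 hT0, hx0, ell_Pop]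
  · rw [hell N t ht, hell N 0 hT0, ← sub_eq_iff_eq_add']
    exact (intervalIntegral.integral_eq_sub_of_hasDerivAt (fun τ _ => hx N τ)
      ((hyc N).intervalIntegrable _ _)).symm
  · have hvc := hv.continuous
    have hG : Continuous fun τ => -(Aop N (Aop N (x N τ))) -
        (2 : ℂ) • Pop N (kop (multKer s k) (v τ) (Dop N (y N τ))) -
        Pop N (kop (multKer s k) (v τ) (kop (multKer s k) (v τ) (Dop N (Dop N (x N τ))))) := by
      have := hxc N; have := hyc N; fun_prop
    have hi := (hG.intervalIntegrable (μ := volume) 0 t).add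
      ((Pop N).integrable_comp hR).intervalIntegrable
    have h := congrArg ell (hy N t ht)
    rw [map_add] at h
    rw [h]
    congr 1
    have h2 := (ell.restrictScalars ℝ).intervalIntegral_comp_comm hi
    simp only [ContinuousLinearMap.coe_restrictScalars'] at h2
    refine h2.symm.trans (intervalIntegral.integral_congr fun τ hτ => ?_)
    rw [uIcc_of_le ht.1] at hτ
    have hτ' : τ ∈ Icc 0 T := ⟨hτ.1, hτ.2.trans ht.2⟩
    rw [map_add, ell_galerkin hk (hs.trans (by linarith)) hs' N (v τ) (hPy N τ hτ'),
      ell_Pop]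

variable {a k T B : ℝ} {v R : ℝ → L2} {Z₀ Y₀ : L2} {Zn Yn : ℕ → ℝ → L2}

/-- The time derivative of `Z` costs `3/2` derivatives, which a test vector in the range of
`⟨D⟩^{-3/2}` absorbs. The resulting bound is Lipschitz in time. -/
lemma IsApprox.equicontinuous_Z (h : IsApprox a k T B v R Z₀ Y₀ Zn Yn) :
    ∀ φ ∈ range ell, ∃ w : ℝ → ℝ, Continuous w ∧
      ∀ n, ∀ t ∈ Icc 0 T, ∀ t' ∈ Icc 0 T, ‖⟪φ, Zn n t - Zn n t'⟫_ℂ‖ ≤ |w t - w t'| := by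
  rintro _ ⟨φ, rfl⟩
  refine ⟨fun t => ‖φ‖ * (B * t), by fun_prop, fun n t ht t' ht' => ?_⟩
  have hi : ∀ t, IntervalIntegrable (Yn n) volume 0 t := fun t =>
    (h.continuous_Y n).intervalIntegrable _ _
  rw [inner_ell, map_sub, h.eq_Z n t ht, h.eq_Z n t' ht', add_sub_add_left_eq_sub,
    intervalIntegral.integral_interval_sub_left (hi t) (hi t')]
  have hB : 0 ≤ B := (norm_nonneg _).trans (h.bound_Y 0 t ht)
  refine (norm_inner_le_norm _ _).trans ?_
  rw [← mul_sub, ← mul_sub, abs_mul, abs_norm, abs_mul, abs_of_nonneg hB]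
  gcongr
  refine intervalIntegral.norm_integral_le_of_norm_le_const fun τ hτ => h.bound_Y n τ ?_
  have h1 := uIoc_subset_uIcc hτ
  exact (Set.uIcc_subset_Icc ht' ht) h1

/-- As for `Z`, but the modulus is a primitive involving `‖R‖`, hence continuous without being
Lipschitz. -/
lemma IsApprox.equicontinuous_Y (h : IsApprox a k T B v R Z₀ Y₀ Zn Yn) (hv : Continuous v)
    (hR : Integrable R) :
    ∀ φ ∈ range ell, ∃ w : ℝ → ℝ, Continuous w ∧
      ∀ n, ∀ t ∈ Icc 0 T, ∀ t' ∈ Icc 0 T, ‖⟪φ, Yn n t - Yn n t'⟫_ℂ‖ ≤ |w t - w t'| := by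
  rintro _ ⟨φ, rfl⟩
  obtain ⟨C, hC⟩ := (isCompact_Icc (a := (0 : ℝ)) (b := T)).exists_bound_of_continuousOn
    (continuous_accZ (a := a) (k := k) hv).continuousOn
  obtain ⟨C', hC'⟩ := (isCompact_Icc (a := (0 : ℝ)) (b := T)).exists_bound_of_continuousOn
    (continuous_accY (a := a) (k := k) hv).continuousOn
  have hint : ∀ t t', IntervalIntegrable (fun τ => C * B + C' * B + ‖R τ‖) volume t t' :=
    fun t t' => intervalIntegrable_const.add hR.norm.intervalIntegrable
  refine ⟨fun t => ‖φ‖ * ∫ τ in (0 : ℝ)..t, (C * B + C' * B + ‖R τ‖),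
    continuous_const.mul (intervalIntegral.continuous_primitive hint 0), fun n t ht t' ht' => ?_⟩
  have hcZ := continuous_accZ (a := a) (k := k) hv
  have hcY := continuous_accY (a := a) (k := k) hv
  have hi : ∀ t, IntervalIntegrable (fun τ => Pop n (accZ a k (v τ) (Zn n τ) +
      accY a k (v τ) (Yn n τ)) + Pop n (ell (R τ))) volume 0 t := fun t => by
    have h1 : Continuous fun τ => Pop n (accZ a k (v τ) (Zn n τ) + accY a k (v τ) (Yn n τ)) := by
      have := h.continuous_Z n; have := h.continuous_Y n; fun_prop
    exact (h1.intervalIntegrable _ _).add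
      ((Pop n).integrable_comp (ell.integrable_comp hR)).intervalIntegrable
  rw [inner_ell, map_sub, h.eq_Y n t ht, h.eq_Y n t' ht', add_sub_add_left_eq_sub,
    intervalIntegral.integral_interval_sub_left (hi t) (hi t'), ← mul_sub,
    intervalIntegral.integral_interval_sub_left (hint 0 t) (hint 0 t'), abs_mul, abs_norm]
  refine (norm_inner_le_norm _ _).trans ?_
  gcongr
  refine intervalIntegral.norm_integral_le_abs_of_norm_le ?_ (hint _ _)
  refine (ae_restrict_iff' measurableSet_uIoc).2 (ae_of_all _ fun τ hτ => ?_)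
  have hτ' : τ ∈ Icc 0 T := (Set.uIcc_subset_Icc ht' ht) (uIoc_subset_uIcc hτ)
  refine (norm_add_le _ _).trans (add_le_add ((norm_Pop_le _ _).trans
    ((norm_add_le _ _).trans (add_le_add ?_ ?_))) ((norm_Pop_le _ _).trans (norm_ell_le _)))
  · exact (accZ a k (v τ)).le_of_opNorm_le_of_le (hC τ hτ') (h.bound_Z n τ hτ')
  · exact (accY a k (v τ)).le_of_opNorm_le_of_le (hC' τ hτ') (h.bound_Y n τ hτ')

/-- Bounded sets are weakly compact, so limits exist at each time. Since the equation is linear, the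
weak convergence upgraded to time integrals by equicontinuity suffices; the cutoff is moved onto the
test vector, where it converges strongly. -/
lemma IsApprox.exists_isWeakSolution (h : IsApprox a k T B v R Z₀ Y₀ Zn Yn) (hT : 0 ≤ T)
    (hv : Continuous v) (hR : Integrable R) :
    ∃ Z Y, IsWeakSolution a k T v R Z Y ∧ Z 0 = Z₀ ∧ Y 0 = Y₀ ∧
      (∀ t ∈ Icc 0 T, ‖Z t‖ ≤ B) ∧ ∀ t ∈ Icc 0 T, ‖Y t‖ ≤ B := by
  classical
  -- Along one ultrafilter the weak limits exist at all times simultaneously, without extracting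
  -- subsequences.
  set U : Ultrafilter ℕ := hyperfilter ℕ
  have hU : (U : Filter ℕ) ≤ atTop := Nat.hyperfilter_le_atTop
  have hT0 : (0 : ℝ) ∈ Icc 0 T := ⟨le_rfl, hT⟩
  have hZ : ∀ t : Icc 0 T, ∃ g : L2, ‖g‖ ≤ B ∧ ∀ φ, Tendsto (fun n => ⟪φ, Zn n t⟫_ℂ) U (𝓝 ⟪φ, g⟫_ℂ) :=
    fun t => exists_weak_limit U fun n => h.bound_Z n t t.2
  have hY : ∀ t : Icc 0 T, ∃ g : L2, ‖g‖ ≤ B ∧ ∀ φ, Tendsto (fun n => ⟪φ, Yn n t⟫_ℂ) U (𝓝 ⟪φ, g⟫_ℂ) :=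
    fun t => exists_weak_limit U fun n => h.bound_Y n t t.2
  choose Z' hZb hZl using hZ
  choose Y' hYb hYl using hY
  obtain ⟨Z, hZe⟩ : ∃ Z : ℝ → L2, ∀ t : Icc 0 T, Z t = Z' t :=
    ⟨fun t => Z' (projIcc 0 T hT t), fun t => by simp only [projIcc_val]⟩
  obtain ⟨Y, hYe⟩ : ∃ Y : ℝ → L2, ∀ t : Icc 0 T, Y t = Y' t :=
    ⟨fun t => Y' (projIcc 0 T hT t), fun t => by simp only [projIcc_val]⟩
  have lZ : ∀ t ∈ Icc 0 T, ∀ φ, Tendsto (fun n => ⟪φ, Zn n t⟫_ℂ) U (𝓝 ⟪φ, Z t⟫_ℂ) :=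
    fun t ht φ => by rw [hZe ⟨t, ht⟩]; exact hZl ⟨t, ht⟩ φ
  have lY : ∀ t ∈ Icc 0 T, ∀ φ, Tendsto (fun n => ⟪φ, Yn n t⟫_ℂ) U (𝓝 ⟪φ, Y t⟫_ℂ) :=
    fun t ht φ => by rw [hYe ⟨t, ht⟩]; exact hYl ⟨t, ht⟩ φ
  have hP : ∀ φ : L2, Tendsto (fun n => Pop n φ) U (𝓝 φ) := fun φ => (tendsto_Pop φ).mono_left hU
  have hZ0 : Z 0 = Z₀ := ext_inner_left ℂ fun φ => tendsto_nhds_unique (lZ 0 hT0 φ) (by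
    simp only [h.initial_Z]; exact tendsto_const_nhds.inner (hP Z₀))
  have hY0 : Y 0 = Y₀ := ext_inner_left ℂ fun φ => tendsto_nhds_unique (lY 0 hT0 φ) (by
    simp only [h.initial_Y]; exact tendsto_const_nhds.inner (hP Y₀))
  have key_Z := fun (L : ℝ → L2 →L[ℂ] L2) (hL : Continuous L) φ =>
    tendsto_integral_inner_clm h.continuous_Z h.bound_Z lZ denseRange_ell h.equicontinuous_Z hL (hP φ)
  have key_Y := fun (L : ℝ → L2 →L[ℂ] L2) (hL : Continuous L) φ =>
    tendsto_integral_inner_clm h.continuous_Y h.bound_Y lY denseRange_ell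
      (h.equicontinuous_Y hv hR) hL (hP φ)
  have key_Y' := fun φ => tendsto_integral_inner_clm h.continuous_Y h.bound_Y lY denseRange_ell
      (h.equicontinuous_Y hv hR) (continuous_const (y := ContinuousLinearMap.id ℂ L2))
      (tendsto_const_nhds (x := φ))
  have hcZ := continuous_accZ (a := a) (k := k) hv
  have hcY := continuous_accY (a := a) (k := k) hv
  have hYc : ∀ φ, ContinuousOn (fun t => ⟪φ, Y t⟫_ℂ) (Icc 0 T) := fun φ => by
    simpa using (key_Y' φ).1
  refine ⟨Z, Y, ⟨hYc, fun φ t ht => ?_, fun φ => ?_, fun φ t ht => ?_⟩, hZ0, hY0,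
    fun t ht => by rw [hZe ⟨t, ht⟩]; exact hZb _, fun t ht => by rw [hYe ⟨t, ht⟩]; exact hYb _⟩
  · refine tendsto_nhds_unique (f := fun n => ⟪ell φ, Zn n t⟫_ℂ) (l := (U : Filter ℕ)) ?_ ?_
    · rw [← inner_ell]; exact lZ t ht _
    · have h1 := (lZ 0 hT0 (ell φ)).add ((key_Y' φ).2 t ht)
      rw [inner_ell] at h1
      refine h1.congr fun n => ?_
      have hi : IntervalIntegrable (Yn n) volume 0 t := (h.continuous_Y n).intervalIntegrable _ _
      rw [inner_ell φ (Zn n t), h.eq_Z n t ht, inner_add_right, inner_ell]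
      congr 1
      exact ((innerSL ℂ φ).restrictScalars ℝ).intervalIntegral_comp_comm hi
  · simp only [inner_add_right]
    exact (key_Z _ hcZ φ).1.add (key_Y _ hcY φ).1
  · have hsplit : ∀ {f g : ℝ → L2} (ψ : L2), IntervalIntegrable (fun τ => ⟪ψ, f τ⟫_ℂ) volume 0 t →
        IntervalIntegrable (fun τ => ⟪ψ, g τ⟫_ℂ) volume 0 t →
        ∫ τ in (0 : ℝ)..t, ⟪ψ, f τ + g τ⟫_ℂ =
          (∫ τ in (0 : ℝ)..t, ⟪ψ, f τ⟫_ℂ) + ∫ τ in (0 : ℝ)..t, ⟪ψ, g τ⟫_ℂ := fun ψ hf hg => by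
      simp only [inner_add_right]
      exact intervalIntegral.integral_add hf hg
    have hIcc : uIcc 0 t ⊆ Icc 0 T := by
      rw [uIcc_of_le ht.1]; exact Icc_subset_Icc_right ht.2
    rw [hsplit φ ((key_Z _ hcZ φ).1.mono hIcc).intervalIntegrable
      ((key_Y _ hcY φ).1.mono hIcc).intervalIntegrable]
    refine tendsto_nhds_unique (f := fun n => ⟪ell φ, Yn n t⟫_ℂ) (l := (U : Filter ℕ)) ?_ ?_
    · rw [← inner_ell]; exact lY t ht _
    · have hRi : IntervalIntegrable (fun τ => ell (R τ)) volume 0 t :=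
        (ell.integrable_comp hR).intervalIntegrable
      have hRc : ∀ ψ, ∫ τ in (0 : ℝ)..t, ⟪ψ, ell (R τ)⟫_ℂ = ⟪ψ, ∫ τ in (0 : ℝ)..t, ell (R τ)⟫_ℂ :=
        fun ψ => ((innerSL ℂ ψ).restrictScalars ℝ).intervalIntegral_comp_comm hRi
      have hR1 : Tendsto (fun n => ∫ τ in (0 : ℝ)..t, ⟪Pop n φ, ell (R τ)⟫_ℂ) U
          (𝓝 (∫ τ in (0 : ℝ)..t, ⟪φ, ell (R τ)⟫_ℂ)) := by
        simp only [hRc]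
        exact (hP φ).inner tendsto_const_nhds
      have h1 := (lY 0 hT0 (ell φ)).add ((((key_Z _ hcZ φ).2 t ht).add
        ((key_Y _ hcY φ).2 t ht)).add hR1)
      rw [inner_ell] at h1
      refine h1.congr fun n => ?_
      have hZnc := h.continuous_Z n
      have hYnc := h.continuous_Y n
      have c1 : Continuous fun τ => accZ a k (v τ) (Zn n τ) := by fun_prop
      have c2 : Continuous fun τ => accY a k (v τ) (Yn n τ) := by fun_prop
      have hcI : ∀ {f : ℝ → L2} (ψ : L2), Continuous f →
          IntervalIntegrable (fun τ => ⟪ψ, f τ⟫_ℂ) volume 0 t := fun ψ hf =>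
        (Continuous.inner continuous_const hf).intervalIntegrable _ _
      have c3 : Continuous fun τ => Pop n (accZ a k (v τ) (Zn n τ) + accY a k (v τ) (Yn n τ)) :=
        (Pop n).continuous.comp (c1.add c2)
      rw [← hsplit _ (hcI _ c1) (hcI _ c2), ← hsplit (f := fun τ => accZ a k (v τ) (Zn n τ) +
        accY a k (v τ) (Yn n τ)) _ (hcI _ (c1.add c2)) (((innerSL ℂ (Pop n φ)).restrictScalars ℝ).integrable_comp
          (ell.integrable_comp hR)).intervalIntegrable,
        inner_ell φ (Yn n t), h.eq_Y n t ht, inner_add_right, inner_ell]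
      congr 1
      have h3 := ((innerSL ℂ φ).restrictScalars ℝ).intervalIntegral_comp_comm
        ((c3.intervalIntegrable (μ := volume) 0 t).add
          ((Pop n).integrable_comp (ell.integrable_comp hR)).intervalIntegrable)
      refine Eq.trans ?_ h3
      refine intervalIntegral.integral_congr fun τ _ => ?_
      simp only [ContinuousLinearMap.coe_restrictScalars', innerSL_apply_apply, ← map_add, inner_Pop]

end

/-! ### Uniqueness in Fourier variables -/

/-- `P_N ⟨D⟩^c (⟨D⟩^a V ⟨D⟩^{-a}) ⟨D⟩^{-c} = P_N (⟨D⟩^{a+c} V ⟨D⟩^{-a-c})`. -/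
lemma mulOp_cut_wsym_kop {a k c : ℝ} (hk : 3 ≤ k) (ha : |a| ≤ k) (hac : |a + c| ≤ k) (hc : 0 ≤ c)
    (N : ℕ) (v h : L2) :
    mulOp (fun ξ => cut N ξ * wsym c ξ) (kop (multKer a k) v (mulOp (wsym (-c)) h)) =
      Pop N (kop (multKer (a + c) k) v h) := by
  have h1 := mulOp_kop_mulOp_congr (admissible_multKer hk ha) (admissible_multKer hk hac)
    (bddMul_cut_wsym N hc) (bddMul_cut N) (bddMul_wsym (neg_nonpos.2 hc)) (BddMul.const 1)
    (fun ξ η => by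
      rw [mul_assoc (cut N ξ), wsym_mul_multKer, mul_assoc, mul_assoc, wsym_mul,
        add_neg_cancel, wsym_zero, mul_assoc]) v h
  rw [h1, mulOp_const, one_smul, Pop]

section Remainder

variable {s k : ℝ}

/-- The error made by the frequency truncation of a solution, tested against the solution. -/
lemma exists_remainder_bound (hk : 3 ≤ k) (h1 : |s - 1| ≤ k) (h2 : |s - 3 / 2| ≤ k) (b : ℝ) :
    ∃ C : ℝ, 0 ≤ C ∧ ∀ (N : ℕ) (v Y Q Q' : L2), ‖v‖ ≤ b →
      ‖⟪mulOp (fun ξ => cut N ξ * wsym (-(1 / 2)) ξ) Y, mulOp (fun ξ => cut N ξ * wsym 1 ξ)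
        (accZ (s - 3 / 2) k v Q' + accY (s - 3 / 2) k v Q +
          mulOp (fun ξ => wsym (-3) ξ * (asym ξ * asym ξ)) Q')⟫_ℂ‖ ≤ C * ‖Y‖ * (‖Q‖ + ‖Q'‖) := by
  have hm := admissible_multKer hk h1
  set c := 2 ^ k * (3 * kerConst.toReal) * |b| with hc
  have hc0 : 0 ≤ c := by positivity
  have hpi := Real.two_pi_pos
  refine ⟨2 * (c * (2 * Real.pi)) + c * (c * (2 * Real.pi) ^ 2), by positivity,
    fun N v Y Q Q' hv => ?_⟩
  have hcT : ∀ g, ‖kop (multKer (s - 1) k) v g‖ ≤ c * ‖g‖ := fun g => by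
    refine (norm_kop_le hm v g).trans ?_
    rw [hc]
    gcongr
    exact hv.trans (le_abs_self b)
  have hb1 : BddMul (fun ξ => wsym (-1) ξ * dsym ξ) (2 * Real.pi) :=
    bddMul_wsym_mul (n := 1) (by norm_num) (by fun_prop) hpi.le fun ξ => by rw [norm_dsym, pow_one]
  have hb2 : BddMul (fun ξ => wsym (-(5 / 2)) ξ * (dsym ξ * dsym ξ)) ((2 * Real.pi) ^ 2) :=
    bddMul_wsym_mul (n := 2) (by norm_num) (by fun_prop) (by positivity) fun ξ => by
      rw [norm_mul, norm_dsym]; exact le_of_eq (by ring)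
  have bw : BddMul (wsym (-(1 / 2))) 1 := bddMul_wsym (by norm_num)
  have e1 : mulOp (fun ξ => wsym (-(3 / 2)) ξ * dsym ξ) Q =
      mulOp (wsym (-(1 / 2))) (mulOp (fun ξ => wsym (-1) ξ * dsym ξ) Q) := by
    rw [mulOp_mulOp bw hb1]
    simp only [← mul_assoc, wsym_mul]; norm_num
  have e2 : mulOp (fun ξ => wsym (-3) ξ * (dsym ξ * dsym ξ)) Q' =
      mulOp (wsym (-(1 / 2))) (mulOp (fun ξ => wsym (-(5 / 2)) ξ * (dsym ξ * dsym ξ)) Q') := by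
    rw [mulOp_mulOp bw hb2]
    simp only [← mul_assoc, wsym_mul]; norm_num
  have e3 : ∀ g, kop (multKer (s - 3 / 2) k) v (mulOp (wsym (-(1 / 2))) g) =
      mulOp (wsym (-(1 / 2))) (kop (multKer (s - 1) k) v g) := fun g => by
    have h3 : s - 3 / 2 = s - 1 + -(1 / 2) := by ring
    rw [h3] at h2 ⊢
    exact (mulOp_wsym_kop hk h1 h2 (by norm_num) v g).symm
  have e4 : ∀ g, mulOp (fun ξ => cut N ξ * wsym (1 / 2) ξ)
      (kop (multKer (s - 3 / 2) k) v (mulOp (wsym (-(1 / 2))) g)) =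
      Pop N (kop (multKer (s - 1) k) v g) := fun g => by
    have h3 : s - 1 = s - 3 / 2 + 1 / 2 := by ring
    rw [h3] at h1 ⊢
    exact mulOp_cut_wsym_kop hk h2 h1 (by norm_num) N v g
  -- The weights `⟨D⟩^{-1/2}` and `⟨D⟩` are gathered on one side as `⟨D⟩^{1/2}`, which lifts the
  -- operators from level `s - 3/2` to `s - 1`. There `⟨D⟩^{-1}∂` acts on `Q`: order exactly zero,
  -- so level `s - 1/2` is the highest at which this bound closes.
  rw [inner_mulOp_left ((bddMul_cut N).mul bw),
    mulOp_mulOp ((bddMul_cut N).mul bw).conj (bddMul_cut_wsym N zero_le_one)]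
  have e5 : (fun ξ => conj (cut N ξ * wsym (-(1 / 2)) ξ) * (cut N ξ * wsym 1 ξ)) =
      fun ξ => cut N ξ * wsym (1 / 2) ξ := by
    ext ξ
    rw [map_mul, conj_cut, conj_wsym, mul_mul_mul_comm, cut_mul_self, wsym_mul]; norm_num
  -- The added multiplier removes the dispersive part, which has too many derivatives but commutes
  -- with the truncation; only the terms containing `V` remain.
  have e6 : accZ (s - 3 / 2) k v Q' + accY (s - 3 / 2) k v Q +
        mulOp (fun ξ => wsym (-3) ξ * (asym ξ * asym ξ)) Q' =
      -(2 : ℂ) • kop (multKer (s - 3 / 2) k) v (mulOp (fun ξ => wsym (-(3 / 2)) ξ * dsym ξ) Q) -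
      kop (multKer (s - 3 / 2) k) v (kop (multKer (s - 3 / 2) k) v
        (mulOp (fun ξ => wsym (-3) ξ * (dsym ξ * dsym ξ)) Q')) := by
    simp only [accZ, accY, sub_apply, neg_apply, smul_apply, ContinuousLinearMap.comp_apply,
      neg_smul]
    abel
  rw [e5, e6, map_sub, map_smul, e1, e2, e3 (mulOp _ Q'), e4, e4]
  refine (norm_inner_le_norm _ _).trans ?_
  have n1 : ‖Pop N (kop (multKer (s - 1) k) v (mulOp (fun ξ => wsym (-1) ξ * dsym ξ) Q))‖ ≤
      c * (2 * Real.pi * ‖Q‖) :=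
    (norm_Pop_le _ _).trans ((hcT _).trans (by gcongr; exact norm_mulOp_le hb1 Q))
  have n2 : ‖Pop N (kop (multKer (s - 1) k) v (kop (multKer (s - 1) k) v
      (mulOp (fun ξ => wsym (-(5 / 2)) ξ * (dsym ξ * dsym ξ)) Q')))‖ ≤
      c * (c * ((2 * Real.pi) ^ 2 * ‖Q'‖)) :=
    (norm_Pop_le _ _).trans ((hcT _).trans (by
      gcongr
      exact (hcT _).trans (by gcongr; exact norm_mulOp_le hb2 Q')))
  have n3 : ‖-(2 : ℂ)‖ = 2 := by simp
  calc _ ≤ ‖Y‖ * (2 * (c * (2 * Real.pi * ‖Q‖)) + c * (c * ((2 * Real.pi) ^ 2 * ‖Q'‖))) := by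
        gcongr
        refine (norm_sub_le _ _).trans (add_le_add ?_ n2)
        rw [norm_smul, n3]
        gcongr
    _ ≤ _ := by
        have p1 : 0 ≤ ‖Y‖ * (2 * (c * (2 * Real.pi * ‖Q'‖))) := by positivity
        have p2 : 0 ≤ ‖Y‖ * (c * (c * ((2 * Real.pi) ^ 2 * ‖Q‖))) := by positivity
        linarith

/-- The truncated acceleration at regularity `σ = s - 1/2`. -/
lemma mulOp_cut_wsym_acc (hk : 3 ≤ k) (h1 : |s - 1 / 2| ≤ k) (h2 : |s - 3 / 2| ≤ k) (N : ℕ)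
    (v Z Y : L2) :
    -(Aop N (Aop N (mulOp (fun ξ => cut N ξ * wsym (-2) ξ) Z))) -
      (2 : ℂ) • Pop N (kop (multKer (s - 1 / 2) k) v
        (Dop N (mulOp (fun ξ => cut N ξ * wsym (-(1 / 2)) ξ) Y))) -
      Pop N (kop (multKer (s - 1 / 2) k) v (kop (multKer (s - 1 / 2) k) v
        (Dop N (Dop N (mulOp (fun ξ => cut N ξ * wsym (-2) ξ) Z))))) =
    mulOp (fun ξ => cut N ξ * wsym 1 ξ) (accZ (s - 3 / 2) k v (Pop N Z) +
      accY (s - 3 / 2) k v (Pop N Y)) := by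
  have bw2 : BddMul (wsym (-2)) 1 := bddMul_wsym (by norm_num)
  have bw1 : BddMul (wsym (-1)) 1 := bddMul_wsym (by norm_num)
  have bwh : BddMul (wsym (-(1 / 2))) 1 := bddMul_wsym (by norm_num)
  have b1 := bddMul_cut_wsym N zero_le_one
  have e1 : Aop N (Aop N (mulOp (fun ξ => cut N ξ * wsym (-2) ξ) Z)) =
      mulOp (fun ξ => cut N ξ * wsym 1 ξ)
        (mulOp (fun ξ => wsym (-3) ξ * (asym ξ * asym ξ)) (Pop N Z)) := by
    rw [Aop, Pop, mulOp_mulOp (bddMul_cut_asym N) ((bddMul_cut N).mul bw2),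
      mulOp_mulOp (bddMul_cut_asym N) ((bddMul_cut_asym N).mul ((bddMul_cut N).mul bw2)),
      mulOp_mulOp bddMul_wsym_asym_sq (bddMul_cut N),
      mulOp_mulOp b1 (bddMul_wsym_asym_sq.mul (bddMul_cut N))]
    congr 2; ext ξ
    have : wsym (-2) ξ = wsym 1 ξ * wsym (-3) ξ := by rw [wsym_mul]; norm_num
    rw [this]
    linear_combination (cut N ξ * wsym 1 ξ * wsym (-3) ξ * asym ξ * asym ξ) * cut_mul_self N ξ
  have e2 : mulOp (wsym (-1)) (Dop N (mulOp (fun ξ => cut N ξ * wsym (-(1 / 2)) ξ) Y)) =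
      mulOp (fun ξ => wsym (-(3 / 2)) ξ * dsym ξ) (Pop N Y) := by
    rw [Dop, Pop, mulOp_mulOp (bddMul_cut_dsym N) ((bddMul_cut N).mul bwh),
      mulOp_mulOp bw1 ((bddMul_cut_dsym N).mul ((bddMul_cut N).mul bwh)),
      mulOp_mulOp bddMul_wsym_dsym (bddMul_cut N)]
    congr 2; ext ξ
    have : wsym (-(3 / 2)) ξ = wsym (-1) ξ * wsym (-(1 / 2)) ξ := by rw [wsym_mul]; norm_num
    rw [this]
    linear_combination (wsym (-1) ξ * wsym (-(1 / 2)) ξ * dsym ξ) * cut_mul_self N ξ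
  have e3 : mulOp (wsym (-1)) (Dop N (Dop N (mulOp (fun ξ => cut N ξ * wsym (-2) ξ) Z))) =
      mulOp (fun ξ => wsym (-3) ξ * (dsym ξ * dsym ξ)) (Pop N Z) := by
    rw [Dop, Pop, mulOp_mulOp (bddMul_cut_dsym N) ((bddMul_cut N).mul bw2),
      mulOp_mulOp (bddMul_cut_dsym N) ((bddMul_cut_dsym N).mul ((bddMul_cut N).mul bw2)),
      mulOp_mulOp bw1 ((bddMul_cut_dsym N).mul ((bddMul_cut_dsym N).mul ((bddMul_cut N).mul bw2))),
      mulOp_mulOp bddMul_wsym_dsym_sq (bddMul_cut N)]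
    congr 2; ext ξ
    have : wsym (-3) ξ = wsym (-1) ξ * wsym (-2) ξ := by rw [wsym_mul]; norm_num
    rw [this]
    linear_combination (wsym (-1) ξ * wsym (-2) ξ * dsym ξ * dsym ξ) * (1 + cut N ξ) *
      cut_mul_self N ξ
  have hs : s - 1 / 2 = s - 3 / 2 + 1 := by ring
  have hs' : s - 3 / 2 = s - 1 / 2 + -1 := by ring
  have e4 : ∀ h, Pop N (kop (multKer (s - 1 / 2) k) v h) = mulOp (fun ξ => cut N ξ * wsym 1 ξ)
      (kop (multKer (s - 3 / 2) k) v (mulOp (wsym (-1)) h)) := fun h => by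
    rw [hs] at h1 ⊢
    exact (mulOp_cut_wsym_kop hk h2 h1 zero_le_one N v h).symm
  have e5 : ∀ h, mulOp (wsym (-1)) (kop (multKer (s - 1 / 2) k) v h) =
      kop (multKer (s - 3 / 2) k) v (mulOp (wsym (-1)) h) := fun h => by
    rw [hs'] at h2 ⊢
    exact mulOp_wsym_kop hk h1 h2 (by norm_num) v h
  rw [e1, e4, e2, e4, e5, e3]
  simp only [accZ, accY, sub_apply, neg_apply, smul_apply, ContinuousLinearMap.comp_apply,
    map_add, map_sub, map_neg, map_smul]
  abel

end Remainder

lemma intervalIntegrable_clm_apply {L : ℝ → L2 →L[ℂ] L2} (hL : Continuous L) {f : ℝ → L2} {B : ℝ}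
    (hf : AEStronglyMeasurable f) (hB : ∀ᵐ t, ‖f t‖ ≤ B) (a b : ℝ) :
    IntervalIntegrable (fun t => L t (f t)) volume a b := by
  rw [intervalIntegrable_iff]
  obtain ⟨C, hC⟩ := (isCompact_uIcc (a := a) (b := b)).exists_bound_of_continuousOn hL.continuousOn
  refine Measure.integrableOn_of_bounded (M := C * B) (by simp) ?_ ?_
  · exact (ContinuousLinearMap.id ℂ (L2 →L[ℂ] L2)).aestronglyMeasurable_comp₂
      hL.aestronglyMeasurable hf
  · refine (ae_restrict_iff' measurableSet_uIoc).2 (hB.mono fun t ht hts => ?_)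
    exact (L t).le_of_opNorm_le_of_le (hC t (uIoc_subset_uIcc hts)) ht

/-- The truncations `x N`, `y N` of a solution with zero data and no force satisfy the Galerkin
equation at level `s - 1/2` up to an error. Paired with the velocity, this error is bounded by `‖Y -
P_N Y‖ + ‖Z - P_N Z‖`, whose time integral tends to zero by dominated convergence. The energy
estimate then makes the energy vanish in the limit. -/
theorem eq_zero_of_weak {s k : ℝ} (hk : 3 ≤ k) (h0 : |s - 1 / 2| ≤ k - 1) (h1 : |s - 1| ≤ k)
    (h2 : |s - 3 / 2| ≤ k) {T b b' B : ℝ} (hT : 0 ≤ T) (hb : 0 ≤ b) (hb' : 0 ≤ b') {v v' : ℝ → L2}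
    (hv : Coeff T b b' v v') {Z Y : ℝ → L2} (hZm : AEStronglyMeasurable Z)
    (hYm : AEStronglyMeasurable Y) (hZb : ∀ᵐ t, ‖Z t‖ ≤ B) (hYb : ∀ᵐ t, ‖Y t‖ ≤ B)
    (hZ : ∀ᵐ t, t ∈ Icc 0 T → ell (Z t) = ∫ τ in (0 : ℝ)..t, Y τ)
    (hY : ∀ᵐ t, t ∈ Icc 0 T → ell (Y t) = ∫ τ in (0 : ℝ)..t,
      (accZ (s - 3 / 2) k (v τ) (Z τ) + accY (s - 3 / 2) k (v τ) (Y τ))) :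
    ∀ᵐ t, t ∈ Icc 0 T → Z t = 0 ∧ Y t = 0 := by
  obtain ⟨c, hc, H⟩ := exists_energyOps hk h0
  obtain ⟨C, hC0, hC⟩ := exists_remainder_bound (s := s) hk h1 h2 b
  have hB0 : 0 ≤ B := by
    obtain ⟨t, ht⟩ := hZb.exists
    exact (norm_nonneg _).trans ht
  set g : ℝ → L2 := fun τ => accZ (s - 3 / 2) k (v τ) (Z τ) + accY (s - 3 / 2) k (v τ) (Y τ) with hg
  have hgi : ∀ a t, IntervalIntegrable g volume a t := fun a t =>
    (intervalIntegrable_clm_apply (continuous_accZ hv.continuous) hZm hZb a t).add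
      (intervalIntegrable_clm_apply (continuous_accY hv.continuous) hYm hYb a t)
  have hYi : ∀ (L : L2 →L[ℂ] L2) a t, IntervalIntegrable (fun τ => L (Y τ)) volume a t :=
    fun L a t => intervalIntegrable_clm_apply continuous_const hYm hYb a t
  have hYi' : ∀ a t, IntervalIntegrable Y volume a t := hYi (ContinuousLinearMap.id ℂ L2)
  have hcomm : ∀ (L : L2 →L[ℂ] L2) {f : ℝ → L2} (t : ℝ), IntervalIntegrable f volume 0 t →
      ∫ τ in (0 : ℝ)..t, L (f τ) = L (∫ τ in (0 : ℝ)..t, f τ) := fun L f t hf =>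
    (L.restrictScalars ℝ).intervalIntegral_comp_comm hf
  have bwh : BddMul (wsym (-(1 / 2))) 1 := bddMul_wsym (by norm_num)
  have bw2 : BddMul (wsym (-2)) 1 := bddMul_wsym (by norm_num)
  have bw32 : BddMul (wsym (-(3 / 2))) 1 := bddMul_wsym (by norm_num)
  let p : ℕ → L2 →L[ℂ] L2 := fun N => mulOp fun ξ => cut N ξ * wsym 1 ξ
  let q : ℕ → L2 →L[ℂ] L2 := fun N => mulOp fun ξ => cut N ξ * wsym (-(1 / 2)) ξ
  -- Defined through the integrated equation, so that it is continuous for all times; it coincides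
  -- with the truncation of `Y` only almost everywhere on `[0,T]`. Here `p N` lifts from level `s -
  -- 3/2`, and `q N` lowers from level `s`, to `s - 1/2`.
  let y : ℕ → ℝ → L2 := fun N t => p N (∫ τ in (0 : ℝ)..t, g τ)
  have hyc : ∀ N, Continuous (y N) := fun N =>
    (p N).continuous.comp (intervalIntegral.continuous_primitive hgi 0)
  let x : ℕ → ℝ → L2 := fun N t => ∫ τ in (0 : ℝ)..t, y N τ
  have hx : ∀ N t, HasDerivAt (x N) (y N t) t := fun N t =>
    ((hyc N).integral_hasStrictDerivAt 0 t).hasDerivAt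
  have hpell : ∀ N f, p N (ell f) = q N f := fun N f => by
    simp only [p, q, ell]
    rw [mulOp_mulOp (bddMul_cut_wsym N zero_le_one) bw32]
    simp only [mul_assoc, wsym_mul]; norm_num
  have hqell : ∀ N f, q N (ell f) = mulOp (fun ξ => cut N ξ * wsym (-2) ξ) f := fun N f => by
    simp only [q, ell]
    rw [mulOp_mulOp ((bddMul_cut N).mul bwh) bw32]
    simp only [mul_assoc, wsym_mul]; norm_num
  have hyY : ∀ N, ∀ᵐ t, t ∈ Icc 0 T → y N t = q N (Y t) := fun N => hY.mono fun t ht hts => by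
    simp only [y]; rw [← ht hts, hpell]
  have hxX : ∀ N, ∀ t ∈ Icc 0 T, x N t = q N (∫ τ in (0 : ℝ)..t, Y τ) := fun N t ht => by
    rw [← hcomm _ _ (hYi' _ _)]
    refine intervalIntegral.integral_congr_ae ((hyY N).mono fun τ hτ hts => hτ ?_)
    rw [uIoc_of_le ht.1] at hts
    exact ⟨hts.1.le, hts.2.trans ht.2⟩
  have hxZ : ∀ N, ∀ᵐ t, t ∈ Icc 0 T → x N t = mulOp (fun ξ => cut N ξ * wsym (-2) ξ) (Z t) :=
    fun N => hZ.mono fun t ht hts => by rw [hxX N t hts, ← ht hts, hqell]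
  let G : ℕ → ℝ → L2 := fun N τ => -(Aop N (Aop N (x N τ))) -
    (2 : ℂ) • Pop N (kop (multKer (s - 1 / 2) k) (v τ) (Dop N (y N τ))) -
    Pop N (kop (multKer (s - 1 / 2) k) (v τ) (kop (multKer (s - 1 / 2) k) (v τ)
      (Dop N (Dop N (x N τ)))))
  have hGc : ∀ N, Continuous (G N) := fun N => by
    have hvc := hv.continuous
    have h3 := hyc N
    have h4 : Continuous (x N) := continuous_iff_continuousAt.2 fun t => (hx N t).continuousAt
    simp only [G]; fun_prop
  have hpg : ∀ N a t, IntervalIntegrable (fun τ => p N (g τ)) volume a t := fun N a t =>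
    ⟨(p N).integrable_comp (hgi a t).1, (p N).integrable_comp (hgi a t).2⟩
  -- Twice the remainder bound, with `‖Y‖` replaced by its essential bound `B`.
  let ρ : ℕ → ℝ → ℝ := fun N τ => 2 * (C * B) * (‖Y τ - Pop N (Y τ)‖ + ‖Z τ - Pop N (Z τ)‖)
  have hPm : ∀ N {f : ℝ → L2}, AEStronglyMeasurable f →
      AEStronglyMeasurable fun τ => ‖f τ - Pop N (f τ)‖ := fun N f hf =>
    (hf.sub ((Pop N).continuous.comp_aestronglyMeasurable hf)).norm
  have hPb : ∀ N (f : L2), ‖f - Pop N f‖ ≤ 2 * ‖f‖ := fun N f =>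
    (norm_sub_le _ _).trans (by linarith [norm_Pop_le N f])
  have hρm : ∀ N, AEStronglyMeasurable (ρ N) := fun N =>
    ((hPm N hYm).add (hPm N hZm)).const_mul _
  have hρb : ∀ N, ∀ᵐ t, ‖ρ N t‖ ≤ 2 * (C * B) * (2 * B + 2 * B) := fun N => by
    filter_upwards [hZb, hYb] with t h3 h4
    rw [Real.norm_of_nonneg (by positivity)]
    simp only [ρ]
    gcongr
    · exact (hPb N _).trans (by gcongr)
    · exact (hPb N _).trans (by gcongr)
  have hρi : ∀ N, IntervalIntegrable (ρ N) volume 0 T := fun N => by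
    rw [intervalIntegrable_iff]
    exact Measure.integrableOn_of_bounded (by simp) (hρm N) (ae_restrict_of_ae (hρb N))
  have hρlim : Tendsto (fun N => ∫ τ in (0 : ℝ)..T, ρ N τ) atTop (𝓝 0) := by
    have h3 := intervalIntegral.tendsto_integral_filter_of_dominated_convergence
      (μ := volume) (a := 0) (b := T) (F := ρ) (f := fun _ => 0) (l := atTop)
      (fun _ => 2 * (C * B) * (2 * B + 2 * B)) (Eventually.of_forall fun N => (hρm N).restrict)
      (Eventually.of_forall fun N => (hρb N).mono fun t ht _ => ht) (by simp)
      (ae_of_all _ fun t _ => by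
        have h5 : ∀ f : L2, Tendsto (fun N => ‖f - Pop N f‖) atTop (𝓝 0) := fun f => by
          have := (tendsto_iff_norm_sub_tendsto_zero.1 (tendsto_Pop f))
          simpa only [norm_sub_rev] using this
        simpa using ((h5 (Y t)).add (h5 (Z t))).const_mul (2 * (C * B)))
    simpa using h3
  have hE : ∀ N, ∀ t ∈ Icc 0 T, stateSq (Aop N) (x N t) (y N t) ≤
      2 * Real.exp (energyRate (c * b) (c * b') * T) * ∫ τ in (0 : ℝ)..T, ρ N τ := fun N t ht => by
    have h3 := energy_estimate (H T b b' v v' hb hb' hv N) hT (hyc N) (hx N)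
      (r := fun τ => p N (g τ) - G N τ) ((hpg N 0 T).sub ((hGc N).intervalIntegrable _ _))
      (fun t _ => by
        simp only [y, p]
        rw [Pop, mulOp_mulOp (bddMul_cut N) (bddMul_cut_wsym N zero_le_one)]
        simp only [← mul_assoc, cut_mul_self]) (fun t ht => by
        have e0 : y N 0 = 0 := by simp [y]
        have e1 : ∀ τ, -(Aop N (Aop N (x N τ))) -
          (2 : ℂ) • Pop N (kop (multKer (s - 1 / 2) k) (v τ) (Dop N (y N τ))) -
          Pop N (kop (multKer (s - 1 / 2) k) (v τ) (kop (multKer (s - 1 / 2) k) (v τ)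
            (Dop N (Dop N (x N τ))))) + (p N (g τ) - G N τ) = p N (g τ) := fun τ => by
          simp only [G]; abel
        simp only [e0, e1, zero_add]
        exact (hcomm _ _ (hgi 0 t)).symm) (hρi N) (fun τ => by positivity) ?_ t ht
    · have e0 : stateSq (Aop N) (x N 0) (y N 0) = 0 := by simp [stateSq, x, y]
      rwa [e0, mul_zero, zero_add] at h3
    · filter_upwards [hyY N, hxZ N, hYb] with τ h4 h5 h6 hτ
      -- The Galerkin term is the truncated acceleration of `P_N Z`, `P_N Y`, so the error is that
      -- of the high frequencies. The dispersive multiplier may be added freely, as the truncation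
      -- annihilates its value on `Z - P_N Z`; this puts the error in the form of
      -- `exists_remainder_bound`.
      have e1 : p N (g τ) - G N τ = p N (accZ (s - 3 / 2) k (v τ) (Z τ - Pop N (Z τ)) +
          accY (s - 3 / 2) k (v τ) (Y τ - Pop N (Y τ)) +
          mulOp (fun ξ => wsym (-3) ξ * (asym ξ * asym ξ)) (Z τ - Pop N (Z τ))) := by
        have e2 : p N (mulOp (fun ξ => wsym (-3) ξ * (asym ξ * asym ξ)) (Z τ - Pop N (Z τ))) = 0 := by
          simp only [p, Pop, map_sub]
          rw [mulOp_mulOp bddMul_wsym_asym_sq (bddMul_cut N),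
            mulOp_mulOp (bddMul_cut_wsym N zero_le_one) (bddMul_wsym_asym_sq.mul (bddMul_cut N)),
            mulOp_mulOp (bddMul_cut_wsym N zero_le_one) bddMul_wsym_asym_sq, sub_eq_zero]
          congr 2; ext ξ
          linear_combination (-(wsym 1 ξ * wsym (-3) ξ * asym ξ * asym ξ)) * cut_mul_self N ξ
        have e3 : G N τ = p N (accZ (s - 3 / 2) k (v τ) (Pop N (Z τ)) +
            accY (s - 3 / 2) k (v τ) (Pop N (Y τ))) := by
          simp only [G]
          rw [h4 hτ, h5 hτ]
          exact mulOp_cut_wsym_acc hk (h0.trans (by linarith)) h2 N (v τ) (Z τ) (Y τ)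
        rw [map_add (p N) _ (mulOp _ _), e2, e3, add_zero, ← map_sub]
        congr 1
        simp only [hg, map_sub]
        abel
      have h7 := hC N (v τ) (Y τ) (Y τ - Pop N (Y τ)) (Z τ - Pop N (Z τ)) (hv.bound τ hτ)
      have h8 : (⟪y N τ, p N (g τ) - G N τ⟫_ℂ).re ≤
          C * B * (‖Y τ - Pop N (Y τ)‖ + ‖Z τ - Pop N (Z τ)‖) := by
        rw [h4 hτ, e1]
        refine (Complex.re_le_norm _).trans (h7.trans ?_)
        gcongr
      have h9 : 0 ≤ stateSq (Aop N) (x N τ) (y N τ) := by unfold stateSq; positivity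
      simp only [ρ]
      linarith
  have hlim0 : ∀ t ∈ Icc 0 T, Tendsto (fun N => stateSq (Aop N) (x N t) (y N t)) atTop (𝓝 0) :=
    fun t ht => squeeze_zero (fun N => by unfold stateSq; positivity) (fun N => hE N t ht) (by
      simpa using hρlim.const_mul (2 * Real.exp (energyRate (c * b) (c * b') * T)))
  -- The truncations converge strongly to the function with a negative Bessel weight, which is
  -- therefore zero; the weight is injective.
  have hzero : ∀ {c : ℝ}, c ≤ 0 → ∀ (z : ℕ → L2) (f : L2),
      Tendsto (fun N => ‖z N‖ ^ 2) atTop (𝓝 0) →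
      (∀ N, z N = mulOp (fun ξ => cut N ξ * wsym c ξ) f) → f = 0 := fun {c} hc z f hz hzf => by
    have e1 : ∀ N, z N = Pop N (mulOp (wsym c) f) := fun N => by
      rw [hzf, Pop, mulOp_mulOp (bddMul_cut N) (bddMul_wsym hc)]
    have h3 : Tendsto z atTop (𝓝 0) := by
      rw [tendsto_zero_iff_norm_tendsto_zero]
      simpa [Real.sqrt_sq (norm_nonneg _)] using hz.sqrt
    have h4 := tendsto_nhds_unique h3 ((tendsto_Pop (mulOp (wsym c) f)).congr fun N => (e1 N).symm)
    exact mulOp_wsym_injective hc (by rw [← h4, map_zero])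
  filter_upwards [ae_all_iff.2 hyY, ae_all_iff.2 hxZ] with t h3 h4 ht
  refine ⟨hzero (c := -2) (by norm_num) (fun N => x N t) _ ?_ fun N => h4 N ht,
    hzero (c := -(1 / 2)) (by norm_num) (fun N => y N t) _ ?_ fun N => h3 N ht⟩
  · exact squeeze_zero (fun N => by positivity) (fun N => by
      unfold stateSq
      nlinarith [sq_nonneg ‖Aop N (x N t)‖, sq_nonneg ‖y N t‖]) (hlim0 t ht)
  · exact squeeze_zero (fun N => by positivity) (fun N => by
      unfold stateSq
      nlinarith [sq_nonneg ‖Aop N (x N t)‖, sq_nonneg ‖x N t‖]) (hlim0 t ht)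

/-! ### Sobolev distributions as weighted `L²` functions -/

lemma wsym_eq (c ξ : ℝ) : wsym c ξ = (((1 + ‖ξ‖ ^ 2) ^ (c / 2) : ℝ) : ℂ) := by
  rw [wsym, jb, Real.sqrt_eq_rpow, ← Real.rpow_mul (by positivity), Real.norm_eq_abs, sq_abs]
  ring_nf

@[fun_prop]
lemma hasTemperateGrowth_wsym (c : ℝ) : (wsym c).HasTemperateGrowth := by
  have : wsym c = fun ξ => (((1 + ‖ξ‖ ^ 2) ^ (c / 2) : ℝ) : ℂ) := funext (wsym_eq c)
  rw [this]; fun_prop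

@[fun_prop]
lemma hasTemperateGrowth_dsym : dsym.HasTemperateGrowth := by unfold dsym; fun_prop

/-- The distribution `⟨D⟩^{-a} 𝓕⁻ g`, which is in `H^a`. -/
def toDist (a : ℝ) (g : L2) : 𝓢'(ℝ, ℂ) :=
  besselPotential ℝ ℂ (-a) ((𝓕⁻ g : L2) : 𝓢'(ℝ, ℂ))

/-- The Schwartz function `⟨ξ⟩^{-a} 𝓕⁻ φ`. -/
def testSchwartz (a : ℝ) (φ : 𝓢(ℝ, ℂ)) : 𝓢(ℝ, ℂ) := SchwartzMap.smulLeftCLM ℂ (wsym (-a)) (𝓕⁻ φ)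

lemma testSchwartz_apply (a : ℝ) (φ : 𝓢(ℝ, ℂ)) (ξ : ℝ) :
    testSchwartz a φ ξ = wsym (-a) ξ * (𝓕⁻ φ) ξ := by
  rw [testSchwartz, SchwartzMap.smulLeftCLM_apply_apply (by fun_prop), smul_eq_mul]

/-- The `L²` function with which `⟨D⟩^a f` is paired to give `f φ`. -/
def testL2 (a : ℝ) (φ : 𝓢(ℝ, ℂ)) : L2 := star ((testSchwartz a φ).toLp 2)

lemma testL2_ae_eq (a : ℝ) (φ : 𝓢(ℝ, ℂ)) :
    testL2 a φ =ᵐ[volume] fun ξ => conj (wsym (-a) ξ * (𝓕⁻ φ) ξ) := by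
  filter_upwards [Lp.coeFn_star ((testSchwartz a φ).toLp 2 (volume : Measure ℝ)),
    (testSchwartz a φ).coeFn_toLp 2 (volume : Measure ℝ)] with ξ h1 h2
  rw [testL2, h1, Pi.star_apply, h2, testSchwartz_apply]; rfl

lemma inner_eq_of_ae {θ : L2} {m : ℝ → ℂ} (h : θ =ᵐ[volume] fun ξ => conj (m ξ)) (g : L2) :
    ⟪θ, g⟫_ℂ = ∫ ξ, m ξ * g ξ := by
  rw [inner_eq_integral]
  refine integral_congr_ae ?_
  filter_upwards [h] with ξ hξ
  rw [hξ, Complex.conj_conj]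

lemma fourierInv_L2_apply_fourier (g : L2) (ψ : 𝓢(ℝ, ℂ)) :
    ((𝓕⁻ g : L2) : 𝓢'(ℝ, ℂ)) (𝓕 ψ) = ∫ ξ, ψ ξ * g ξ := by
  rw [← Lp.fourierInv_toTemperedDistribution_eq, fourierInv_apply, fourierInv_fourier_eq,
    Lp.toTemperedDistribution_apply]
  simp only [smul_eq_mul]

lemma toDist_apply (a : ℝ) (g : L2) (φ : 𝓢(ℝ, ℂ)) : toDist a g φ = ⟪testL2 a φ, g⟫_ℂ := by
  rw [inner_eq_of_ae (testL2_ae_eq a φ), toDist, besselPotential,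
    TemperedDistribution.fourierMultiplierCLM_apply_apply]
  have e : (fun x : ℝ => (((1 + ‖x‖ ^ 2) ^ (-a / 2) : ℝ) : ℂ)) = wsym (-a) :=
    funext fun ξ => (wsym_eq (-a) ξ).symm
  have := fourierInv_L2_apply_fourier g (testSchwartz a φ)
  simp only [testSchwartz_apply] at this
  rw [← this]
  congr 1
  rw [testSchwartz, ← e]

/-- Plancherel, together with uniqueness of the `L²` representative, which reduces the infimum to
one term. -/
lemma sobolevNorm_toDist (a : ℝ) (g : L2) : sobolevNorm a (toDist a g) = ‖g‖ₑ := by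
  have h0 : besselPotential ℝ ℂ a (toDist a g) = ((𝓕⁻ g : L2) : 𝓢'(ℝ, ℂ)) := by
    rw [toDist, besselPotential_besselPotential_apply, neg_add_cancel, besselPotential_zero]; rfl
  have hn : ‖(𝓕⁻ g : L2)‖ₑ = ‖g‖ₑ := by
    rw [← ofReal_norm, ← ofReal_norm, ← Lp.norm_fourier_eq (𝓕⁻ g : L2), fourier_fourierInv_eq]
  rw [sobolevNorm, h0]
  refine le_antisymm (iInf₂_le_of_le (𝓕⁻ g : L2) rfl hn.le) (le_iInf₂ fun f hf => ?_)
  have hk := LinearMap.ker_eq_bot.1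
    (Lp.ker_toTemperedDistributionCLM_eq_bot (F := ℂ) (μ := (volume : Measure ℝ)) (p := 2))
  have : (𝓕⁻ g : L2) = f := hk hf
  rw [← this, hn]

lemma exists_eq_toDist {a : ℝ} {f : 𝓢'(ℝ, ℂ)} (hf : MemSobolev a 2 f) : ∃ g, f = toDist a g := by
  obtain ⟨h, hh⟩ := hf
  refine ⟨𝓕 h, ?_⟩
  rw [toDist, fourierInv_fourier_eq, ← hh, besselPotential_besselPotential_apply, add_neg_cancel,
    besselPotential_zero]
  rfl

lemma exists_eq_toDist_of_sobolevNorm {a : ℝ} {f : 𝓢'(ℝ, ℂ)} (hf : sobolevNorm a f < ∞) :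
    ∃ g, f = toDist a g := by
  refine exists_eq_toDist ?_
  by_contra h
  refine hf.ne ?_
  rw [sobolevNorm]
  simp only [iInf_eq_top]
  exact fun g hg => (h ⟨g, hg⟩).elim

lemma continuous_star_L2 : Continuous (star : L2 → L2) := by
  refine (Isometry.of_dist_eq fun f g => ?_).continuous
  rw [Lp.dist_def, Lp.dist_def]
  congr 1
  refine eLpNorm_congr_norm_ae ?_
  filter_upwards [Lp.coeFn_star f, Lp.coeFn_star g] with x h5 h6
  rw [Pi.sub_apply, Pi.sub_apply, h5, h6, Pi.star_apply, Pi.star_apply, ← star_sub, norm_star]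

/-- Inverse Fourier transform, weight and conjugation are bijective, so density is that of Schwartz
functions in `L²`. -/
lemma denseRange_testL2 (a : ℝ) : DenseRange (testL2 a) := by
  have h1 : DenseRange fun ψ : 𝓢(ℝ, ℂ) => ψ.toLp 2 (volume : Measure ℝ) :=
    SchwartzMap.denseRange_toLpCLM (p := 2) (by simp)
  have h2 : Function.Surjective (testSchwartz a) := fun ψ => by
    refine ⟨𝓕 (SchwartzMap.smulLeftCLM ℂ (wsym a) ψ), ?_⟩
    ext ξ
    rw [testSchwartz_apply, fourierInv_fourier_eq, SchwartzMap.smulLeftCLM_apply_apply (by fun_prop),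
      smul_eq_mul, ← mul_assoc, wsym_mul, neg_add_cancel, wsym_zero, one_mul]
  have h3 : Function.Surjective (star : L2 → L2) := fun f => ⟨star f, star_star f⟩
  have h5 : DenseRange fun φ => (testSchwartz a φ).toLp 2 (volume : Measure ℝ) := by
    have := h2.range_comp fun ψ : 𝓢(ℝ, ℂ) => ψ.toLp 2 (volume : Measure ℝ)
    rw [DenseRange]
    change Dense (range ((fun ψ : 𝓢(ℝ, ℂ) => ψ.toLp 2 (volume : Measure ℝ)) ∘ testSchwartz a))
    rw [this]
    exact h1
  exact h3.denseRange.comp h5 continuous_star_L2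

lemma ell_testL2 (a : ℝ) (φ : 𝓢(ℝ, ℂ)) : ell (testL2 a φ) = testL2 (a + 3 / 2) φ := by
  refine Lp.ext ?_
  filter_upwards [mulOp_ae_eq (bddMul_wsym (c := -(3 / 2)) (by norm_num)) (testL2 a φ),
    testL2_ae_eq a φ, testL2_ae_eq (a + 3 / 2) φ] with ξ h1 h2 h3
  rw [ell, h1, h2, h3, map_mul, map_mul, conj_wsym, conj_wsym, ← mul_assoc, wsym_mul]
  congr 2; ring

lemma ext_testL2 {a : ℝ} {f g : L2} (h : ∀ φ, ⟪testL2 a φ, f⟫_ℂ = ⟪testL2 a φ, g⟫_ℂ) : f = g := by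
  refine ext_inner_left ℂ fun θ => ?_
  exact congrFun ((denseRange_testL2 a).equalizer (by fun_prop : Continuous fun θ => ⟪θ, f⟫_ℂ)
    (by fun_prop : Continuous fun θ => ⟪θ, g⟫_ℂ) (funext h)) θ

/-! ### Fourier transforms as functions -/

section Density

lemma schwartz_integrable_mul {g : L2} (φ : 𝓢(ℝ, ℂ)) : Integrable fun ξ => g ξ * φ ξ := by
  have h := integrable_mul_conj_L2 (star (φ.toLp 2)) g
  refine h.congr ?_
  filter_upwards [Lp.coeFn_star (φ.toLp 2 (volume : Measure ℝ)),
    φ.coeFn_toLp 2 (volume : Measure ℝ)] with ξ h1 h2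
  rw [h1, Pi.star_apply, h2, mul_comm]
  simp

/-- A function integrable against Schwartz functions is determined by its integrals. -/
lemma ae_eq_of_forall_integral_schwartz {g g' : ℝ → ℂ}
    (hg : ∀ φ : 𝓢(ℝ, ℂ), Integrable fun ξ => g ξ * φ ξ)
    (hg' : ∀ φ : 𝓢(ℝ, ℂ), Integrable fun ξ => g' ξ * φ ξ)
    (h : ∀ φ : 𝓢(ℝ, ℂ), ∫ ξ, g ξ * φ ξ = ∫ ξ, g' ξ * φ ξ) : g =ᵐ[volume] g' := by
  have hloc : ∀ {g : ℝ → ℂ}, (∀ φ : 𝓢(ℝ, ℂ), Integrable fun ξ => g ξ * φ ξ) →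
      LocallyIntegrable g := fun {g} hg x => by
    -- Integrability against a bump equal to `1` near `x` gives local integrability.
    let b : ContDiffBump x := ⟨1, 2, one_pos, one_lt_two⟩
    have hb1 : HasCompactSupport (Complex.ofRealCLM ∘ b) := b.hasCompactSupport.comp_left rfl
    have hb2 : ContDiff ℝ (⊤ : ℕ∞) (Complex.ofRealCLM ∘ b) := Complex.ofRealCLM.contDiff.comp b.contDiff
    refine ⟨Metric.closedBall x 1, Metric.closedBall_mem_nhds x one_pos, ?_⟩
    refine (hg (hb1.toSchwartzMap hb2)).integrableOn.congr_fun (fun ξ hξ => ?_)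
      Metric.isClosed_closedBall.measurableSet
    have : b ξ = 1 := b.one_of_mem_closedBall hξ
    simp [this]
  refine ae_eq_of_integral_contDiff_smul_eq (hloc hg) (hloc hg') fun b hb hc => ?_
  have hb1 : HasCompactSupport (Complex.ofRealCLM ∘ b) := hc.comp_left rfl
  have hb2 : ContDiff ℝ (⊤ : ℕ∞) (Complex.ofRealCLM ∘ b) := Complex.ofRealCLM.contDiff.comp hb
  have := h (hb1.toSchwartzMap hb2)
  simpa [mul_comm] using this

/-- The density obtained by choice may be replaced, under integrals, by any explicit one. -/
lemma IsFourierDensity.ae_eq {f : 𝓢'(ℝ, ℂ)} {g : ℝ → ℂ} (hg : IsFourierDensity f g) :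
    fourierDensity f =ᵐ[volume] g := by
  have h : ∃ g, IsFourierDensity f g := ⟨g, hg⟩
  rw [fourierDensity, dif_pos h]
  exact ae_eq_of_forall_integral_schwartz (fun φ => (h.choose_spec φ).1) (fun φ => (hg φ).1)
    fun φ => by rw [← (h.choose_spec φ).2, (hg φ).2]

lemma isFourierDensity_toDist (a : ℝ) (g : L2) :
    IsFourierDensity (toDist a g) fun ξ => wsym (-a) ξ * g ξ := fun φ => by
  have e : ∀ ξ, wsym (-a) ξ * g ξ * φ ξ = g ξ * SchwartzMap.smulLeftCLM ℂ (wsym (-a)) φ ξ :=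
    fun ξ => by
      rw [SchwartzMap.smulLeftCLM_apply_apply (by fun_prop), smul_eq_mul]; ring
  refine ⟨by simp only [e]; exact schwartz_integrable_mul _, ?_⟩
  rw [TemperedDistribution.fourier_apply, toDist_apply, inner_eq_of_ae (testL2_ae_eq a _), fourierInv_fourier_eq]
  congr 1; ext ξ; ring

/-- The minus sign of the distributional derivative cancels the one in the derivative of a Fourier
transform. -/
lemma IsFourierDensity.deriv {f : 𝓢'(ℝ, ℂ)} {g : ℝ → ℂ} (hg : IsFourierDensity f g) :
    IsFourierDensity (dα f) fun ξ => dsym ξ * g ξ := fun φ => by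
  have e : ∀ ξ, dsym ξ * g ξ * φ ξ = g ξ * SchwartzMap.smulLeftCLM ℂ dsym φ ξ := fun ξ => by
    rw [SchwartzMap.smulLeftCLM_apply_apply (by fun_prop), smul_eq_mul]; ring
  simp only [e]
  refine ⟨(hg _).1, ?_⟩
  rw [← (hg _).2, TemperedDistribution.fourier_apply, TemperedDistribution.fourier_apply,
    derivCLM_apply_apply]
  congr 1
  have h := SchwartzMap.lineDerivOp_fourier_eq φ (1 : ℝ)
  have h1 : -(2 * Real.pi * Complex.I) • SchwartzMap.smulLeftCLM ℂ (inner ℝ · (1 : ℝ)) φ =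
      -SchwartzMap.smulLeftCLM ℂ dsym φ := by
    ext ξ
    rw [neg_apply, smul_apply,
      SchwartzMap.smulLeftCLM_apply_apply (by fun_prop),
      SchwartzMap.smulLeftCLM_apply_apply (by fun_prop)]
    simp [dsym]; ring
  rw [h1, FourierTransform.fourier_neg] at h
  rw [← neg_eq_iff_eq_neg.2 h]
  ext ξ
  rfl

end Density

/-! ### Multiplication by `V` as a convolution -/

section Product

lemma fourierInv_flip {f g : ℝ → ℂ} (hf : Integrable f) (hg : Integrable g) :
    ∫ ξ, (𝓕⁻ f) ξ * g ξ = ∫ x, f x * (𝓕⁻ g) x := by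
  have h := VectorFourier.integral_fourierIntegral_smul_eq_flip (μ := (volume : Measure ℝ))
    (ν := (volume : Measure ℝ)) (L := -innerₗ ℝ) (e := Real.fourierChar)
    Real.continuous_fourierChar (by
      exact (continuous_inner (𝕜 := ℝ) (E := ℝ)).neg) hf hg
  have e : (-innerₗ ℝ).flip = -innerₗ ℝ := by ext; simp
  simp only [smul_eq_mul, e] at h
  exact h

/-- Convolution with the reflected Fourier transform `⟨·⟩^{-k} v` of a multiplier. -/
def convOp (k : ℝ) (v : L2) (ψ : ℝ → ℂ) (ξ : ℝ) : ℂ := ∫ ζ, wsym (-k) ζ * v ζ * ψ (ξ + ζ)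

/-- Cauchy–Schwarz, as `⟨·⟩^{-k}` is in `L²`. Hence `V` agrees almost everywhere with a bounded
continuous function. -/
lemma integrable_wsym_mul {k : ℝ} (hk : 1 ≤ k) (v : L2) : Integrable fun ζ => wsym (-k) ζ * v ζ := by
  have h : MemLp (wsym (-k)) 2 (volume : Measure ℝ) := by
    rw [memLp_two_iff_integrable_sq_norm (by fun_prop)]
    refine integrable_inv_one_add_sq.mono' (by fun_prop) (ae_of_all _ fun ξ => ?_)
    rw [Real.norm_of_nonneg (by positivity), norm_wsym, ← Real.rpow_natCast (jb ξ ^ _),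
      ← Real.rpow_mul (jb_pos ξ).le, ← jb_sq, ← Real.rpow_natCast, ← Real.rpow_neg (jb_pos ξ).le]
    refine Real.rpow_le_rpow_of_exponent_le (one_le_jb ξ) ?_
    push_cast
    linarith
  exact h.integrable_mul (Lp.memLp v)

/-- The inverse Fourier transform of a product. -/
lemma fourierInv_mul {h ψ : ℝ → ℂ} (hh : Integrable h) (hψ : Integrable ψ) (ξ : ℝ) :
    (𝓕⁻ fun x => (𝓕⁻ h) x * ψ x) ξ = ∫ ζ, h ζ * (𝓕⁻ ψ) (ξ + ζ) := by
  have h1 : Integrable fun x => Complex.exp ((2 * Real.pi * (x * ξ) : ℝ) * Complex.I) * ψ x := by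
    refine hψ.bdd_mul (c := 1) (Continuous.aestronglyMeasurable (by fun_prop))
      (ae_of_all _ fun x => ?_)
    rw [Complex.norm_exp_ofReal_mul_I]
  have h2 := fourierInv_flip hh h1
  rw [Real.fourierInv_eq']
  refine Eq.trans (integral_congr_ae (ae_of_all _ fun x => ?_)) (h2.trans
    (integral_congr_ae (ae_of_all _ fun ζ => ?_)))
  · simp only [smul_eq_mul, RCLike.inner_apply, conj_trivial]
    rw [mul_comm ξ x]; ring
  · simp only
    congr 1
    rw [Real.fourierInv_eq', Real.fourierInv_eq']
    congr 1; ext x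
    simp only [smul_eq_mul, RCLike.inner_apply, conj_trivial]
    rw [← mul_assoc, ← Complex.exp_add]
    congr 2
    push_cast; ring

/-- `V` is the real-valued function with Fourier transform `⟨·⟩^{-k} v`. -/
structure IsMultiplier (k : ℝ) (V : ℝ → ℝ) (v : L2) : Prop where
  ae_eq : (fun x => (V x : ℂ)) =ᵐ[volume] 𝓕⁻ fun ζ => wsym (-k) ζ * v ζ

variable {k : ℝ} {V : ℝ → ℝ} {v : L2}

lemma IsMultiplier.integrable_mul (h : IsMultiplier k V v) (hk : 1 ≤ k) {ψ : ℝ → ℂ}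
    (hψ : Integrable ψ) : Integrable fun x => (V x : ℂ) * ψ x := by
  have hi := integrable_wsym_mul hk v
  have hc : Continuous (𝓕⁻ fun ζ => wsym (-k) ζ * v ζ) :=
    VectorFourier.fourierIntegral_continuous Real.continuous_fourierChar
      ((continuous_inner (𝕜 := ℝ) (E := ℝ)).neg) hi
  have h1 : Integrable fun x => (𝓕⁻ fun ζ => wsym (-k) ζ * v ζ) x * ψ x :=
    hψ.bdd_mul (c := ∫ ζ, ‖wsym (-k) ζ * v ζ‖) hc.aestronglyMeasurable
      (ae_of_all _ fun x => VectorFourier.norm_fourierIntegral_le_integral_norm _ _ _ _ _)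
  refine h1.congr ?_
  filter_upwards [h.ae_eq] with x hx
  rw [hx]

lemma IsMultiplier.fourierInv_mul (h : IsMultiplier k V v) (hk : 1 ≤ k) {ψ : ℝ → ℂ}
    (hψ : Integrable ψ) : (𝓕⁻ fun x => (V x : ℂ) * ψ x) = convOp k v (𝓕⁻ ψ) := by
  ext ξ
  rw [convOp, ← WaterWave.fourierInv_mul (integrable_wsym_mul hk v) hψ]
  refine Real.fourierInv_congr_ae ?_ ξ
  filter_upwards [h.ae_eq] with x hx
  rw [hx]

/-- The Fourier transform of a real function is Hermitian. -/
lemma IsMultiplier.hermitian (h : IsMultiplier k V v) (hk : 1 ≤ k) :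
    ∀ᵐ x, v (-x) = conj (v x) := by
  set g : ℝ → ℂ := fun ζ => wsym (-k) ζ * v ζ with hg
  have hi : Integrable g := integrable_wsym_mul hk v
  set g' : ℝ → ℂ := fun ζ => conj (g (-ζ)) with hg'
  have hi' : Integrable g' := by
    have : Integrable fun ζ => g (-ζ) := hi.comp_neg
    exact (Complex.conjCLE.toContinuousLinearMap).integrable_comp this
  have e1 : ∀ x, (𝓕⁻ g') x = conj ((𝓕⁻ g) x) := fun x => by
    rw [Real.fourierInv_eq', Real.fourierInv_eq', ← integral_conj, ← integral_neg_eq_self]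
    congr 1; ext ζ
    simp only [hg', smul_eq_mul, neg_neg, map_mul, ← Complex.exp_conj, Complex.conj_I,
      Complex.conj_ofReal, inner_neg_left]
    congr 2
    push_cast; ring
  have e2 : (𝓕⁻ g') =ᵐ[volume] 𝓕⁻ g := by
    filter_upwards [h.ae_eq] with x hx
    rw [e1, ← hx, Complex.conj_ofReal]
  -- Injectivity of the Fourier transform on `L¹`, by testing with Schwartz functions written as
  -- inverse transforms.
  have e3 : g' =ᵐ[volume] g := by
    have hS : ∀ {f : ℝ → ℂ}, Integrable f → ∀ φ : 𝓢(ℝ, ℂ), Integrable fun ξ => f ξ * φ ξ :=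
      fun {f} hf φ => by
        refine (hf.bdd_mul (c := ‖φ.toBoundedContinuousFunction‖)
          φ.continuous.aestronglyMeasurable (ae_of_all _ fun x =>
            φ.toBoundedContinuousFunction.norm_coe_le_norm x)).congr (ae_of_all _ fun x => mul_comm _ _)
    refine ae_eq_of_forall_integral_schwartz (hS hi') (hS hi) fun φ => ?_
    have e4 : (φ : ℝ → ℂ) = 𝓕⁻ ((𝓕 φ : 𝓢(ℝ, ℂ)) : ℝ → ℂ) := by
      rw [← SchwartzMap.fourierInv_coe, fourierInv_fourier_eq]
    rw [e4, ← fourierInv_flip hi' (𝓕 φ : 𝓢(ℝ, ℂ)).integrable,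
      ← fourierInv_flip hi (𝓕 φ : 𝓢(ℝ, ℂ)).integrable]
    refine integral_congr_ae ?_
    filter_upwards [e2] with x hx
    rw [hx]
  filter_upwards [e3] with x hx
  simp only [hg', hg, map_mul, conj_wsym] at hx
  have e5 : wsym (-k) (-x) = wsym (-k) x := by rw [wsym, wsym, jb_neg]
  rw [e5] at hx
  have h0 : wsym (-k) x ≠ 0 := by
    rw [← norm_ne_zero_iff, norm_wsym]; exact (Real.rpow_pos_of_pos (jb_pos x) _).ne'
  rw [← mul_left_cancel₀ h0 hx, Complex.conj_conj]

/-- Duality between multiplication on the Fourier side and on the physical side. -/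
lemma exists_testL2_mul {a : ℝ} (hk : 3 ≤ k) (ha : |a| ≤ k) (hv : ∀ᵐ x, v (-x) = conj (v x))
    {θ : L2} {ψ : ℝ → ℂ} (hθ : θ =ᵐ[volume] fun ξ => conj (wsym (-a) ξ * ψ ξ)) :
    ∃ θ' : L2, (θ' =ᵐ[volume] fun ξ => conj (wsym (-a) ξ * convOp k v ψ ξ)) ∧
      ∀ h, ⟪θ, kop (multKer a k) v h⟫_ℂ = ⟪θ', h⟫_ℂ := by
  have hm := admissible_multKer hk ha
  refine ⟨kop (fun ξ η => conj (multKer a k η ξ)) v θ, ?_, fun h => ?_⟩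
  · filter_upwards [kop_ae_eq hm.adjoint v θ] with ξ hξ
    rw [hξ, convOp, ← integral_const_mul, ← integral_conj, ← integral_add_left_eq_self _ ξ]
    refine integral_congr_ae ?_
    have h1 : ∀ᵐ ζ, θ (ξ + ζ) = conj (wsym (-a) (ξ + ζ) * ψ (ξ + ζ)) :=
      (quasiMeasurePreserving_add_left volume ξ).ae hθ
    filter_upwards [h1, hv] with ζ h2 h3
    rw [h2, sub_add_cancel_left, h3, conj_multKer, multKer, add_sub_cancel_left]
    simp only [map_mul, conj_wsym]
    have h4 : jb (ξ + ζ) ^ a * jb (ξ + ζ) ^ (-a) = 1 := by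
      rw [← Real.rpow_add (jb_pos _), add_neg_cancel, Real.rpow_zero]
    have h5 : ((jb (ξ + ζ) ^ a : ℝ) : ℂ) * ((jb (ξ + ζ) ^ (-a) : ℝ) : ℂ) = 1 := by
      exact_mod_cast h4
    simp only [wsym]
    push_cast
    linear_combination ((jb ξ ^ (-a) : ℝ) : ℂ) * ((jb ζ ^ (-k) : ℝ) : ℂ) * conj (v ζ) *
      conj (ψ (ξ + ζ)) * h5
  · have := realSymbol_of_ae hv _ _ hm.adjoint θ h
    simp only [Complex.conj_conj] at this
    exact this.symm

end Product

/-! ### The distributional equation in Fourier variables -/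

section Acceleration

variable {s k : ℝ} {V : ℝ → ℝ → ℝ} {R u w : ℝ → 𝓢'(ℝ, ℂ)} {t : ℝ} {v Z Y : L2}

/-- The weak form of the equation in Fourier space. -/
lemma acceleration_eq (hk : 3 ≤ k) (h2 : |s - 3 / 2| ≤ k) (hV : IsMultiplier k (V t) v)
    (hu : u t = toDist (s + 3 / 2) Z) (hw : w t = toDist s Y) (φ : 𝓢(ℝ, ℂ)) :
    acceleration V R u w t φ = ⟪testL2 (s - 3 / 2) φ,
      accZ (s - 3 / 2) k v Z + accY (s - 3 / 2) k v Y⟫_ℂ + R t φ := by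
  have hk1 : 1 ≤ k := by linarith
  have hv := hV.hermitian hk1
  set a := s - 3 / 2 with ha
  have hφ := testL2_ae_eq a φ
  have hφ' : testL2 a φ =ᵐ[volume] fun ξ => conj (wsym (-a) ξ * (𝓕⁻ (φ : ℝ → ℂ)) ξ) := by
    simpa only [SchwartzMap.fourierInv_coe] using hφ
  -- Each application of the duality moves one factor `V` onto the test function: one for `V∂w`, two
  -- for `V²∂²u`.
  obtain ⟨θ₁, hθ₁, e₁⟩ := exists_testL2_mul hk h2 hv hφ'
  obtain ⟨θ₂, hθ₂, e₂⟩ := exists_testL2_mul hk h2 hv hθ₁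
  have dw := (isFourierDensity_toDist s Y).deriv.ae_eq
  have du2 := (isFourierDensity_toDist (s + 3 / 2) Z).deriv.deriv.ae_eq
  have du3 := (isFourierDensity_toDist (s + 3 / 2) Z).deriv.deriv.deriv.ae_eq
  have hφi : Integrable (φ : ℝ → ℂ) := φ.integrable
  have wa : ∀ ξ, wsym (-a) ξ * wsym (-(3 / 2)) ξ = wsym (-s) ξ := fun ξ => by
    rw [wsym_mul]; congr 1; rw [ha]; ring
  have wb : ∀ ξ, wsym (-a) ξ * wsym (-3) ξ = wsym (-(s + 3 / 2)) ξ := fun ξ => by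
    rw [wsym_mul]; congr 1; rw [ha]; ring
  -- The symbol identity `(-i sgn ξ)(2πiξ)³ = -(2π|ξ|)³`, that is, `H∂³ = -|D|³`.
  have p1 : hilbertPairing (dα (dα (dα (u t)))) φ = -⟪testL2 a φ,
      mulOp (fun ξ => wsym (-3) ξ * (asym ξ * asym ξ)) Z⟫_ℂ := by
    rw [hilbertPairing, hu, inner_eq_of_ae hφ', ← integral_neg]
    refine integral_congr_ae ?_
    filter_upwards [du3, mulOp_ae_eq bddMul_wsym_asym_sq Z] with ξ h3 h4
    rw [h3, h4, ← wb, asym_mul_self, hilbertSymbol, dsym]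
    have hs : ((SignType.sign ξ : ℝ) : ℂ) * ξ = (|ξ| : ℝ) := by
      rw [← Complex.ofReal_mul]; congr 1; exact sign_mul_self ξ
    have hsq : (ξ : ℂ) ^ 2 = ((|ξ| : ℝ) : ℂ) ^ 2 := by
      rw [← Complex.ofReal_pow, ← Complex.ofReal_pow, sq_abs]
    have hI : Complex.I ^ 4 = 1 := Complex.I_pow_four
    push_cast
    linear_combination (-(2 * Real.pi : ℂ) ^ 3 * Complex.I ^ 4 * ξ ^ 2 * (wsym (-a) ξ * wsym (-3) ξ *
      Z ξ * (𝓕⁻ (φ : ℝ → ℂ)) ξ)) * hs + (-(2 * Real.pi : ℂ) ^ 3 * Complex.I ^ 4 * (|ξ| : ℝ) *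
      (wsym (-a) ξ * wsym (-3) ξ * Z ξ * (𝓕⁻ (φ : ℝ → ℂ)) ξ)) * hsq +
      (-(2 * Real.pi : ℂ) ^ 3 * (|ξ| : ℝ) ^ 3 *
      (wsym (-a) ξ * wsym (-3) ξ * Z ξ * (𝓕⁻ (φ : ℝ → ℂ)) ξ)) * hI
  have p2 : pairing (dα (w t)) (fun x => 2 * (V t x : ℂ) * φ x) = 2 * ⟪testL2 a φ,
      kop (multKer a k) v (mulOp (fun ξ => wsym (-(3 / 2)) ξ * dsym ξ) Y)⟫_ℂ := by
    have f1 : (𝓕⁻ fun x => 2 * (V t x : ℂ) * φ x) = fun ξ => 2 * convOp k v (𝓕⁻ (φ : ℝ → ℂ)) ξ := by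
      rw [← hV.fourierInv_mul hk1 hφi]
      ext ξ
      rw [Real.fourierInv_eq', Real.fourierInv_eq', ← integral_const_mul]
      congr 1; ext x; simp only [smul_eq_mul]; ring
    rw [pairing, hw, f1, e₁, inner_eq_of_ae hθ₁, ← integral_const_mul]
    refine integral_congr_ae ?_
    filter_upwards [dw, mulOp_ae_eq bddMul_wsym_dsym Y] with ξ h3 h4
    rw [h3, h4, ← wa]; ring
  have p3 : pairing (dα (dα (u t))) (fun x => (V t x : ℂ) ^ 2 * φ x) = ⟪testL2 a φ,
      kop (multKer a k) v (kop (multKer a k) v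
        (mulOp (fun ξ => wsym (-3) ξ * (dsym ξ * dsym ξ)) Z))⟫_ℂ := by
    have f1 : (𝓕⁻ fun x => (V t x : ℂ) ^ 2 * φ x) = convOp k v (convOp k v (𝓕⁻ (φ : ℝ → ℂ))) := by
      rw [← hV.fourierInv_mul hk1 hφi, ← hV.fourierInv_mul hk1 (hV.integrable_mul hk1 hφi)]
      congr 1; ext x; ring
    rw [pairing, hu, f1, e₁, e₂, inner_eq_of_ae hθ₂]
    refine integral_congr_ae ?_
    filter_upwards [du2, mulOp_ae_eq bddMul_wsym_dsym_sq Z] with ξ h3 h4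
    rw [h3, h4, ← wb]; ring
  rw [acceleration, p1, p2, p3]
  simp only [accZ, accY, sub_apply, neg_apply, smul_apply, ContinuousLinearMap.comp_apply,
    inner_add_right, inner_sub_right, inner_neg_right, inner_smul_right]
  ring

end Acceleration

/-! ### Separability of the Schwartz space -/

section Separable

/-- `x^k ∂^n φ`, on the Fourier side, in `L¹`. -/
def schwartzL1 (p : ℕ × ℕ) (φ : 𝓢(ℝ, ℂ)) : Lp ℂ 1 (volume : Measure ℝ) :=
  (𝓕⁻ (SchwartzMap.smulLeftCLM ℂ (fun x : ℝ => (x : ℂ) ^ p.1)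
    ((SchwartzMap.derivCLM ℂ ℂ)^[p.2] φ))).toLp 1

lemma iterate_derivCLM (n : ℕ) (φ : 𝓢(ℝ, ℂ)) (x : ℝ) :
    ((SchwartzMap.derivCLM ℂ ℂ)^[n] φ) x = iteratedDeriv n φ x := by
  induction n generalizing φ with
  | zero => simp
  | succ n ih =>
    rw [Function.iterate_succ_apply, ih, iteratedDeriv_succ']
    rfl

/-- A function is bounded by the `L¹` norm of its inverse Fourier transform. So the Schwartz
seminorms are dominated by norms in the separable space `L¹`, and a countable product of copies of
it detects density. -/
lemma seminorm_sub_le (p : ℕ × ℕ) (φ ψ : 𝓢(ℝ, ℂ)) :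
    schwartzSeminormFamily ℂ ℝ ℂ p (φ - ψ) ≤ ‖schwartzL1 p φ - schwartzL1 p ψ‖ := by
  have hsub : schwartzL1 p φ - schwartzL1 p ψ = schwartzL1 p (φ - ψ) := by
    have h1 : (SchwartzMap.derivCLM ℂ ℂ)^[p.2] (φ - ψ) =
        (SchwartzMap.derivCLM ℂ ℂ)^[p.2] φ - (SchwartzMap.derivCLM ℂ ℂ)^[p.2] ψ := by
      simp only [← FunLike.coe_pow_eq_iterate, map_sub]
    have h2 : ∀ f g : 𝓢(ℝ, ℂ), 𝓕⁻ (f - g) = 𝓕⁻ f - 𝓕⁻ g := fun f g => by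
      rw [sub_eq_add_neg, FourierTransform.fourierInv_add, FourierTransform.fourierInv_neg, sub_eq_add_neg]
    rw [schwartzL1, schwartzL1, schwartzL1, h1, map_sub, h2]
    exact (map_sub (SchwartzMap.toLpCLM ℂ ℂ 1 (volume : Measure ℝ)) _ _).symm
  rw [hsub]
  refine SchwartzMap.seminorm_le_bound ℂ p.1 p.2 _ (norm_nonneg _) fun x => ?_
  have h := SchwartzMap.norm_fourier_apply_le_toLp_one (𝓕⁻ (SchwartzMap.smulLeftCLM ℂ
    (fun x : ℝ => (x : ℂ) ^ p.1) ((SchwartzMap.derivCLM ℂ ℂ)^[p.2] (φ - ψ)))) x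
  refine le_trans (le_of_eq ?_) h
  rw [fourier_fourierInv_eq, SchwartzMap.smulLeftCLM_apply_apply (by fun_prop), iterate_derivCLM,
    norm_smul, norm_pow, Complex.norm_real, norm_iteratedFDeriv_eq_norm_iteratedDeriv]

/-- The Schwartz space is separable. -/
lemma exists_countable_dense_schwartz : ∃ D : Set 𝓢(ℝ, ℂ), D.Countable ∧ Dense D := by
  let Φ : 𝓢(ℝ, ℂ) → (ℕ × ℕ → Lp ℂ 1 (volume : Measure ℝ)) := fun φ p => schwartzL1 p φ
  have : Fact ((1 : ℝ≥0∞) ≠ ∞) := ⟨by simp⟩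
  have : Fact ((1 : ℝ≥0∞) ≤ 1) := ⟨le_rfl⟩
  have : SecondCountableTopology (Lp ℂ 1 (volume : Measure ℝ)) := inferInstance
  obtain ⟨E, hEc, hEd⟩ := TopologicalSpace.exists_countable_dense (range Φ)
  choose g hg using fun y : range Φ => y.2
  refine ⟨g '' E, hEc.image g, fun φ => ?_⟩
  rw [mem_closure_iff_nhds_basis ((schwartz_withSeminorms ℂ ℝ ℂ).hasBasis_ball)]
  rintro ⟨s, r⟩ hr
  have hopen : {y : range Φ | ∀ p ∈ s, ‖y.1 p - Φ φ p‖ < r} ∈ 𝓝 (⟨Φ φ, φ, rfl⟩ : range Φ) := by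
    have : ∀ p ∈ s, {y : range Φ | ‖y.1 p - Φ φ p‖ < r} ∈ 𝓝 (⟨Φ φ, φ, rfl⟩ : range Φ) := fun p _ => by
      have hc : Continuous fun y : range Φ => ‖y.1 p - Φ φ p‖ :=
        (((continuous_apply p).comp continuous_subtype_val).sub continuous_const).norm
      exact hc.continuousAt.preimage_mem_nhds (Iio_mem_nhds (by simpa using hr))
    have h2 := (Filter.biInter_finset_mem s).2 this
    filter_upwards [h2] with y hy p hp
    exact Set.mem_iInter₂.1 hy p hp
  obtain ⟨y, hyE, hy⟩ := hEd.inter_nhds_nonempty hopen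
  refine ⟨g y, ⟨y, hyE, rfl⟩, ?_⟩
  rw [Seminorm.mem_ball]
  refine Seminorm.finset_sup_apply_lt hr fun p hp => ?_
  refine (seminorm_sub_le p _ _).trans_lt ?_
  have := hy p hp
  rwa [← hg y] at this

end Separable

/-! ### Measurable `L²` representatives -/

section Measurability

lemma norm_star_L2 (f : L2) : ‖star f‖ = ‖f‖ := by
  rw [Lp.norm_def, Lp.norm_def]
  congr 1
  refine eLpNorm_congr_norm_ae ?_
  filter_upwards [Lp.coeFn_star f] with x h5
  rw [h5, Pi.star_apply, norm_star]

lemma inner_star_star (f g : L2) : ⟪star f, star g⟫_ℂ = ⟪g, f⟫_ℂ := by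
  rw [inner_eq_integral, inner_eq_integral]
  refine integral_congr_ae ?_
  filter_upwards [Lp.coeFn_star f, Lp.coeFn_star g] with x h1 h2
  rw [h1, h2, Pi.star_apply, Pi.star_apply]
  simp [mul_comm]

/-- The linear version of `testL2`. -/
def testCLM (a : ℝ) : 𝓢(ℝ, ℂ) →L[ℂ] L2 :=
  (SchwartzMap.toLpCLM ℂ ℂ 2 (volume : Measure ℝ)).comp
    ((SchwartzMap.smulLeftCLM ℂ (wsym (-a))).comp (fourierInvCLM ℂ 𝓢(ℝ, ℂ)))

lemma star_testCLM (a : ℝ) (φ : 𝓢(ℝ, ℂ)) : star (testCLM a φ) = testL2 a φ := rfl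

lemma denseRange_testCLM (a : ℝ) : DenseRange (testCLM a) := by
  have h3 : Function.Surjective (star : L2 → L2) := fun f => ⟨star f, star_star f⟩
  have h := h3.denseRange.comp (denseRange_testL2 a) continuous_star_L2
  refine h.mono ?_
  rintro _ ⟨φ, rfl⟩
  exact ⟨φ, by rw [Function.comp_apply, ← star_testCLM, star_star]⟩

/-- A distribution bounded by the dual norm is in the Sobolev space. -/
lemma exists_eq_toDist_of_bound {a c : ℝ} (hc : 0 ≤ c) {f : 𝓢'(ℝ, ℂ)}
    (h : ∀ φ, ‖f φ‖ ≤ c * ‖testL2 a φ‖) : ∃ g : L2, ‖g‖ ≤ c ∧ f = toDist a g := by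
  let f' : 𝓢(ℝ, ℂ) →ₗ[ℂ] ℂ :=
    { toFun := f
      map_add' := fun φ ψ => map_add f φ ψ
      map_smul' := fun c φ => map_smul f c φ }
  have hb : ∀ φ, ‖f' φ‖ ≤ c * ‖(testCLM a : 𝓢(ℝ, ℂ) →ₗ[ℂ] L2) φ‖ := fun φ => by
    have := h φ
    rwa [← star_testCLM, norm_star_L2] at this
  -- The bound says that `f` factors through the dense range of the test map, so it extends to a
  -- functional on `L²`, and Riesz applies.
  let F : L2 →L[ℂ] ℂ := f'.extendOfNorm (testCLM a : 𝓢(ℝ, ℂ) →ₗ[ℂ] L2)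
  have hF : ∀ φ, F (testCLM a φ) = f φ := fun φ =>
    LinearMap.extendOfNorm_eq (denseRange_testCLM a) ⟨c, hb⟩ φ
  have hFn : ‖F‖ ≤ c := LinearMap.opNorm_extendOfNorm_le (denseRange_testCLM a) hc hb
  let h0 : L2 := (InnerProductSpace.toDual ℂ L2).symm F
  refine ⟨star h0, ?_, ?_⟩
  · rw [norm_star_L2, LinearIsometryEquiv.norm_map]; exact hFn
  · ext φ
    rw [toDist_apply, ← star_testCLM, inner_star_star, InnerProductSpace.toDual_symm_apply, hF]

lemma continuous_testL2 (a : ℝ) : Continuous (testL2 a) :=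
  continuous_star_L2.comp (testCLM a).continuous

/-- Duality. Its use is that with a countable dense set the infimum over representatives becomes a
countable supremum, which is measurable in time. -/
lemma sobolevNorm_eq_iSup (a : ℝ) {D : Set 𝓢(ℝ, ℂ)} (hD : Dense D) (f : 𝓢'(ℝ, ℂ)) :
    sobolevNorm a f = ⨆ ψ ∈ D, ‖f ψ‖ₑ / ‖testL2 a ψ‖ₑ := by
  refine le_antisymm ?_ (iSup₂_le fun ψ _ => ?_)
  · set c := ⨆ ψ ∈ D, ‖f ψ‖ₑ / ‖testL2 a ψ‖ₑ with hc
    by_cases htop : c = ∞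
    · rw [htop]; exact le_top
    have h : ∀ φ, ‖f φ‖ ≤ c.toReal * ‖testL2 a φ‖ := by
      have hcl : IsClosed {φ | ‖f φ‖ ≤ c.toReal * ‖testL2 a φ‖} :=
        isClosed_le (map_continuous f).norm (continuous_const.mul (continuous_testL2 a).norm)
      have hsub : D ⊆ {φ | ‖f φ‖ ≤ c.toReal * ‖testL2 a φ‖} := fun ψ hψ => by
        have h1 : ‖f ψ‖ₑ / ‖testL2 a ψ‖ₑ ≤ c := le_iSup₂_of_le ψ hψ le_rfl
        rw [ENNReal.div_le_iff_le_mul (Or.inr htop) (Or.inl enorm_ne_top)] at h1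
        have h2 := ENNReal.toReal_mono (ENNReal.mul_ne_top htop enorm_ne_top) h1
        rwa [ENNReal.toReal_mul, toReal_enorm, toReal_enorm] at h2
      exact fun φ => hcl.closure_subset_iff.2 hsub (hD φ)
    obtain ⟨g, hg, rfl⟩ := exists_eq_toDist_of_bound ENNReal.toReal_nonneg h
    rw [sobolevNorm_toDist, ← ofReal_norm, ← ENNReal.ofReal_toReal htop]
    exact ENNReal.ofReal_le_ofReal hg
  · by_cases hf : sobolevNorm a f < ∞
    · obtain ⟨g, rfl⟩ := exists_eq_toDist_of_sobolevNorm hf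
      refine ENNReal.div_le_of_le_mul ?_
      rw [sobolevNorm_toDist, toDist_apply, mul_comm, ← ofReal_norm, ← ofReal_norm, ← ofReal_norm,
        ← ENNReal.ofReal_mul (norm_nonneg _)]
      exact ENNReal.ofReal_le_ofReal (norm_inner_le_norm _ _)
    · rw [not_lt_top_iff.1 hf]; exact le_top

lemma aemeasurable_sobolevNorm (a : ℝ) {α : Type*} [MeasurableSpace α] {μ : Measure α}
    {f : α → 𝓢'(ℝ, ℂ)} (hf : ∀ φ, AEMeasurable (fun t => f t φ) μ) :
    AEMeasurable (fun t => sobolevNorm a (f t)) μ := by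
  obtain ⟨D, hDc, hD⟩ := exists_countable_dense_schwartz
  simp only [sobolevNorm_eq_iSup a hD]
  exact AEMeasurable.biSup D hDc fun ψ _ => (hf ψ).enorm.div_const _

/-- A representation of a family of distributions by `L²` functions. -/
lemma exists_repr {a T : ℝ} {f : ℝ → 𝓢'(ℝ, ℂ)}
    (hf : ∀ φ, AEMeasurable (fun t => f t φ) (volume.restrict (Icc 0 T)))
    (hn : ∀ᵐ t ∂(volume.restrict (Icc 0 T)), sobolevNorm a (f t) < ∞) :
    ∃ G : ℝ → L2, AEStronglyMeasurable G volume ∧ (∀ t, t ∉ Icc 0 T → G t = 0) ∧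
      ∀ᵐ t ∂(volume.restrict (Icc 0 T)), f t = toDist a (G t) := by
  classical
  let G : ℝ → L2 := fun t =>
    if h : sobolevNorm a (f t) < ∞ then (exists_eq_toDist_of_sobolevNorm h).choose else 0
  have hG : ∀ᵐ t ∂(volume.restrict (Icc 0 T)), f t = toDist a (G t) := by
    filter_upwards [hn] with t ht
    have : G t = (exists_eq_toDist_of_sobolevNorm ht).choose := dif_pos ht
    rw [this]
    exact (exists_eq_toDist_of_sobolevNorm ht).choose_spec
  have hGm : AEStronglyMeasurable G (volume.restrict (Icc 0 T)) := by
    have : Fact ((2 : ℝ≥0∞) ≠ ∞) := ⟨by simp⟩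
    refine aestronglyMeasurable_of_inner (denseRange_testL2 a) ?_
    rintro _ ⟨φ, rfl⟩
    refine (hf φ).congr ?_
    filter_upwards [hG] with t ht
    rw [ht, toDist_apply]
  refine ⟨(Icc 0 T).indicator G, (aestronglyMeasurable_indicator_iff measurableSet_Icc).2 hGm,
    fun t ht => indicator_of_notMem ht _, ?_⟩
  filter_upwards [hG, ae_restrict_mem measurableSet_Icc] with t ht hm
  rw [indicator_of_mem hm, ht]

/-- Finiteness of the time integral puts almost every value in `H^a`. Extension by zero outside
`[0,T]` makes the representative integrable on the line. -/
lemma MemL2.exists_repr {a T : ℝ} {f : ℝ → 𝓢'(ℝ, ℂ)} (hf : MemL2 T a f) :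
    ∃ G : ℝ → L2, AEStronglyMeasurable G volume ∧ (∀ t, t ∉ Icc 0 T → G t = 0) ∧
      (∀ᵐ t ∂(volume.restrict (Icc 0 T)), f t = toDist a (G t)) ∧
      Integrable G ∧ Integrable (fun t => ‖G t‖ ^ 2) ∧
      ENNReal.ofReal √(∫ t in (0 : ℝ)..T, ‖G t‖ ^ 2) = l2Norm T a f := by
  have hlt : ∫⁻ t in Icc 0 T, sobolevNorm a (f t) ^ 2 < ∞ := by
    by_contra h
    have h1 := hf.norm_lt_top
    rw [l2Norm, not_lt_top_iff.1 h] at h1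
    simp at h1
  have hmeas := aemeasurable_sobolevNorm a hf.measurable
  have hn : ∀ᵐ t ∂(volume.restrict (Icc 0 T)), sobolevNorm a (f t) < ∞ := by
    filter_upwards [ae_lt_top' (hmeas.pow_const 2) hlt.ne] with t ht
    by_contra h
    rw [not_lt_top_iff.1 h] at ht
    simp at ht
  obtain ⟨G, hGm, hG0, hG⟩ := WaterWave.exists_repr hf.measurable hn
  have hsq : ∫⁻ t in Icc 0 T, sobolevNorm a (f t) ^ 2 = ∫⁻ t in Icc 0 T, ENNReal.ofReal (‖G t‖ ^ 2) := by
    refine lintegral_congr_ae ?_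
    filter_upwards [hG] with t ht
    rw [ht, sobolevNorm_toDist, ENNReal.ofReal_pow (norm_nonneg _), ofReal_norm]
  have hi2 : IntegrableOn (fun t => ‖G t‖ ^ 2) (Icc 0 T) := by
    refine ⟨(hGm.norm.pow 2).restrict, ?_⟩
    rw [hasFiniteIntegral_iff_ofReal (ae_of_all _ fun t => by positivity), ← hsq]
    exact hlt
  have hi2' : Integrable (fun t => ‖G t‖ ^ 2) :=
    (integrableOn_iff_integrable_of_support_subset fun t ht => by
      by_contra h; exact ht (by simp [hG0 t h])).1 hi2
  have hi1 : Integrable G := by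
    refine (integrableOn_iff_integrable_of_support_subset (s := Icc 0 T) fun t ht => by
      by_contra h; exact ht (hG0 t h)).1 ?_
    refine Integrable.mono' (g := fun t => 1 + ‖G t‖ ^ 2)
      ((integrable_const _).add hi2) hGm.restrict (ae_of_all _ fun t => ?_)
    nlinarith [sq_nonneg (‖G t‖ - 1)]
  refine ⟨G, hGm, hG0, hG, hi1, hi2', ?_⟩
  rw [l2Norm, hsq]
  by_cases hT : 0 ≤ T
  · rw [intervalIntegral.integral_of_le hT, ← integral_Icc_eq_integral_Ioc,
      ← ofReal_integral_eq_lintegral_ofReal hi2 (ae_of_all _ fun t => by positivity),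
      ENNReal.ofReal_rpow_of_nonneg (integral_nonneg fun t => by positivity) (by norm_num),
      Real.sqrt_eq_rpow]
  · rw [Icc_eq_empty hT, intervalIntegral.integral_of_ge (not_le.1 hT).le]
    have : ∀ t, G t = 0 := fun t => hG0 t (by simp [Icc_eq_empty hT])
    simp [this]

end Measurability

/-! ### Regularity of the coefficient `V` -/

section Coefficient

lemma intervalIntegral_inner_right {G : ℝ → L2} {t : ℝ} (θ : L2) (hG : IntervalIntegrable G volume 0 t) :
    ∫ τ in (0 : ℝ)..t, ⟪θ, G τ⟫_ℂ = ⟪θ, ∫ τ in (0 : ℝ)..t, G τ⟫_ℂ :=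
  (innerSL ℂ θ).intervalIntegral_comp_comm hG

lemma intervalIntegral_congr_ae_Icc {E : Type*} [NormedAddCommGroup E] [NormedSpace ℝ E] {T t : ℝ}
    (ht : t ∈ Icc 0 T) {f g : ℝ → E} (h : ∀ᵐ τ ∂(volume.restrict (Icc 0 T)), f τ = g τ) :
    ∫ τ in (0 : ℝ)..t, f τ = ∫ τ in (0 : ℝ)..t, g τ := by
  refine intervalIntegral.integral_congr_ae ?_
  rw [ae_restrict_iff' measurableSet_Icc] at h
  filter_upwards [h] with τ hτ hm
  rw [uIoc_of_le ht.1] at hm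
  exact hτ ⟨hm.1.le, hm.2.trans ht.2⟩

/-- One value in `H^k` and an integrable derivative in `H^k` place the whole curve in `H^k`, as a
primitive. Applied twice, this gains the `C¹` regularity. -/
lemma HasWeakTimeDeriv.exists_eq_toDist {T k : ℝ} {f g : ℝ → 𝓢'(ℝ, ℂ)} {G : ℝ → L2}
    (h : HasWeakTimeDeriv T f (fun t φ => g t φ)) (hG : ∀ b, IntervalIntegrable G volume 0 b)
    (hg : ∀ᵐ t ∂(volume.restrict (Icc 0 T)), g t = toDist k (G t)) {t₀ : ℝ} (ht₀ : t₀ ∈ Icc 0 T)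
    {h₀ : L2} (hf : f t₀ = toDist k h₀) :
    ∃ c : L2, ∀ t ∈ Icc 0 T, f t = toDist k (c + ∫ τ in (0 : ℝ)..t, G τ) := by
  have e : ∀ t ∈ Icc 0 T, ∀ φ, f t φ = f 0 φ + ⟪testL2 k φ, ∫ τ in (0 : ℝ)..t, G τ⟫_ℂ :=
    fun t ht φ => by
      rw [(h φ).2 t ht, ← intervalIntegral_inner_right _ (hG t)]
      congr 1
      refine intervalIntegral_congr_ae_Icc ht ?_
      filter_upwards [hg] with τ hτ
      rw [hτ, toDist_apply]
  refine ⟨h₀ - ∫ τ in (0 : ℝ)..t₀, G τ, fun t ht => ?_⟩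
  ext φ
  have e₀ := e t₀ ht₀ φ
  rw [hf, toDist_apply] at e₀
  rw [e t ht φ, toDist_apply, inner_add_right, inner_sub_right, e₀]
  ring

/-- The exceptional set inside the open interval is open and null, hence empty; the endpoints follow
by closure, for which `T > 0` is needed. -/
lemma forall_mem_Icc_of_ae {E : Type*} [TopologicalSpace E] {T : ℝ} (hT : 0 < T) {v : ℝ → E}
    (hv : Continuous v) {F : Set E} (hF : IsClosed F)
    (h : ∀ᵐ t ∂(volume.restrict (Icc 0 T)), v t ∈ F) : ∀ t ∈ Icc 0 T, v t ∈ F := by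
  have h1 : Ioo 0 T ⊆ v ⁻¹' F := by
    have ho : IsOpen (Ioo 0 T ∩ (v ⁻¹' F)ᶜ) := isOpen_Ioo.inter (hF.preimage hv).isOpen_compl
    have h0 : volume (Ioo 0 T ∩ (v ⁻¹' F)ᶜ) = 0 := by
      rw [ae_restrict_iff' measurableSet_Icc, ae_iff] at h
      refine measure_mono_null (fun t ht => ?_) h
      simp only [mem_ofPred_eq, Classical.not_imp]
      exact ⟨Ioo_subset_Icc_self ht.1, ht.2⟩
    have h2 := (ho.measure_eq_zero_iff volume).1 h0
    intro t ht
    by_contra hn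
    exact (h2 ▸ (⟨ht, hn⟩ : t ∈ Ioo 0 T ∩ (v ⁻¹' F)ᶜ) : t ∈ (∅ : Set ℝ))
  have h2 := (hF.preimage hv).closure_subset_iff.2 h1
  rwa [closure_Ioo hT.ne] at h2

lemma ae_neBot_restrict_Icc {T : ℝ} (hT : 0 < T) : (ae (volume.restrict (Icc (0 : ℝ) T))).NeBot := by
  rw [ae_restrict_neBot, Real.volume_Icc]
  simpa using hT

/-- Finiteness of the essential supremum has to be shown first, since `toReal` sends `∞` to `0`. -/
lemma norm_le_linftyNorm {T k : ℝ} (hT : 0 < T) {f : ℝ → 𝓢'(ℝ, ℂ)} {v : ℝ → L2} (hv : Continuous v)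
    (h : ∀ t ∈ Icc 0 T, f t = toDist k (v t)) : ∀ t ∈ Icc 0 T, ‖v t‖ ≤ (linftyNorm T k f).toReal := by
  have hfin : linftyNorm T k f ≠ ∞ := by
    obtain ⟨C, hC⟩ := (isCompact_Icc (a := (0 : ℝ)) (b := T)).exists_bound_of_continuousOn
      hv.continuousOn
    refine ((essSup_le_of_ae_le (ENNReal.ofReal C) ?_).trans_lt ENNReal.ofReal_lt_top).ne
    filter_upwards [ae_restrict_mem measurableSet_Icc] with t ht
    rw [h t ht, sobolevNorm_toDist, ← ofReal_norm]
    exact ENNReal.ofReal_le_ofReal (hC t ht)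
  refine forall_mem_Icc_of_ae (F := {g : L2 | ‖g‖ ≤ (linftyNorm T k f).toReal}) hT hv
    (isClosed_le continuous_norm continuous_const) ?_
  filter_upwards [ae_restrict_mem measurableSet_Icc,
    ENNReal.ae_le_essSup (μ := volume.restrict (Icc 0 T)) (fun t => sobolevNorm k (f t))] with t ht h1
  rw [h t ht, sobolevNorm_toDist] at h1
  have := ENNReal.toReal_mono hfin h1
  rwa [toReal_enorm] at this

lemma isMultiplier_of_repr {k : ℝ} (hk : 1 ≤ k) {V : ℝ → ℝ} {v : L2}
    (hV : MemLp (fun x => (V x : ℂ)) 2 volume)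
    (h : toDist k v = (hV.toLp _ : Lp ℂ 2 (volume : Measure ℝ))) : IsMultiplier k V v := by
  have hi := integrable_wsym_mul hk v
  have hc : Continuous (𝓕⁻ fun ζ => wsym (-k) ζ * v ζ) :=
    VectorFourier.fourierIntegral_continuous Real.continuous_fourierChar
      ((continuous_inner (𝕜 := ℝ) (E := ℝ)).neg) hi
  have hlp : ∀ φ : 𝓢(ℝ, ℂ), (fun x => (V x : ℂ) * φ x) =ᵐ[volume] fun x => hV.toLp _ x * φ x :=
    fun φ => by
      filter_upwards [hV.coeFn_toLp] with x hx
      rw [hx]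
  refine ⟨ae_eq_of_forall_integral_schwartz
    (fun φ => (schwartz_integrable_mul φ).congr (hlp φ).symm) (fun φ => ?_) fun φ => ?_⟩
  · exact φ.integrable.bdd_mul (c := ∫ ζ, ‖wsym (-k) ζ * v ζ‖) hc.aestronglyMeasurable
      (ae_of_all _ fun x => VectorFourier.norm_fourierIntegral_le_integral_norm _ _ _ _ _)
  · have h1 := congrArg (fun d : 𝓢'(ℝ, ℂ) => d φ) h
    simp only [toDist_apply, Lp.toTemperedDistribution_apply, smul_eq_mul] at h1
    rw [fourierInv_flip hi φ.integrable, integral_congr_ae (hlp φ)]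
    simp only [mul_comm _ (φ _)]
    rw [← h1, inner_eq_of_ae (testL2_ae_eq k φ)]
    refine integral_congr_ae (ae_of_all _ fun ξ => ?_)
    simp only [SchwartzMap.fourierInv_coe]
    ring

/-- A coefficient in `H²([0,T];H^k)` is `C¹` with values in `H^k`. -/
lemma MemHlHk.exists_coeff {T k : ℝ} (hT : 0 < T) (hk : 1 ≤ k) {l : ℕ} (hl : 2 ≤ l) {V : ℝ → ℝ → ℝ}
    {DV : ℕ → ℝ → 𝓢'(ℝ, ℂ)} (h : MemHlHk T l k V DV) :
    ∃ v v' : ℝ → L2, Coeff T (linftyNorm T k (DV 0)).toReal (linftyNorm T k (DV 1)).toReal v v' ∧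
      ∀ᵐ t ∂(volume.restrict (Icc 0 T)), IsMultiplier k (V t) (v t) := by
  have hne := ae_neBot_restrict_Icc hT
  obtain ⟨G₀, -, -, hG₀, -⟩ := (h.memL2 0 (by lia)).exists_repr
  obtain ⟨G₁, -, -, hG₁, -⟩ := (h.memL2 1 (by lia)).exists_repr
  obtain ⟨G₂, -, -, hG₂, hi₂, -⟩ := (h.memL2 2 (by lia)).exists_repr
  -- Membership in `H^k` is known almost everywhere only; some such time serves as base point for
  -- the primitive.
  obtain ⟨t₀, e₀, ht₀⟩ := (hG₀.and (ae_restrict_mem measurableSet_Icc)).exists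
  obtain ⟨t₁, e₁, ht₁⟩ := (hG₁.and (ae_restrict_mem measurableSet_Icc)).exists
  obtain ⟨c₁, hc₁⟩ := (h.deriv 1 (by lia)).exists_eq_toDist (fun b => hi₂.intervalIntegrable)
    hG₂ ht₁ e₁
  set v' : ℝ → L2 := fun t => c₁ + ∫ τ in (0 : ℝ)..t, G₂ τ with hv'
  have hcont : Continuous v' := continuous_const.add
    (intervalIntegral.continuous_primitive (fun a b => hi₂.intervalIntegrable) 0)
  obtain ⟨c₀, hc₀⟩ := (h.deriv 0 (by lia)).exists_eq_toDist (G := v')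
    (fun b => hcont.intervalIntegrable 0 b)
    ((ae_restrict_mem measurableSet_Icc).mono fun t ht => hc₁ t ht) ht₀ e₀
  set v : ℝ → L2 := fun t => c₀ + ∫ τ in (0 : ℝ)..t, v' τ with hv
  have hder : ∀ t, HasDerivAt v (v' t) t := fun t =>
    ((hcont.integral_hasStrictDerivAt 0 t).hasDerivAt).const_add c₀
  have hvc : Continuous v := continuous_iff_continuousAt.2 fun t => (hder t).continuousAt
  have hmul : ∀ᵐ t ∂(volume.restrict (Icc 0 T)), IsMultiplier k (V t) (v t) := by
    filter_upwards [h.repr, ae_restrict_mem measurableSet_Icc] with t ⟨hV, e⟩ ht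
    exact isMultiplier_of_repr hk hV (by rw [← e, hc₀ t ht])
  refine ⟨v, v', ⟨hder, hcont, ?_, norm_le_linftyNorm hT hvc hc₀, norm_le_linftyNorm hT hcont hc₁⟩,
    hmul⟩
  exact forall_mem_Icc_of_ae hT hvc isClosed_realSymbol
    (hmul.mono fun t ht => realSymbol_of_ae (ht.hermitian hk))

end Coefficient

/-! ### From Fourier variables to distributional solutions -/

section Solution

variable {T s k : ℝ} {V : ℝ → ℝ → ℝ} {R : ℝ → 𝓢'(ℝ, ℂ)}

lemma inner_testL2_ell (a : ℝ) (φ : 𝓢(ℝ, ℂ)) (g : L2) :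
    ⟪testL2 a φ, ell g⟫_ℂ = ⟪testL2 (a + 3 / 2) φ, g⟫_ℂ := by
  rw [← inner_ell, ell_testL2]

lemma linftyNorm_toDist_le {a B : ℝ} {Z : ℝ → L2} (hZ : ∀ t ∈ Icc 0 T, ‖Z t‖ ≤ B) :
    linftyNorm T a (fun t => toDist a (Z t)) ≤ ENNReal.ofReal B := by
  refine essSup_le_of_ae_le _ ?_
  filter_upwards [ae_restrict_mem measurableSet_Icc] with t ht
  rw [sobolevNorm_toDist, ← ofReal_norm]
  exact ENNReal.ofReal_le_ofReal (hZ t ht)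

/-- A Schwartz function tests the first equation at level `s` and the second at level `s - 3/2`; in
both, `⟨D⟩^{-3/2}` raises the index of the test vector by `3/2`, restoring the levels of `u`, of
`∂_t u` and of the force. -/
lemma IsWeakSolution.isSolution (hk : 3 ≤ k) (h2 : |s - 3 / 2| ≤ k) {v G Z Y : ℝ → L2} {B : ℝ}
    (h : IsWeakSolution (s - 3 / 2) k T v G Z Y)
    (hV : ∀ᵐ t ∂(volume.restrict (Icc 0 T)), IsMultiplier k (V t) (v t)) (hG : Integrable G)
    (hR : ∀ᵐ t ∂(volume.restrict (Icc 0 T)), R t = toDist s (G t))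
    (hZ : ∀ t ∈ Icc 0 T, ‖Z t‖ ≤ B) (hY : ∀ t ∈ Icc 0 T, ‖Y t‖ ≤ B) :
    IsSolution T s V R (toDist (s + 3 / 2) (Z 0)) (toDist s (Y 0))
      (fun t => toDist (s + 3 / 2) (Z t)) (fun t => toDist s (Y t)) where
  bounded := (linftyNorm_toDist_le hZ).trans_lt ENNReal.ofReal_lt_top
  bounded_deriv := (linftyNorm_toDist_le hY).trans_lt ENNReal.ofReal_lt_top
  initial := rfl
  initial_deriv := rfl
  timeDeriv φ := by
    simp only [toDist_apply]
    refine ⟨(h.continuousOn_Y _).integrableOn_Icc, fun t ht => ?_⟩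
    have := h.eq_Z (testL2 s φ) t ht
    rwa [inner_testL2_ell, inner_testL2_ell] at this
  equation φ := by
    have hacc : ∀ᵐ t ∂(volume.restrict (Icc 0 T)), acceleration V R
        (fun t => toDist (s + 3 / 2) (Z t)) (fun t => toDist s (Y t)) t φ =
        ⟪testL2 (s - 3 / 2) φ, accZ (s - 3 / 2) k (v t) (Z t) + accY (s - 3 / 2) k (v t) (Y t)⟫_ℂ +
          ⟪testL2 (s - 3 / 2) φ, ell (G t)⟫_ℂ := by
      filter_upwards [hV, hR] with t hVt hRt
      rw [acceleration_eq hk h2 hVt rfl rfl, hRt, toDist_apply, inner_testL2_ell, sub_add_cancel]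
    have i1 := (h.continuousOn_acc (testL2 (s - 3 / 2) φ)).integrableOn_Icc (μ := volume)
    have i2 : Integrable fun t => ⟪testL2 (s - 3 / 2) φ, ell (G t)⟫_ℂ :=
      ((innerSL ℂ (testL2 (s - 3 / 2) φ)).comp ell).integrable_comp hG
    refine ⟨(i1.add i2.integrableOn).congr (hacc.mono fun t ht => ht.symm), fun t ht => ?_⟩
    have := h.eq_Y (testL2 (s - 3 / 2) φ) t ht
    rw [inner_testL2_ell, inner_testL2_ell, sub_add_cancel] at this
    simp only [toDist_apply]
    rw [this, intervalIntegral_congr_ae_Icc ht hacc, intervalIntegral.integral_add _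
      i2.intervalIntegrable]
    rw [intervalIntegrable_iff_integrableOn_Icc_of_le ht.1]
    exact i1.mono_set (Icc_subset_Icc_right ht.2)

end Solution

/-! ### Uniqueness for distributional solutions -/

section Uniqueness

variable {T s k : ℝ} {V : ℝ → ℝ → ℝ} {R u w u' w' : ℝ → 𝓢'(ℝ, ℂ)} {u₀ u₁ : 𝓢'(ℝ, ℂ)}

lemma HasWeakTimeDeriv.aemeasurable {g : ℝ → 𝓢(ℝ, ℂ) → ℂ} (h : HasWeakTimeDeriv T u g)
    (φ : 𝓢(ℝ, ℂ)) : AEMeasurable (fun t => u t φ) (volume.restrict (Icc 0 T)) := by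
  have h1 : ContinuousOn (fun t => u 0 φ + ∫ τ in Ioc 0 t, g τ φ) (Icc 0 T) :=
    continuousOn_const.add (intervalIntegral.continuousOn_primitive (h φ).1)
  refine (h1.congr fun t ht => ?_).aemeasurable measurableSet_Icc
  rw [(h φ).2 t ht, intervalIntegral.integral_of_le ht.1]

lemma exists_bounded_repr {a : ℝ} (hm : ∀ φ, AEMeasurable (fun t => u t φ) (volume.restrict (Icc 0 T)))
    (hb : linftyNorm T a u < ∞) : ∃ (Z : ℝ → L2) (B : ℝ), AEStronglyMeasurable Z volume ∧
      (∀ᵐ t, ‖Z t‖ ≤ B) ∧ ∀ᵐ t ∂(volume.restrict (Icc 0 T)), u t = toDist a (Z t) := by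
  have hle := ENNReal.ae_le_essSup (μ := volume.restrict (Icc 0 T)) (fun t => sobolevNorm a (u t))
  obtain ⟨Z, hZm, hZ0, hZ⟩ := exists_repr hm (hle.mono fun t ht => ht.trans_lt hb)
  refine ⟨Z, (linftyNorm T a u).toReal, hZm, ?_, hZ⟩
  have h1 := hle.and hZ
  rw [ae_restrict_iff' measurableSet_Icc] at h1
  filter_upwards [h1] with t ht
  by_cases hm : t ∈ Icc 0 T
  · obtain ⟨h2, h3⟩ := ht hm
    rw [h3, sobolevNorm_toDist] at h2
    have := ENNReal.toReal_mono hb.ne h2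
    rwa [toReal_enorm] at this
  · rw [hZ0 t hm, norm_zero]; exact ENNReal.toReal_nonneg

lemma HasWeakTimeDeriv.sub_eq {g g' : ℝ → 𝓢(ℝ, ℂ) → ℂ} (h : HasWeakTimeDeriv T u g)
    (h' : HasWeakTimeDeriv T u' g') (h0 : u 0 = u' 0) {t : ℝ} (ht : t ∈ Icc 0 T) (φ : 𝓢(ℝ, ℂ)) :
    u t φ - u' t φ = ∫ τ in (0 : ℝ)..t, (g τ φ - g' τ φ) := by
  have hi : ∀ {f : ℝ → ℂ}, IntegrableOn f (Icc 0 T) → IntervalIntegrable f volume 0 t :=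
    fun {f} hf => by
      rw [intervalIntegrable_iff_integrableOn_Icc_of_le ht.1]
      exact hf.mono_set (Icc_subset_Icc_right ht.2)
  rw [(h φ).2 t ht, (h' φ).2 t ht, h0, intervalIntegral.integral_sub (hi (h φ).1) (hi (h' φ).1)]
  ring

lemma HasWeakTimeDeriv.eq {g g' : ℝ → 𝓢(ℝ, ℂ) → ℂ} (h : HasWeakTimeDeriv T u g)
    (h' : HasWeakTimeDeriv T u' g') (h0 : u 0 = u' 0)
    (hg : ∀ᵐ t ∂(volume.restrict (Icc 0 T)), g t = g' t) {t : ℝ} (ht : t ∈ Icc 0 T) :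
    u t = u' t := by
  ext φ
  rw [← sub_eq_zero, h.sub_eq h' h0 ht, intervalIntegral_congr_ae_Icc (g := fun _ => 0) ht
    (hg.mono fun τ hτ => by rw [hτ, sub_self])]
  simp

/-- The force and the data cancel in the difference, whose bounded representatives fall under
`eq_zero_of_weak`. -/
theorem IsSolution.unique (hk : 3 ≤ k) (h0 : |s - 1 / 2| ≤ k - 1) (h1 : |s - 1| ≤ k)
    (h2 : |s - 3 / 2| ≤ k) (hT : 0 ≤ T) {b b' : ℝ} (hb : 0 ≤ b) (hb' : 0 ≤ b') {v v' : ℝ → L2}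
    (hv : Coeff T b b' v v') (hV : ∀ᵐ t ∂(volume.restrict (Icc 0 T)), IsMultiplier k (V t) (v t))
    (h : IsSolution T s V R u₀ u₁ u w) (h' : IsSolution T s V R u₀ u₁ u' w') :
    ∀ t ∈ Icc 0 T, u t = u' t ∧ w t = w' t := by
  obtain ⟨Z, B₁, hZm, hZb, hZ⟩ := exists_bounded_repr h.timeDeriv.aemeasurable h.bounded
  obtain ⟨Y, B₂, hYm, hYb, hY⟩ := exists_bounded_repr h.equation.aemeasurable h.bounded_deriv
  obtain ⟨Z', B₃, hZm', hZb', hZ'⟩ := exists_bounded_repr h'.timeDeriv.aemeasurable h'.bounded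
  obtain ⟨Y', B₄, hYm', hYb', hY'⟩ := exists_bounded_repr h'.equation.aemeasurable h'.bounded_deriv
  have hu0 : u 0 = u' 0 := h.initial.trans h'.initial.symm
  have hw0 : w 0 = w' 0 := h.initial_deriv.trans h'.initial_deriv.symm
  have hdZm := hZm.sub hZm'
  have hdYm := hYm.sub hYm'
  have hdZb : ∀ᵐ t, ‖(Z - Z') t‖ ≤ max (B₁ + B₃) (B₂ + B₄) := by
    filter_upwards [hZb, hZb'] with t e e'
    exact (norm_sub_le _ _).trans (le_max_of_le_left (add_le_add e e'))
  have hdYb : ∀ᵐ t, ‖(Y - Y') t‖ ≤ max (B₁ + B₃) (B₂ + B₄) := by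
    filter_upwards [hYb, hYb'] with t e e'
    exact (norm_sub_le _ _).trans (le_max_of_le_right (add_le_add e e'))
  have hdZ : ∀ᵐ t, t ∈ Icc 0 T → ell ((Z - Z') t) = ∫ τ in (0 : ℝ)..t, (Y - Y') τ := by
    refine (ae_restrict_iff' measurableSet_Icc).1 ?_
    filter_upwards [hZ, hZ', ae_restrict_mem measurableSet_Icc] with t e e' ht
    refine ext_testL2 (a := s) fun φ => ?_
    have hd := h.timeDeriv.sub_eq h'.timeDeriv hu0 ht φ
    rw [e, e', toDist_apply, toDist_apply, ← inner_sub_right, ← inner_testL2_ell] at hd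
    have hi : IntervalIntegrable (Y - Y') volume 0 t := intervalIntegrable_clm_apply
      (L := fun _ => ContinuousLinearMap.id ℂ L2) continuous_const hdYm hdYb 0 t
    rw [← intervalIntegral_inner_right _ hi]
    refine hd.trans (intervalIntegral_congr_ae_Icc ht ?_)
    filter_upwards [hY, hY'] with τ f f'
    rw [f, f', toDist_apply, toDist_apply, ← inner_sub_right]
    rfl
  have hdY : ∀ᵐ t, t ∈ Icc 0 T → ell ((Y - Y') t) = ∫ τ in (0 : ℝ)..t,
      (accZ (s - 3 / 2) k (v τ) ((Z - Z') τ) + accY (s - 3 / 2) k (v τ) ((Y - Y') τ)) := by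
    refine (ae_restrict_iff' measurableSet_Icc).1 ?_
    filter_upwards [hY, hY', ae_restrict_mem measurableSet_Icc] with t e e' ht
    refine ext_testL2 (a := s - 3 / 2) fun φ => ?_
    have hd := h.equation.sub_eq h'.equation hw0 ht φ
    rw [e, e', toDist_apply, toDist_apply, ← inner_sub_right] at hd
    rw [inner_testL2_ell, sub_add_cancel, ← intervalIntegral_inner_right _
      ((intervalIntegrable_clm_apply (continuous_accZ hv.continuous) hdZm hdZb 0 t).add
        (intervalIntegrable_clm_apply (continuous_accY hv.continuous) hdYm hdYb 0 t))]
    refine hd.trans (intervalIntegral_congr_ae_Icc ht ?_)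
    filter_upwards [hZ, hZ', hY, hY', hV] with τ f f' g g' hVτ
    rw [acceleration_eq hk h2 hVτ f g, acceleration_eq hk h2 hVτ f' g', add_sub_add_right_eq_sub,
      ← inner_sub_right, Pi.sub_apply, Pi.sub_apply, map_sub, map_sub]
    congr 1
    abel
  have hz := (ae_restrict_iff' measurableSet_Icc).2
    (eq_zero_of_weak hk h0 h1 h2 hT hb hb' hv hdZm hdYm hdZb hdYb hdZ hdY)
  have hu : ∀ᵐ t ∂(volume.restrict (Icc 0 T)), u t = u' t ∧ w t = w' t := by
    filter_upwards [hz, hZ, hZ', hY, hY'] with t e f f' g g'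
    rw [f, f', g, g', sub_eq_zero.1 e.1, sub_eq_zero.1 e.2]
    exact ⟨rfl, rfl⟩
  -- Almost everywhere equality becomes equality at every time, since each value is the initial
  -- value plus a time integral.
  refine fun t ht => ⟨h.timeDeriv.eq h'.timeDeriv hu0 (hu.mono fun τ e => ?_) ht,
    h.equation.eq h'.equation hw0 (hu.mono fun τ e => ?_) ht⟩
  · rw [e.2]
  · ext φ
    rw [acceleration, acceleration, e.1, e.2]

end Uniqueness

/-! ### The exponential form of the constants -/

section Constants

open MvPolynomial in
/-- The exponent of the energy estimate, as a polynomial in the norms of the coefficient. -/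
def energyPoly (T c : ℝ) : MvPolynomial (Fin 2) ℝ :=
  let M : MvPolynomial (Fin 2) ℝ := C c * X 0
  let M' : MvPolynomial (Fin 2) ℝ := C c * X 1
  let K : MvPolynomial (Fin 2) ℝ := C (1 / 2) + 4 * (1 + M ^ 2) ^ 3
  C T * (2 * (4 * M + 2 * M ^ 2 + 2 * M * M' + 2 * K + 1)) + K +
    C (8 * ((2 * Real.pi) ^ 3 + 1))

lemma eval_energyPoly (T c b b' : ℝ) : MvPolynomial.eval ![b, b'] (energyPoly T c) =
    T * energyRate (c * b) (c * b') + energyCoeff (c * b) + 8 * ((2 * Real.pi) ^ 3 + 1) := by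
  simp [energyPoly, energyRate, energyCoeff]

/-- The prefactor `2EKA` is at least `1`, so it dominates its own square root. Then `K ≤ e^K` and
`8A ≤ e^{8A}` move all factors into the exponent, which explains the shape of `energyPoly`. -/
lemma four_mul_sqrt_energyBound_le {T c b b' ρ : ℝ} (hT : 0 ≤ T) (hc : 0 ≤ c) (hb : 0 ≤ b)
    (hb' : 0 ≤ b') (hρ : 0 ≤ ρ) (Z₀ Y₀ : L2) :
    2 * √(energyBound T (c * b) (c * b') Z₀ Y₀ ρ) + 2 * √(energyBound T (c * b) (c * b') Z₀ Y₀ ρ) ≤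
      Real.exp (MvPolynomial.eval ![b, b'] (energyPoly T c)) * (‖Z₀‖ + ‖Y₀‖ + √ρ) := by
  rw [eval_energyPoly, Real.exp_add, Real.exp_add, energyBound]
  set K := energyCoeff (c * b) with hK
  set A := (2 * Real.pi) ^ 3 + 1 with hA
  set E := Real.exp (energyRate (c * b) (c * b') * T) with hE
  have hK1 : 1 ≤ K := energyCoeff_ge_one _
  have hA1 : 1 ≤ A := by have := Real.pi_pos; rw [hA]; linarith [pow_pos (mul_pos two_pos this) 3]
  have hE1 : 1 ≤ E := by
    refine Real.one_le_exp (mul_nonneg ?_ hT)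
    rw [energyRate, ← hK]
    positivity
  have hx : 1 ≤ 2 * E * K * A := by
    have h1 : 1 ≤ E * K := one_le_mul_of_one_le_of_one_le hE1 hK1
    have h2 : 1 ≤ E * K * A := one_le_mul_of_one_le_of_one_le h1 hA1
    linarith
  set n := ‖Z₀‖ + ‖Y₀‖ + √ρ with hn
  have hn0 : 0 ≤ n := by positivity
  have hsq : K * (‖Y₀‖ ^ 2 + A * ‖Z₀‖ ^ 2) + ρ ≤ K * A * n ^ 2 := by
    have h1 : ‖Y₀‖ ^ 2 + ‖Z₀‖ ^ 2 + ρ ≤ n ^ 2 := by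
      have e := Real.sq_sqrt hρ
      have p1 := mul_nonneg (norm_nonneg Z₀) (norm_nonneg Y₀)
      have p2 := mul_nonneg (norm_nonneg Z₀) (Real.sqrt_nonneg ρ)
      have p3 := mul_nonneg (norm_nonneg Y₀) (Real.sqrt_nonneg ρ)
      rw [hn]; linarith [e]
    have hKA : 1 ≤ K * A := one_le_mul_of_one_le_of_one_le hK1 hA1
    have hKA' : K ≤ K * A := le_mul_of_one_le_right (by linarith) hA1
    calc K * (‖Y₀‖ ^ 2 + A * ‖Z₀‖ ^ 2) + ρ = K * ‖Y₀‖ ^ 2 + K * A * ‖Z₀‖ ^ 2 + 1 * ρ := by ring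
      _ ≤ K * A * ‖Y₀‖ ^ 2 + K * A * ‖Z₀‖ ^ 2 + K * A * ρ := by gcongr
      _ = K * A * (‖Y₀‖ ^ 2 + ‖Z₀‖ ^ 2 + ρ) := by ring
      _ ≤ K * A * n ^ 2 := by gcongr
  have hs : √(2 * E * (K * (‖Y₀‖ ^ 2 + A * ‖Z₀‖ ^ 2) + ρ)) ≤ 2 * E * K * A * n := by
    rw [Real.sqrt_le_left (by positivity)]
    calc 2 * E * (K * (‖Y₀‖ ^ 2 + A * ‖Z₀‖ ^ 2) + ρ) ≤ 2 * E * (K * A * n ^ 2) := by gcongr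
      _ = 1 * (2 * E * K * A) * n ^ 2 := by ring
      _ ≤ (2 * E * K * A) * (2 * E * K * A) * n ^ 2 := by gcongr
      _ = (2 * E * K * A * n) ^ 2 := by ring
  have hK2 : K ≤ Real.exp K := (by linarith : K ≤ K + 1).trans (Real.add_one_le_exp K)
  have hA2 : 8 * A ≤ Real.exp (8 * A) := (by linarith : 8 * A ≤ 8 * A + 1).trans (Real.add_one_le_exp _)
  have hE2 : Real.exp (T * energyRate (c * b) (c * b')) = E := by rw [hE, mul_comm]
  rw [hE2]
  calc _ ≤ 4 * (2 * E * K * A * n) := by linarith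
    _ = E * K * (8 * A) * n := by ring
    _ ≤ E * Real.exp K * Real.exp (8 * A) * n := by gcongr

end Constants

/-! ### Existence with bounds, and the theorem -/

section Existence

/-- Data and force are treated together; the two problems are the cases `G = 0` and `Z₀ = Y₀ = 0`.
-/
theorem exists_solution {s k : ℝ} (hk : 3 ≤ k) (h0 : |s| ≤ k - 1) (h2 : |s - 3 / 2| ≤ k) {T : ℝ}
    (hT : 0 ≤ T) : ∃ P : MvPolynomial (Fin 2) ℝ, ∀ (V : ℝ → ℝ → ℝ) (b b' : ℝ) (v v' : ℝ → L2),
      0 ≤ b → 0 ≤ b' → Coeff T b b' v v' →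
      (∀ᵐ t ∂(volume.restrict (Icc 0 T)), IsMultiplier k (V t) (v t)) →
      ∀ (R : ℝ → 𝓢'(ℝ, ℂ)) (G : ℝ → L2) (Z₀ Y₀ : L2), Integrable G →
      Integrable (fun t => ‖G t‖ ^ 2) →
      (∀ᵐ t ∂(volume.restrict (Icc 0 T)), R t = toDist s (G t)) →
      ∃ u w : ℝ → 𝓢'(ℝ, ℂ), IsSolution T s V R (toDist (s + 3 / 2) Z₀) (toDist s Y₀) u w ∧
        linftyNorm T (s + 3 / 2) u + linftyNorm T s w ≤
          ENNReal.ofReal (Real.exp (MvPolynomial.eval ![b, b'] P)) *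
            (‖Z₀‖ₑ + ‖Y₀‖ₑ + ENNReal.ofReal √(∫ t in (0 : ℝ)..T, ‖G t‖ ^ 2)) := by
  obtain ⟨c, hc, H⟩ := exists_approx hk h0 h2
  refine ⟨energyPoly T c, fun V b b' v v' hb hb' hv hV R G Z₀ Y₀ hG hG2 hR => ?_⟩
  obtain ⟨Zn, Yn, hn⟩ := H T b b' v v' hT hb hb' hv G Z₀ Y₀ hG hG2
  obtain ⟨Z, Y, hZY, rfl, rfl, hZ, hY⟩ := hn.exists_isWeakSolution hT hv.continuous hG
  refine ⟨_, _, hZY.isSolution hk h2 hV hG hR hZ hY, ?_⟩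
  refine (add_le_add (linftyNorm_toDist_le hZ) (linftyNorm_toDist_le hY)).trans ?_
  rw [← ofReal_norm, ← ofReal_norm, ← ENNReal.ofReal_add (by positivity) (by positivity),
    ← ENNReal.ofReal_add (by positivity) (by positivity),
    ← ENNReal.ofReal_add (by positivity) (by positivity), ← ENNReal.ofReal_mul (by positivity)]
  exact ENNReal.ofReal_le_ofReal (four_mul_sqrt_energyBound_le hT hc hb hb'
    (intervalIntegral.integral_nonneg hT fun t _ => by positivity) _ _)

end Existence

end WaterWave

end

theorem mainTheorem10 (T k s : ℝ) (hT : 0 < T) (hk : 3 ≤ k) (hs : 0 ≤ s + 3 / 2)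
    (hsk : s + 3 / 2 ≤ k) :
    ∃ P₁ P₂ : MvPolynomial (Fin 2) ℝ,
      ∀ l : ℕ, 2 ≤ l → ∀ (V : ℝ → ℝ → ℝ) (DV : ℕ → ℝ → 𝓢'(ℝ, ℂ)),
        WaterWave.MemHlHk T l k V DV →
        (∀ u₀ u₁ : 𝓢'(ℝ, ℂ), MemSobolev (s + 3 / 2) 2 u₀ → MemSobolev s 2 u₁ →
          ∃ u w : ℝ → 𝓢'(ℝ, ℂ),
            WaterWave.IsSolution T s V 0 u₀ u₁ u w ∧
            WaterWave.linftyNorm T (s + 3 / 2) u + WaterWave.linftyNorm T s w ≤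
              WaterWave.energyConst P₁ T k DV *
                (WaterWave.sobolevNorm (s + 3 / 2) u₀ + WaterWave.sobolevNorm s u₁) ∧
            ∀ u' w' : ℝ → 𝓢'(ℝ, ℂ), WaterWave.IsSolution T s V 0 u₀ u₁ u' w' →
              ∀ t ∈ Icc 0 T, u' t = u t ∧ w' t = w t) ∧
        (∀ R : ℝ → 𝓢'(ℝ, ℂ), WaterWave.MemL2 T s R →
          ∃ v w : ℝ → 𝓢'(ℝ, ℂ),
            WaterWave.IsSolution T s V R 0 0 v w ∧
            WaterWave.linftyNorm T s w + WaterWave.linftyNorm T (s + 3 / 2) v ≤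
              WaterWave.energyConst P₂ T k DV * WaterWave.l2Norm T s R ∧
            ∀ v' w' : ℝ → 𝓢'(ℝ, ℂ), WaterWave.IsSolution T s V R 0 0 v' w' →
              ∀ t ∈ Icc 0 T, v' t = v t ∧ w' t = w t) := by
  open WaterWave in
  -- The levels in use: `s` for existence, `s - 1/2` for the energy of a difference, `s - 1` for its
  -- remainder, `s - 3/2` for the equation itself. At `s = -3/2` the second and the last require
  -- exactly `k ≥ 3`.
  have a0 : |s| ≤ k - 1 := abs_le.2 ⟨by linarith, by linarith⟩
  have a1 : |s - 1 / 2| ≤ k - 1 := abs_le.2 ⟨by linarith, by linarith⟩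
  have a2 : |s - 1| ≤ k := abs_le.2 ⟨by linarith, by linarith⟩
  have a3 : |s - 3 / 2| ≤ k := abs_le.2 ⟨by linarith, by linarith⟩
  have toDist_zero : ∀ a, toDist a 0 = 0 := fun a => by
    ext φ
    rw [toDist_apply, inner_zero_right]; rfl
  obtain ⟨P, hP⟩ := exists_solution hk a0 a3 hT.le
  refine ⟨P, P, fun l hl V DV h => ?_⟩
  obtain ⟨v, v', hv, hV⟩ := h.exists_coeff hT (by linarith) hl
  have hb : 0 ≤ (linftyNorm T k (DV 0)).toReal := ENNReal.toReal_nonneg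
  have hb' : 0 ≤ (linftyNorm T k (DV 1)).toReal := ENNReal.toReal_nonneg
  refine ⟨fun u₀ u₁ hu₀ hu₁ => ?_, fun R hR => ?_⟩
  · obtain ⟨Z₀, rfl⟩ := exists_eq_toDist hu₀
    obtain ⟨Y₀, rfl⟩ := exists_eq_toDist hu₁
    obtain ⟨u, w, h1, h2⟩ := hP V _ _ v v' hb hb' hv hV 0 (fun _ => 0) Z₀ Y₀ (integrable_zero _ _ _)
      (by simp) (ae_of_all _ fun t => by rw [toDist_zero]; rfl)
    refine ⟨u, w, h1, ?_, fun u' w' h' =>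
      IsSolution.unique hk a1 a2 a3 hT.le hb hb' hv hV h' h1⟩
    simpa [sobolevNorm_toDist, energyConst] using h2
  · obtain ⟨G, -, -, hG, hi, hi2, hn⟩ := hR.exists_repr
    obtain ⟨u, w, h1, h2⟩ := hP V _ _ v v' hb hb' hv hV R G 0 0 hi hi2 hG
    rw [toDist_zero, toDist_zero] at h1
    refine ⟨u, w, h1, ?_, fun u' w' h' =>
      IsSolution.unique hk a1 a2 a3 hT.le hb hb' hv hV h' h1⟩
    rw [hn] at h2
    rw [add_comm]
    simpa [energyConst] using h2
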